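/- Let $a>0$. Let $\psi_n(x,t)$, $n\ge 0$, be the orthonormal basis of $L^2(\mathbb R)$ of solutions of the free Schrödinger equation $i\partial_t\psi=-\partial_x^2\psi$ given by $$\psi_0(x,t)=(2\pi)^{-1/4}(1+it)^{-1/2}e^{-x^2/(4(1+it))},\qquad \sqrt{n+1}\,\psi_{n+1}=\bigl((i+t)\partial_x-\tfrac{ix}{2}\bigr)\psi_n .$$ Let $L=-a\tanh(ax)+\partial_x$, $\varphi_n=L\psi_n$, $g_0=-\partial_x^2+a^2$, let $\bar L$ and $\bar g_0$ be the closures of $L$ and $g_0$ from the linear span of the $\psi_n(\cdot,s)$ at an instant $s$, and let $H_1\subset L^2(\mathbb R)$ be the closed linear span of the $\varphi_n(\cdot,s)$. Define $\bar L^+$ in $H_1$ by $\bar L^+(\bar L\psi)=\bar g_0\psi$ for $\psi$ in the domain of $\bar g_0$, and put $M=(\bar L^+)^{-1}$; $M$ is defined on all of $L^2(\mathbb R)$, and $H_1$ and $M$ do not depend on $s$. For $z\in\mathbb C$ put $\psi_z=\Phi\sum_n a_nz^n\psi_n$ with $\Phi=e^{-|z|^2/2}$ and $a_n=(n!)^{-1/2}$,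 and put $\eta_n=M\psi_n$. Theorem. The vectors $\eta_z=M\psi_z=\Phi\sum_n a_nz^n\eta_n$, $z\in\mathbb C$, are coherent states in Klauder's sense for the soliton Hamiltonian $h_1=-\partial_x^2-2a^2\,\mathrm{sech}^2(ax)$ on $H_1$. That is, for every $z$ and every time $t$, $\eta_z(t)$ lies in the domain of $h_1$ and $i\,\partial_t\eta_z=h_1\eta_z$; and at every time $t$, $$\int_{\mathbb C}d\mu_\eta(z)\,|\eta_z\rangle\langle\eta_z|=\mathbb I_{H_1}$$ in the weak sense, with absolutely convergent integrals, where $d\mu_\eta$ is the real Radon measure $$d\mu_\eta=\omega_\eta(x)\,dx\,dy,\qquad \omega_\eta(x)=\frac1\pi\Bigl(x^2+a^2-\frac14\Bigr),\qquad z=x+iy$$ (a positive measure if $a\ge\frac12$, a signed one if $a<\frac12$). Every real (signed) Radon measure $d\mu$ on $\mathbb C$ that gives this resolution of the identity in terms of the $\eta_z(t)$, at some $t$, equals $d\mu_\eta$ and solves the moment problem in the complex plane $$a_na_k\int_{\mathbb C}d\mu\,|\Phi|^2z^n\bar z^k=S_{nk},\qquad n,k\ge 0,$$ where $S_{nk}=\langle\varphi_n|\varphi_k\rangle=\langle\psi_n|g_0|\psi_k\rangle$.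 -/

import Mathlib

open MeasureTheory Polynomial

noncomputable section

namespace DarbouxCS

/-! ### Signed Radon measures on a planar domain -/

/-- A real (signed) Radon measure on `D ⊆ ℂ`, given by its Jordan decomposition: it is defined and
finite on the Borel sets that are contained in a compact subset of `D`. -/
structure SignedRadonMeasure (D : Set ℂ) where
  /-- the positive part -/
  pos : Measure ℂ
  /-- the negative part -/
  neg : Measure ℂ
  pos_compl : pos Dᶜ = 0
  neg_compl : neg Dᶜ = 0
  pos_lt_top : ∀ K : Set ℂ, K ⊆ D → IsCompact K → pos K < ⊤
  neg_lt_top : ∀ K : Set ℂ, K ⊆ D → IsCompact K → neg K < ⊤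
  mutuallySingular : Measure.MutuallySingular pos neg

namespace SignedRadonMeasure

variable {D : Set ℂ}

/-- The value of the measure on a (relatively compact Borel) set. -/
def value (μ : SignedRadonMeasure D) (B : Set ℂ) : ℝ :=
  (μ.pos B).toReal - (μ.neg B).toReal

/-- Absolute integrability: integrability with respect to the total variation `pos + neg`. -/
def AbsIntegrable (μ : SignedRadonMeasure D) (f : ℂ → ℂ) : Prop :=
  Integrable f μ.pos ∧ Integrable f μ.neg

/-- The integral with respect to a signed Radon measure. -/
def integral (μ : SignedRadonMeasure D) (f : ℂ → ℂ) : ℂ :=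
  (∫ z, f z ∂μ.pos) - ∫ z, f z ∂μ.neg

/-- `∫_D dμ |v_z⟩⟨v_z| = 𝕀`, in the weak sense with absolutely convergent integrals. -/
def ResolvesIdentity {H : Type*} [NormedAddCommGroup H] [InnerProductSpace ℂ H]
    (μ : SignedRadonMeasure D) (v : ℂ → H) : Prop :=
  ∀ f g : H,
    μ.AbsIntegrable (fun z => inner ℂ f (v z) * inner ℂ (v z) g) ∧
    μ.integral (fun z => inner ℂ f (v z) * inner ℂ (v z) g) = inner ℂ f g

/-- The signed Radon measure `w(z) dx dy` on `ℂ` with continuous real density `w`. -/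
def ofDensity (w : ℂ → ℝ) (hw : Continuous w) : SignedRadonMeasure Set.univ where
  pos := volume.withDensity fun z => ENNReal.ofReal (w z)
  neg := volume.withDensity fun z => ENNReal.ofReal (-w z)
  pos_compl := by simp
  neg_compl := by simp
  pos_lt_top := fun K _ hK => by
    have := IsLocallyFiniteMeasure.withDensity_ofReal (μ := (volume : Measure ℂ)) hw
    exact hK.measure_lt_top
  neg_lt_top := fun K _ hK => by
    have := IsLocallyFiniteMeasure.withDensity_ofReal (μ := (volume : Measure ℂ)) hw.neg
    exact hK.measure_lt_top
  mutuallySingular := withDensity_ofReal_mutuallySingular hw.measurable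

end SignedRadonMeasure

/-! ### Coherent states -/

/-- A family `ψ z t` (label `z`, time `t`) of vectors of the Hilbert space `H` is a system of
coherent states, in Klauder's sense, of the Hamiltonian `h`, with label domain `D` and measure `μ`:
`D` is a domain in `ℂ`, the measure `μ` on `D` resolves the identity of `H` (at every time), and
every `ψ z` stays in the domain of `h` and solves `i ∂ₜ ψ = h ψ`. -/
structure IsCoherentSystem {H : Type*} [NormedAddCommGroup H] [InnerProductSpace ℂ H]
    [CompleteSpace H] (h : H →ₗ.[ℂ] H) (D : Set ℂ) (μ : SignedRadonMeasure D)
    (ψ : ℂ → ℝ → H) : Prop where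
  isOpen : IsOpen D
  isConnected : IsConnected D
  resolution : ∀ t : ℝ, μ.ResolvesIdentity (fun z => ψ z t)
  schrodinger : ∀ z ∈ D, ∀ t : ℝ, ∃ hz : ψ z t ∈ h.domain,
    ∃ ψ' : H, HasDerivAt (ψ z) ψ' t ∧ Complex.I • ψ' = h ⟨ψ z t, hz⟩

/-! ### The free-particle basis -/

/-- The Hilbert space `L²(ℝ)`. -/
abbrev L2 : Type := Lp ℂ 2 (volume : Measure ℝ)

/-- The raising operator `a⁺ = (i + t) ∂ₓ - i x / 2`. -/
def raising (t : ℝ) (f : ℝ → ℂ) (x : ℝ) : ℂ :=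
  (Complex.I + t) * deriv f x - Complex.I * x / 2 * f x

/-- The free-particle basis functions `ψₙ(x,t)`: `ψ₀` is the normalized solution of the free
Schrödinger equation `i ∂ₜ ψ = - ∂ₓ² ψ` annihilated by `(i - t) ∂ₓ + i x / 2`, and
`a⁺ ψₙ = √(n+1) ψₙ₊₁`. -/
def psiFun : ℕ → ℝ → ℝ → ℂ
  | 0, t, x => (((2 * Real.pi) ^ (-(1 / 4) : ℝ) : ℝ) : ℂ) *
      (1 + Complex.I * t) ^ (-(1 / 2) : ℂ) * Complex.exp (-(x : ℂ) ^ 2 / (4 * (1 + Complex.I * t)))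
  | n + 1, t, x => ((Real.sqrt (n + 1))⁻¹ : ℂ) * raising t (psiFun n t) x

/-- The Darboux transformation operator `L = - a th(a x) + ∂ₓ`. -/
def darboux (a : ℝ) (f : ℝ → ℂ) (x : ℝ) : ℂ :=
  -((a * Real.tanh (a * x) : ℝ) : ℂ) * f x + deriv f x

/-- The operator `g₀ = h₀ + a² = - ∂ₓ² + a²`. -/
def gZeroFun (a : ℝ) (f : ℝ → ℂ) (x : ℝ) : ℂ :=
  -deriv (deriv f) x + (a : ℂ) ^ 2 * f x

/-- Polynomial multiples of the Gaussian `exp (-x² / (4 (1 + i t)))`. -/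
def IsPolyGauss (t : ℝ) (f : ℝ → ℂ) : Prop :=
  ∃ p : ℂ[X], f = fun x : ℝ =>
    p.eval (x : ℂ) * Complex.exp (-(x : ℂ) ^ 2 / (4 * (1 + Complex.I * t)))

theorem IsPolyGauss.deriv {t : ℝ} {f : ℝ → ℂ} (hf : IsPolyGauss t f) :
    IsPolyGauss t (deriv f) := by
  obtain ⟨p, rfl⟩ := hf
  refine ⟨Polynomial.derivative p + p * (C (-(1 / (2 * (1 + Complex.I * t)))) * X), ?_⟩
  funext x
  have h1 : HasDerivAt (fun y : ℂ => p.eval y) ((Polynomial.derivative p).eval (x : ℂ)) (x : ℂ) :=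
    p.hasDerivAt _
  have h2 : HasDerivAt (fun y : ℂ => -y ^ 2 / (4 * (1 + Complex.I * t)))
      (-(2 * (x : ℂ)) / (4 * (1 + Complex.I * t))) (x : ℂ) := by
    simpa using ((hasDerivAt_pow 2 (x : ℂ)).neg.div_const (4 * (1 + Complex.I * t)))
  have h3 := (h1.mul h2.cexp).comp_ofReal
  rw [show _root_.deriv (fun x : ℝ => p.eval (x : ℂ) *
    Complex.exp (-(x : ℂ) ^ 2 / (4 * (1 + Complex.I * t)))) x = _ from h3.deriv]
  simp only [eval_add, eval_mul, eval_C, eval_X]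
  have h4 : -(2 * (x : ℂ)) / (4 * (1 + Complex.I * t)) = -(1 / (2 * (1 + Complex.I * t))) * x := by
    rw [show (4 * (1 + Complex.I * t)) = 2 * (2 * (1 + Complex.I * (t : ℂ))) by ring,
      neg_div, mul_div_mul_left _ _ two_ne_zero]
    ring
  rw [h4]
  ring

theorem isPolyGauss_psiFun (n : ℕ) (t : ℝ) : IsPolyGauss t (psiFun n t) := by
  induction n with
  | zero =>
    refine ⟨C ((((2 * Real.pi) ^ (-(1 / 4) : ℝ) : ℝ) : ℂ) *
      (1 + Complex.I * t) ^ (-(1 / 2) : ℂ)), ?_⟩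
    funext x
    simp only [psiFun, eval_C]
  | succ n ih =>
    obtain ⟨q, hq⟩ := ih.deriv
    obtain ⟨p, hp⟩ := ih
    refine ⟨C ((Real.sqrt (n + 1))⁻¹ : ℂ) *
      (C (Complex.I + t) * q - C (Complex.I / 2) * X * p), ?_⟩
    funext x
    simp only [psiFun, raising, hq, eval_mul, eval_sub, eval_C, eval_X]
    rw [hp]
    ring

theorem IsPolyGauss.memLp {t : ℝ} {f : ℝ → ℂ} (hf : IsPolyGauss t f) :
    MemLp f 2 (volume : Measure ℝ) := by
  obtain ⟨p, rfl⟩ := hf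
  induction p using Polynomial.induction_on' with
  | add p q hp hq =>
    simp only [eval_add, add_mul]
    exact hp.add hq
  | monomial n c =>
    have hc : Continuous (fun x : ℝ => (monomial n c).eval (x : ℂ) *
        Complex.exp (-(x : ℂ) ^ 2 / (4 * (1 + Complex.I * t)))) := by
      simp only [eval_monomial]
      fun_prop
    rw [memLp_two_iff_integrable_sq_norm hc.aestronglyMeasurable]
    have hb : 0 < 1 / (2 * (1 + t ^ 2)) := by positivity
    have h := (integrable_rpow_mul_exp_neg_mul_sq hb (s := ((2 * n : ℕ) : ℝ))
      (by have : (0 : ℝ) ≤ ((2 * n : ℕ) : ℝ) := Nat.cast_nonneg _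
          linarith)).const_mul (‖c‖ ^ 2)
    refine h.congr (Filter.Eventually.of_forall fun x => ?_)
    have hre : (-(x : ℂ) ^ 2 / (4 * (1 + Complex.I * t))).re = -(1 / (4 * (1 + t ^ 2))) * x ^ 2 := by
      have : (-(x : ℂ) ^ 2 / (4 * (1 + Complex.I * t)))
          = ((-(1 / (4 * (1 + t ^ 2))) * x ^ 2 : ℝ) : ℂ) * (1 - Complex.I * t) := by
        have h1 : (1 + Complex.I * t : ℂ) ≠ 0 := by
          intro h0
          have := congrArg Complex.re h0
          simp at this
        have h2 : (1 + (t : ℂ) ^ 2) ≠ 0 := by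
          have : (0 : ℝ) < 1 + t ^ 2 := by positivity
          exact_mod_cast this.ne'
        push_cast
        field_simp
        ring_nf
        simp only [Complex.I_sq]
        ring
      rw [this, Complex.re_ofReal_mul]
      simp
    simp only [eval_monomial, norm_mul, norm_pow, Complex.norm_exp, hre, Complex.norm_real,
      Real.rpow_natCast, Real.norm_eq_abs]
    rw [mul_pow, mul_pow, ← pow_mul, ← Real.exp_nat_mul, mul_comm n 2, pow_mul, pow_mul, sq_abs]
    have : -(1 / (2 * (1 + t ^ 2))) * x ^ 2
        = ((2 : ℕ) : ℝ) * (-(1 / (4 * (1 + t ^ 2))) * x ^ 2) := by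
      push_cast
      field_simp
      ring
    rw [this]
    ring

theorem memLp_psiFun (n : ℕ) (t : ℝ) : MemLp (psiFun n t) 2 (volume : Measure ℝ) :=
  (isPolyGauss_psiFun n t).memLp

theorem memLp_darboux (a : ℝ) (n : ℕ) (t : ℝ) :
    MemLp (darboux a (psiFun n t)) 2 (volume : Measure ℝ) := by
  have h1 := (memLp_psiFun n t)
  have h2 := (isPolyGauss_psiFun n t).deriv.memLp
  have hc : Continuous fun x : ℝ => -((a * Real.tanh (a * x) : ℝ) : ℂ) := by
    have : Continuous Real.tanh := by
      rw [show Real.tanh = fun x => Real.sinh x / Real.cosh x from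
        funext Real.tanh_eq_sinh_div_cosh]
      exact Real.continuous_sinh.div Real.continuous_cosh fun x => (Real.cosh_pos x).ne'
    fun_prop
  have h3 : MemLp (fun x : ℝ => -((a * Real.tanh (a * x) : ℝ) : ℂ) * psiFun n t x) 2 volume := by
    refine MemLp.of_le_mul (c := |a|) h1 (hc.aestronglyMeasurable.mul h1.1)
      (Filter.Eventually.of_forall fun x => ?_)
    rw [norm_mul, norm_neg, Complex.norm_real, Real.norm_eq_abs, abs_mul]
    have : |Real.tanh (a * x)| ≤ 1 := (Real.abs_tanh_lt_one _).le
    gcongr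
    exact mul_le_of_le_one_right (abs_nonneg a) this
  exact h3.add h2

theorem memLp_gZeroFun (a : ℝ) (n : ℕ) (t : ℝ) :
    MemLp (gZeroFun a (psiFun n t)) 2 (volume : Measure ℝ) :=
  (isPolyGauss_psiFun n t).deriv.deriv.memLp.neg.add ((memLp_psiFun n t).const_mul _)

/-- The vector `ψₙ(·,t)` of `L²(ℝ)`. -/
def psi (n : ℕ) (t : ℝ) : L2 := (memLp_psiFun n t).toLp _

/-- The vector `φₙ(·,t) = L ψₙ(·,t)`. -/
def phi (a : ℝ) (n : ℕ) (t : ℝ) : L2 := (memLp_darboux a n t).toLp _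

/-- The vector `g₀ ψₙ(·,t)`. -/
def gPsi (a : ℝ) (n : ℕ) (t : ℝ) : L2 := (memLp_gZeroFun a n t).toLp _

/-! ### The operators `L̄`, `ḡ₀`, `L̄⁺` and `M`

The initial lineal is `ℒ₀ = span {ψₙ(·,s)}`, taken at an arbitrary instant `s`. -/

/-- The lineal `ℒ₁ = span {φₙ(·,s)}`. -/
def lineal1 (a s : ℝ) : Submodule ℂ L2 := Submodule.span ℂ (Set.range fun n => phi a n s)

/-- The Hilbert space `H₁`, the closure of `ℒ₁`. -/
abbrev H1 (a s : ℝ) : Submodule ℂ L2 := (lineal1 a s).topologicalClosure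

/-- `φₙ(·,s)` as an element of `H₁`. -/
def phiH1 (a : ℝ) (n : ℕ) (s : ℝ) : H1 a s :=
  ⟨phi a n s, (lineal1 a s).le_topologicalClosure (Submodule.subset_span ⟨n, rfl⟩)⟩

/-- `L` on the lineal `ℒ₀`: the linear operator with `L ψₙ = φₙ`. -/
def Lmin (a s : ℝ) : L2 →ₗ.[ℂ] H1 a s :=
  (Submodule.span ℂ (Set.range fun n => (psi n s, phiH1 a n s))).toLinearPMap

/-- `L̄`, the closure of `L`. -/
def Lbar (a s : ℝ) : L2 →ₗ.[ℂ] H1 a s := (Lmin a s).closure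

/-- `g₀ = - ∂ₓ² + a²` on the lineal `ℒ₀`. -/
def gZeroMin (a s : ℝ) : L2 →ₗ.[ℂ] L2 :=
  (Submodule.span ℂ (Set.range fun n => (psi n s, gPsi a n s))).toLinearPMap

/-- `ḡ₀`, the closure of `g₀`. -/
def gZeroBar (a s : ℝ) : L2 →ₗ.[ℂ] L2 := (gZeroMin a s).closure

/-- The graph `{(L̄ψ, ḡ₀ψ)}`, `ψ` in the domain of `ḡ₀`. -/
def LbarPlusGraph (a s : ℝ) : Submodule ℂ (H1 a s × L2) where
  carrier := {p | ∃ ψ : L2, (ψ, p.1) ∈ (Lbar a s).graph ∧ (ψ, p.2) ∈ (gZeroBar a s).graph}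
  zero_mem' := ⟨0, Submodule.zero_mem _, Submodule.zero_mem _⟩
  add_mem' := by
    rintro p q ⟨f, hf, hf'⟩ ⟨g, hg, hg'⟩
    exact ⟨f + g, Submodule.add_mem _ hf hg, Submodule.add_mem _ hf' hg'⟩
  smul_mem' := by
    rintro c p ⟨f, hf, hf'⟩
    exact ⟨c • f, Submodule.smul_mem _ c hf, Submodule.smul_mem _ c hf'⟩

/-- The operator `L̄⁺` in `H₁`, `L̄⁺ (L̄ψ) = ḡ₀ψ`. -/
def LbarPlus (a s : ℝ) : H1 a s →ₗ.[ℂ] L2 := (LbarPlusGraph a s).toLinearPMap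

/-- `M = (L̄⁺)⁻¹`. -/
def M (a s : ℝ) : L2 →ₗ.[ℂ] H1 a s := (LbarPlus a s).inverse

open Classical in
/-- The value `M f`, by convention `0` off the domain of `M`. -/
def applyM (a s : ℝ) (f : L2) : H1 a s :=
  if hf : f ∈ (M a s).domain then M a s ⟨f, hf⟩ else 0

/-! ### The vectors `ψ_z`, `ηₙ`, `η_z` -/

/-- `Φ(z) = exp (- z z̄ / 2)`. -/
def Phi (z : ℂ) : ℝ := Real.exp (-‖z‖ ^ 2 / 2)

/-- `aₙ = (n!)^(-1/2)`. -/
def coef (n : ℕ) : ℝ := (Real.sqrt (n.factorial : ℝ))⁻¹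

/-- The free-particle coherent state `ψ_z = Φ ∑ₙ aₙ zⁿ ψₙ` at time `t`. -/
def psiZ (z : ℂ) (t : ℝ) : L2 :=
  (Phi z : ℂ) • ∑' n : ℕ, ((coef n : ℂ) * z ^ n) • psi n t

/-- `ηₙ = M ψₙ` at time `t`. -/
def etaN (a s : ℝ) (n : ℕ) (t : ℝ) : H1 a s := applyM a s (psi n t)

/-- `η_z = M ψ_z` at time `t`. -/
def etaZ (a s : ℝ) (z : ℂ) (t : ℝ) : H1 a s := applyM a s (psiZ z t)

/-! ### The soliton Hamiltonian -/

/-- The soliton potential `V₁(x) = - 2 a² sech²(a x)`. -/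
def solitonPotential (a x : ℝ) : ℝ := -2 * a ^ 2 / Real.cosh (a * x) ^ 2

/-- Pairs `(θ, - θ'' + V θ)` with `θ` a test function (smooth, compactly supported). -/
def testPairs (V : ℝ → ℝ) : Set (L2 × L2) :=
  {p | ∃ θ : ℝ → ℂ, ContDiff ℝ (⊤ : ℕ∞) θ ∧ HasCompactSupport θ ∧
    p.1 =ᵐ[volume] θ ∧ p.2 =ᵐ[volume] fun x => -deriv (deriv θ) x + V x * θ x}

/-- The graph of the Schrödinger operator `- ∂ₓ² + V` in `L²(ℝ)` on its maximal domain: the pairs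
`(f, g)` in `L²(ℝ)` with `- f'' + V f = g` in the sense of distributions. -/
def schrodingerGraph (V : ℝ → ℝ) : Submodule ℂ (L2 × L2) where
  carrier := {p | ∀ θ ∈ testPairs V, inner ℂ θ.2 p.1 = inner ℂ θ.1 p.2}
  zero_mem' := fun θ _ => by simp
  add_mem' := by
    intro p q hp hq θ hθ
    simp only [Prod.fst_add, Prod.snd_add, inner_add_right, hp θ hθ, hq θ hθ]
  smul_mem' := by
    intro c p hp θ hθ
    simp only [Prod.smul_fst, Prod.smul_snd, inner_smul_right, hp θ hθ]

/-- The Hamiltonian `h₁ = - ∂ₓ² + V₁(x)` as an operator in the Hilbert space `H₁`. -/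
def hOne (a s : ℝ) : H1 a s →ₗ.[ℂ] H1 a s :=
  ((schrodingerGraph (solitonPotential a)).comap
    ((H1 a s).subtype.prodMap (H1 a s).subtype)).toLinearPMap

/-! ### The measure and its moments -/

/-- The density `ω_η(x) = (1/π) (x² + a² - 1/4)`. -/
def omegaEta (a x : ℝ) : ℝ := 1 / Real.pi * (x ^ 2 + a ^ 2 - 1 / 4)

/-- The measure `dμ_η = ω_η(x) dx dy`, `z = x + i y`. -/
def muEta (a : ℝ) : SignedRadonMeasure Set.univ :=
  SignedRadonMeasure.ofDensity (fun z => omegaEta a z.re) (by unfold omegaEta; fun_prop)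

/-- The moments `S_{nk} = ⟨φₙ|φₖ⟩₁ = ⟨ψₙ|ḡ₀|ψₖ⟩₀`, with the vectors taken at time `t`. -/
def S (a : ℝ) (t : ℝ) (n k : ℕ) : ℂ := inner ℂ (psi n t) (gPsi a k t)

/-- The complex moment problem: `aₙ aₖ ∫ dμ |Φ|² zⁿ z̄ᵏ = s n k` for all `n`, `k`. -/
def SolvesMomentProblem (μ : SignedRadonMeasure Set.univ) (s : ℕ → ℕ → ℂ) : Prop :=
  ∀ n k : ℕ,
    μ.AbsIntegrable (fun z => (Phi z : ℂ) ^ 2 * z ^ n * (starRingEnd ℂ z) ^ k) ∧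
    (coef n : ℂ) * coef k *
      μ.integral (fun z => (Phi z : ℂ) ^ 2 * z ^ n * (starRingEnd ℂ z) ^ k) = s n k

end DarbouxCS

end

open MeasureTheory DarbouxCS

noncomputable section

namespace DarbouxCS

open Polynomial SchwartzMap Topology Filter FourierTransform

/-! ### Operators on the Schwartz space -/

/-! The superpotential W = a tanh(ax) satisfies W' + W² = a². Hence g₀ = L⁺L and h₁ + a² = LL⁺, with
L⁺ the formal adjoint of L, and L intertwines h₀ = -∂² with h₁ (`darbouxAdjS_darbouxS`,
`solitonS_darbouxS`). Since ‖Lf‖² = ‖f'‖² + a²‖f‖², both L and g₀ are bounded below. On Schwartz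
functions g₀ is onto by the Fourier transform, so its closure is a bijection onto L². Thus M = L̄
ḡ₀⁻¹ is bounded and everywhere defined, and ⟨L̄v, Mf⟩ = ⟨v, f⟩ (`inner_applyM`). Nothing depends on
the instant s. The coefficients of a Schwartz function in the ψₙ decay fast while ‖g₀ψₙ‖ grows
linearly, so the span of the ψₙ(·,s) has the same graph closures as the whole Schwartz space
(`topologicalClosure_tripleSpan`).

Evolution: the raising operator maps free solutions to free solutions, the series of ψ_z may be
differentiated termwise, and h₁M = Mh₀ passes to the limit because the graph of h₁ is closed.

Resolution: for f = L̄v and g = L̄w the duality gives ⟨f, η_z⟩⟨η_z, g⟩ = ⟨v, ψ_z⟩⟨ψ_z, w⟩, so the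
claim is that the weight ω_η represents the form ⟨L̄v, L̄w⟩ of g₀. With A, A⁺ the ladder operators,
-∂² = (A + A⁺)²/4 = (A² + 2AA⁺ + A⁺²)/4 - 1/4, and the first term is the anti-Wick quantization of
x² = (z + z̄)²/4. This explains the density x² + a² - 1/4; on basis vectors it is a comparison of
Gaussian moments (`coef_mul_integral_eq`). The extension to all of H₁ is by closure: the L² norms of
⟨ψ_z, v⟩ and x⟨ψ_z, v⟩ are controlled by ‖v‖ and ‖L̄v‖ (`norm_bargmannSpan_le`), whatever the sign
of a² - 1/4.

Uniqueness: for f = L̄ψ_w and g = L̄ψ_{-w} the integrand is a nonzero constant times Φ(z)² exp(2i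
Im(w̄z)). A resolution of the identity therefore prescribes the characteristic function of the
finite signed measure Φ²dμ, hence μ. Testing on φₙ, φₖ gives the moment problem. -/

/-- The embedding of the Schwartz space into `L²(ℝ)`. -/
def toL2 : 𝓢(ℝ, ℂ) →L[ℂ] L2 := SchwartzMap.toLpCLM ℂ ℂ 2 volume

theorem toL2_coeFn (f : 𝓢(ℝ, ℂ)) : (toL2 f : ℝ → ℂ) =ᵐ[volume] f := f.coeFn_toLp 2 volume

theorem toL2_eq_toLp {f : 𝓢(ℝ, ℂ)} {g : ℝ → ℂ} (hg : MemLp g 2 (volume : Measure ℝ))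
    (h : ⇑f = g) : toL2 f = hg.toLp g := by
  subst h
  rfl

theorem inner_toL2 (f g : 𝓢(ℝ, ℂ)) :
    inner ℂ (toL2 f) (toL2 g) = ∫ x, g x * starRingEnd ℂ (f x) := by
  refine (inner_toL2_toL2_eq f g volume).trans ?_
  simp only [RCLike.inner_apply]

theorem denseRange_toL2 : DenseRange toL2 := by
  have := SchwartzMap.denseRange_toLpCLM (E := ℝ) (F := ℂ) (p := 2) (μ := volume) (by simp)
  exact this

/-- The complex conjugate of a Schwartz function. -/
def conjS : 𝓢(ℝ, ℂ) →L[ℝ] 𝓢(ℝ, ℂ) :=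
  SchwartzMap.postcompCLM (Complex.conjCLE : ℂ →L[ℝ] ℂ)

theorem conjS_apply (f : 𝓢(ℝ, ℂ)) (x : ℝ) : conjS f x = starRingEnd ℂ (f x) := rfl

/-- Differentiation. -/
def dS : 𝓢(ℝ, ℂ) →L[ℂ] 𝓢(ℝ, ℂ) := SchwartzMap.derivCLM ℂ ℂ

theorem dS_apply (f : 𝓢(ℝ, ℂ)) (x : ℝ) : dS f x = deriv f x := rfl

theorem dS_coe (f : 𝓢(ℝ, ℂ)) : ⇑(dS f) = deriv f := rfl

/-- Multiplication by a real function. -/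
def mulS (w : ℝ → ℝ) : 𝓢(ℝ, ℂ) →L[ℂ] 𝓢(ℝ, ℂ) :=
  SchwartzMap.smulLeftCLM ℂ (fun x => (w x : ℂ))

theorem mulS_apply {w : ℝ → ℝ} (hw : w.HasTemperateGrowth) (f : 𝓢(ℝ, ℂ)) (x : ℝ) :
    mulS w f x = w x * f x := by
  have : (fun x => (w x : ℂ)).HasTemperateGrowth := by fun_prop
  simp [mulS, this]

theorem inner_mulS {w : ℝ → ℝ} (hw : w.HasTemperateGrowth) (f g : 𝓢(ℝ, ℂ)) :
    inner ℂ (toL2 f) (toL2 (mulS w g)) = inner ℂ (toL2 (mulS w f)) (toL2 g) := by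
  simp only [inner_toL2, mulS_apply hw]
  congr 1 with x
  simp
  ring

theorem inner_dS (f g : 𝓢(ℝ, ℂ)) :
    inner ℂ (toL2 f) (toL2 (dS g)) = -inner ℂ (toL2 (dS f)) (toL2 g) := by
  simp only [inner_toL2]
  have h := SchwartzMap.integral_mul_deriv_eq_neg_deriv_mul (conjS f) g
  have h2 : ∀ x, deriv (conjS f) x = starRingEnd ℂ (deriv f x) := fun x => by
    have : ⇑(conjS f) = fun x => starRingEnd ℂ (f x) := rfl
    rw [this]
    exact ((f.hasDerivAt x).star).deriv
  simp only [h2, conjS_apply] at h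
  simp only [dS_apply]
  simpa only [mul_comm] using h

theorem dS_mulS {w w' : ℝ → ℝ} (hw : w.HasTemperateGrowth) (hw' : w'.HasTemperateGrowth)
    (h : ∀ x, HasDerivAt w (w' x) x) (f : 𝓢(ℝ, ℂ)) :
    dS (mulS w f) = mulS w' f + mulS w (dS f) := by
  ext x
  have h1 : ⇑(mulS w f) = fun x => (w x : ℂ) * f x := funext fun x => mulS_apply hw f x
  have h2 := ((h x).ofReal_comp.mul (f.hasDerivAt x)).deriv
  rw [dS_apply, h1]
  refine h2.trans ?_
  simp [mulS_apply hw, mulS_apply hw', dS_apply]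

/-! ### The operators of the Darboux transformation on the Schwartz space -/

theorem abs_tanh_le_one (x : ℝ) : |Real.tanh x| ≤ 1 := (Real.abs_tanh_lt_one x).le

theorem hasDerivAt_tanh (x : ℝ) : HasDerivAt Real.tanh (1 - Real.tanh x ^ 2) x := by
  have h := (Real.hasDerivAt_sinh x).div (Real.hasDerivAt_cosh x) (Real.cosh_pos x).ne'
  have h2 : Real.tanh = fun x => Real.sinh x / Real.cosh x := funext Real.tanh_eq_sinh_div_cosh
  rw [h2]
  convert! h using 1
  have := (Real.cosh_pos x).ne'
  field_simp

/-- Since tanh' = 1 - tanh², polynomials in tanh are stable under differentiation; as |tanh| ≤ 1,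
every derivative is then bounded. -/
theorem exists_iteratedDeriv_tanh (n : ℕ) :
    ∃ p : ℝ[X], iteratedDeriv n Real.tanh = fun x => p.eval (Real.tanh x) := by
  induction n with
  | zero => exact ⟨X, by simp⟩
  | succ n ih =>
    obtain ⟨p, hp⟩ := ih
    refine ⟨derivative p * (1 - X ^ 2), ?_⟩
    rw [iteratedDeriv_succ, hp]
    funext x
    have := (p.hasDerivAt (Real.tanh x)).comp x (hasDerivAt_tanh x)
    simpa [Function.comp_def] using this.deriv

theorem contDiff_tanh {n : WithTop ℕ∞} : ContDiff ℝ n Real.tanh := by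
  have h2 : Real.tanh = fun x => Real.sinh x / Real.cosh x := funext Real.tanh_eq_sinh_div_cosh
  rw [h2]
  exact Real.contDiff_sinh.div Real.contDiff_cosh fun x => (Real.cosh_pos x).ne'

@[fun_prop]
theorem hasTemperateGrowth_tanh : Real.tanh.HasTemperateGrowth := by
  refine ⟨contDiff_tanh, fun n => ?_⟩
  obtain ⟨p, hp⟩ := exists_iteratedDeriv_tanh n
  obtain ⟨C, hC⟩ := (isCompact_Icc (a := (-1 : ℝ)) (b := 1)).exists_bound_of_continuousOn
    (f := fun x => p.eval x) p.continuous.continuousOn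
  refine ⟨0, C, fun x => ?_⟩
  rw [norm_iteratedFDeriv_eq_norm_iteratedDeriv, hp]
  simpa using hC (Real.tanh x) (abs_le.mp (abs_tanh_le_one x))

/-- The superpotential `a tanh (a x)`. -/
def superpot (a x : ℝ) : ℝ := a * Real.tanh (a * x)

/-- The derivative of the superpotential. -/
def superpotDeriv (a x : ℝ) : ℝ := a ^ 2 - superpot a x ^ 2

@[fun_prop]
theorem hasTemperateGrowth_superpot (a : ℝ) : (superpot a).HasTemperateGrowth := by
  unfold superpot
  have h : (fun x : ℝ => a * x).HasTemperateGrowth := by fun_prop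
  have := hasTemperateGrowth_tanh.comp h
  exact (Function.HasTemperateGrowth.const a).mul this

@[fun_prop]
theorem hasTemperateGrowth_superpotDeriv (a : ℝ) : (superpotDeriv a).HasTemperateGrowth := by
  unfold superpotDeriv
  fun_prop

theorem hasDerivAt_superpot (a x : ℝ) : HasDerivAt (superpot a) (superpotDeriv a x) x := by
  have h := ((hasDerivAt_tanh (a * x)).comp x ((hasDerivAt_id x).const_mul a)).const_mul a
  unfold superpot superpotDeriv
  convert! h using 1
  simp [superpot]
  ring

theorem solitonPotential_eq (a x : ℝ) : solitonPotential a x = -2 * superpotDeriv a x := by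
  have h := (Real.cosh_pos (a * x)).ne'
  have h2 := Real.cosh_sq (a * x)
  simp only [solitonPotential, superpotDeriv, superpot, Real.tanh_eq_sinh_div_cosh]
  field_simp
  rw [h2]
  ring

@[fun_prop]
theorem hasTemperateGrowth_solitonPotential (a : ℝ) :
    (solitonPotential a).HasTemperateGrowth := by
  rw [funext (solitonPotential_eq a)]
  fun_prop

/-- The operator `L` on the Schwartz space. -/
def darbouxS (a : ℝ) : 𝓢(ℝ, ℂ) →L[ℂ] 𝓢(ℝ, ℂ) := dS - mulS (superpot a)

/-- The formal adjoint of `L` on the Schwartz space. -/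
def darbouxAdjS (a : ℝ) : 𝓢(ℝ, ℂ) →L[ℂ] 𝓢(ℝ, ℂ) := -dS - mulS (superpot a)

/-- The operator `-∂²` on the Schwartz space. -/
def freeS : 𝓢(ℝ, ℂ) →L[ℂ] 𝓢(ℝ, ℂ) := -(dS ∘L dS)

/-- The operator `-∂² + a²` on the Schwartz space. -/
def gZeroS (a : ℝ) : 𝓢(ℝ, ℂ) →L[ℂ] 𝓢(ℝ, ℂ) := freeS + (a : ℂ) ^ 2 • ContinuousLinearMap.id ℂ _

/-- The soliton Hamiltonian on the Schwartz space. -/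
def solitonS (a : ℝ) : 𝓢(ℝ, ℂ) →L[ℂ] 𝓢(ℝ, ℂ) := freeS + mulS (solitonPotential a)

theorem freeS_apply (f : 𝓢(ℝ, ℂ)) : freeS f = -dS (dS f) := rfl

theorem gZeroS_apply (a : ℝ) (f : 𝓢(ℝ, ℂ)) : gZeroS a f = freeS f + (a : ℂ) ^ 2 • f := rfl

theorem darbouxS_apply (a : ℝ) (f : 𝓢(ℝ, ℂ)) : darbouxS a f = dS f - mulS (superpot a) f := rfl

theorem darbouxAdjS_apply (a : ℝ) (f : 𝓢(ℝ, ℂ)) :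
    darbouxAdjS a f = -dS f - mulS (superpot a) f := rfl

theorem solitonS_apply (a : ℝ) (f : 𝓢(ℝ, ℂ)) :
    solitonS a f = freeS f + mulS (solitonPotential a) f := rfl

theorem coe_darbouxS (a : ℝ) (f : 𝓢(ℝ, ℂ)) : ⇑(darbouxS a f) = darboux a f := by
  funext x
  simp [darbouxS_apply, darboux, mulS_apply (hasTemperateGrowth_superpot a), dS_apply, superpot]
  ring

theorem coe_gZeroS (a : ℝ) (f : 𝓢(ℝ, ℂ)) : ⇑(gZeroS a f) = gZeroFun a f := by
  funext x
  simp [gZeroS_apply, gZeroFun, freeS_apply, dS_apply, dS_coe]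

theorem coe_solitonS (a : ℝ) (f : 𝓢(ℝ, ℂ)) :
    ⇑(solitonS a f) = fun x => -deriv (deriv f) x + solitonPotential a x * f x := by
  funext x
  simp [solitonS_apply, freeS_apply, dS_apply, dS_coe,
    mulS_apply (hasTemperateGrowth_solitonPotential a)]

theorem inner_darbouxS (a : ℝ) (f g : 𝓢(ℝ, ℂ)) :
    inner ℂ (toL2 f) (toL2 (darbouxS a g)) = inner ℂ (toL2 (darbouxAdjS a f)) (toL2 g) := by
  simp only [darbouxS_apply, darbouxAdjS_apply, map_sub, map_neg, inner_sub_left, inner_sub_right,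
    inner_dS, inner_neg_left, inner_mulS (hasTemperateGrowth_superpot a)]

theorem inner_freeS_eq (f g : 𝓢(ℝ, ℂ)) :
    inner ℂ (toL2 f) (toL2 (freeS g)) = inner ℂ (toL2 (dS f)) (toL2 (dS g)) := by
  simp only [freeS_apply, map_neg, inner_neg_right, inner_dS, neg_neg]

theorem inner_freeS (f g : 𝓢(ℝ, ℂ)) :
    inner ℂ (toL2 f) (toL2 (freeS g)) = inner ℂ (toL2 (freeS f)) (toL2 g) := by
  rw [inner_freeS_eq, inner_dS, freeS_apply, map_neg, inner_neg_left]

theorem inner_gZeroS (a : ℝ) (f g : 𝓢(ℝ, ℂ)) :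
    inner ℂ (toL2 f) (toL2 (gZeroS a g)) = inner ℂ (toL2 (gZeroS a f)) (toL2 g) := by
  simp only [gZeroS_apply, map_add, map_smul, inner_add_left, inner_add_right, inner_freeS,
    inner_smul_left, inner_smul_right]
  simp

theorem inner_solitonS (a : ℝ) (f g : 𝓢(ℝ, ℂ)) :
    inner ℂ (toL2 f) (toL2 (solitonS a g)) = inner ℂ (toL2 (solitonS a f)) (toL2 g) := by
  simp only [solitonS_apply, map_add, inner_add_left, inner_add_right, inner_freeS,
    inner_mulS (hasTemperateGrowth_solitonPotential a)]

/-- (-∂ - W)(∂ - W) = -∂² + W' + W², and W' + W² = a². The opposite order gives -∂² - W' + W² = -∂²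
- 2W' + a², where -2W' is the soliton potential. -/
theorem darbouxAdjS_darbouxS (a : ℝ) (f : 𝓢(ℝ, ℂ)) :
    darbouxAdjS a (darbouxS a f) = gZeroS a f := by
  have h1 := hasTemperateGrowth_superpot a
  have h2 := hasTemperateGrowth_superpotDeriv a
  simp only [darbouxS_apply, darbouxAdjS_apply, gZeroS_apply, freeS_apply, map_sub,
    dS_mulS h1 h2 (hasDerivAt_superpot a)]
  ext x
  simp [mulS_apply h1, mulS_apply h2, superpotDeriv]
  ring

theorem darbouxS_darbouxAdjS (a : ℝ) (f : 𝓢(ℝ, ℂ)) :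
    darbouxS a (darbouxAdjS a f) = solitonS a f + (a : ℂ) ^ 2 • f := by
  have h1 := hasTemperateGrowth_superpot a
  have h2 := hasTemperateGrowth_superpotDeriv a
  have h3 := hasTemperateGrowth_solitonPotential a
  simp only [darbouxS_apply, darbouxAdjS_apply, solitonS_apply, freeS_apply, map_sub, map_neg,
    dS_mulS h1 h2 (hasDerivAt_superpot a)]
  ext x
  simp [mulS_apply h1, mulS_apply h2, mulS_apply h3, superpotDeriv, solitonPotential_eq]
  ring

/-- The intertwining relation `h₁ L = L h₀`. -/
theorem solitonS_darbouxS (a : ℝ) (f : 𝓢(ℝ, ℂ)) :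
    solitonS a (darbouxS a f) = darbouxS a (freeS f) := by
  -- Associativity (LL⁺)L = L(L⁺L); the terms a²L on both sides cancel.
  have h := darbouxS_darbouxAdjS a (darbouxS a f)
  rw [darbouxAdjS_darbouxS, gZeroS_apply, map_add, map_smul] at h
  exact (add_right_cancel h).symm

/-! ### A priori bounds for L and g₀. -/

theorem inner_darbouxS_darbouxS (a : ℝ) (f g : 𝓢(ℝ, ℂ)) :
    inner ℂ (toL2 (darbouxS a f)) (toL2 (darbouxS a g)) =
      inner ℂ (toL2 f) (toL2 (gZeroS a g)) := by
  rw [inner_darbouxS, darbouxAdjS_darbouxS, inner_gZeroS]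

/-- The term a²‖f‖² makes L bounded below by a. Every injectivity and closed-range argument for L̄
and ḡ₀ rests on it. -/
theorem norm_darbouxS_sq (a : ℝ) (f : 𝓢(ℝ, ℂ)) :
    ‖toL2 (darbouxS a f)‖ ^ 2 = ‖toL2 (dS f)‖ ^ 2 + a ^ 2 * ‖toL2 f‖ ^ 2 := by
  have h := inner_darbouxS_darbouxS a f f
  rw [gZeroS_apply, map_add, inner_add_right, inner_freeS_eq, map_smul, inner_smul_right] at h
  simp only [inner_self_eq_norm_sq_to_K, Complex.coe_algebraMap] at h
  exact_mod_cast h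

theorem norm_toL2_le_darbouxS {a : ℝ} (ha : 0 < a) (f : 𝓢(ℝ, ℂ)) :
    ‖toL2 f‖ ≤ a⁻¹ * ‖toL2 (darbouxS a f)‖ := by
  have h := norm_darbouxS_sq a f
  rw [inv_mul_eq_div, le_div_iff₀ ha]
  refine le_of_sq_le_sq ?_ (norm_nonneg _)
  nlinarith [sq_nonneg ‖toL2 (dS f)‖]

/-- Cauchy–Schwarz in ‖Lf‖² = ⟨f, g₀f⟩, then ‖f‖ ≤ a⁻¹‖Lf‖, and one factor ‖Lf‖ cancels. -/
theorem norm_darbouxS_le_gZeroS {a : ℝ} (ha : 0 < a) (f : 𝓢(ℝ, ℂ)) :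
    ‖toL2 (darbouxS a f)‖ ≤ a⁻¹ * ‖toL2 (gZeroS a f)‖ := by
  have h : ‖toL2 (darbouxS a f)‖ ^ 2 ≤ ‖toL2 f‖ * ‖toL2 (gZeroS a f)‖ := by
    have h := inner_darbouxS_darbouxS a f f
    rw [inner_self_eq_norm_sq_to_K] at h
    have h2 := norm_inner_le_norm (𝕜 := ℂ) (toL2 f) (toL2 (gZeroS a f))
    rw [← h] at h2
    simpa using h2
  have h2 := norm_toL2_le_darbouxS ha f
  have h3 : ‖toL2 (darbouxS a f)‖ ^ 2 ≤
      ‖toL2 (darbouxS a f)‖ * (a⁻¹ * ‖toL2 (gZeroS a f)‖) := by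
    refine h.trans ?_
    calc _ ≤ (a⁻¹ * ‖toL2 (darbouxS a f)‖) * ‖toL2 (gZeroS a f)‖ := by gcongr
      _ = _ := by ring
  rcases (norm_nonneg (toL2 (darbouxS a f))).eq_or_lt with h0 | h0
  · rw [← h0]; positivity
  · rw [sq] at h3
    exact le_of_mul_le_mul_left h3 h0

/-- `-∂² + a²` is onto on the Schwartz space, by the Fourier transform. -/
theorem gZeroS_surjective {a : ℝ} (ha : 0 < a) : Function.Surjective (gZeroS a) := by
  -- The multiplier is (4π²ξ² + a²)⁻¹, written as a rescaled (1 + |·|²)⁻¹, whose temperate growth is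
  -- known.
  have hw : (fun ξ : ℝ => (a ^ 2)⁻¹ * (1 + ‖2 * Real.pi / a * ξ‖ ^ 2) ^ (-1 : ℝ)).HasTemperateGrowth := by
    have h1 := Function.hasTemperateGrowth_one_add_norm_sq_rpow ℝ (-1)
    have h2 : (fun ξ : ℝ => 2 * Real.pi / a * ξ).HasTemperateGrowth := by fun_prop
    exact (Function.HasTemperateGrowth.const _).mul (h1.comp h2)
  have hid : (fun ξ : ℝ => ξ).HasTemperateGrowth := by fun_prop
  have hd : ∀ h : 𝓢(ℝ, ℂ), dS (𝓕⁻ h) =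
      𝓕⁻ ((2 * Real.pi * Complex.I) • mulS (fun ξ => ξ) h) := by
    intro h
    have h1 := lineDerivOp_fourierInv_eq h (1 : ℝ)
    have h2 : LineDeriv.lineDerivOp (1 : ℝ) (𝓕⁻ h) = dS (𝓕⁻ h) := by
      ext x
      rw [lineDerivOp_apply_eq_fderiv, dS_apply]
      simp
    have h3 : smulLeftCLM ℂ (fun x : ℝ => inner ℝ x (1 : ℝ)) h = mulS (fun ξ => ξ) h := by
      ext x
      have h4 : (fun x : ℝ => inner ℝ x (1 : ℝ)).HasTemperateGrowth := by fun_prop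
      rw [mulS_apply hid, smulLeftCLM_apply_apply h4]
      simp
    rw [h2, h3] at h1
    exact h1
  intro f
  refine ⟨𝓕⁻ (mulS (fun ξ : ℝ => (a ^ 2)⁻¹ * (1 + ‖2 * Real.pi / a * ξ‖ ^ 2) ^ (-1 : ℝ)) (𝓕 f)),
    ?_⟩
  set w := fun ξ : ℝ => (a ^ 2)⁻¹ * (1 + ‖2 * Real.pi / a * ξ‖ ^ 2) ^ (-1 : ℝ) with hwdef
  have hfin : ∀ h : 𝓢(ℝ, ℂ), gZeroS a (𝓕⁻ h) = 𝓕⁻ (-((2 * Real.pi * Complex.I) •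
      mulS (fun ξ => ξ) ((2 * Real.pi * Complex.I) • mulS (fun ξ => ξ) h)) + (a : ℂ) ^ 2 • h) := by
    intro h
    rw [gZeroS_apply, freeS_apply, hd, hd]
    simp only [FourierTransform.fourierInv_add, FourierTransform.fourierInv_smul,
      FourierTransform.fourierInv_neg]
  rw [hfin]
  have : -((2 * Real.pi * Complex.I) •
      mulS (fun ξ => ξ) ((2 * Real.pi * Complex.I) • mulS (fun ξ => ξ) (mulS w (𝓕 f)))) +
      (a : ℂ) ^ 2 • mulS w (𝓕 f) = 𝓕 f := by
    ext ξ
    have hpos : (1 + (2 * Real.pi / a * ξ) ^ 2 : ℝ) ≠ 0 := by positivity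
    have hwe : w ξ * (4 * Real.pi ^ 2 * ξ ^ 2 + a ^ 2) = 1 := by
      simp only [hwdef, Real.rpow_neg_one, Real.norm_eq_abs, sq_abs]
      field_simp
      ring_nf
    have hwe' : (w ξ : ℂ) * (4 * Real.pi ^ 2 * ξ ^ 2 + a ^ 2) = 1 := by exact_mod_cast hwe
    simp only [add_apply, neg_apply, smul_apply, map_smul, mulS_apply hid, mulS_apply hw,
      smul_eq_mul]
    linear_combination (𝓕 f ξ) * hwe' -
      4 * Real.pi ^ 2 * ξ ^ 2 * (w ξ : ℂ) * (𝓕 f ξ) * Complex.I_sq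
  rw [this, FourierTransform.fourierInv_fourier_eq]

/-! ### The free-particle basis in the Schwartz space -/

theorem one_add_I_mul_ne_zero (t : ℝ) : (1 + Complex.I * t : ℂ) ≠ 0 := by
  intro h
  simpa using congrArg Complex.re h

theorem norm_gauss (t x : ℝ) : ‖Complex.exp (-(x : ℂ) ^ 2 / (4 * (1 + Complex.I * t)))‖ =
    Real.exp (-(1 / (4 * (1 + t ^ 2))) * x ^ 2) := by
  have : (-(x : ℂ) ^ 2 / (4 * (1 + Complex.I * t)))
      = ((-(1 / (4 * (1 + t ^ 2))) * x ^ 2 : ℝ) : ℂ) * (1 - Complex.I * t) := by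
    have h1 := one_add_I_mul_ne_zero t
    have h2 : (1 + (t : ℂ) ^ 2) ≠ 0 := by
      have : (0 : ℝ) < 1 + t ^ 2 := by positivity
      exact_mod_cast this.ne'
    push_cast
    field_simp
    ring_nf
    simp only [Complex.I_sq]
    ring
  rw [Complex.norm_exp, this, Complex.re_ofReal_mul]
  simp

theorem pow_abs_mul_gauss_le {b : ℝ} (hb : 0 < b) (n : ℕ) (x : ℝ) :
    |x| ^ n * Real.exp (-b * x ^ 2) ≤ 1 + (n.factorial : ℝ) / b ^ n := by
  have h1 : |x| ^ n ≤ 1 + (x ^ 2) ^ n := by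
    rw [← sq_abs, ← pow_mul, pow_mul']
    nlinarith [sq_nonneg (|x| ^ n - 1), pow_nonneg (abs_nonneg x) n]
  have h2 : (x ^ 2) ^ n * Real.exp (-b * x ^ 2) ≤ (n.factorial : ℝ) / b ^ n := by
    have h := Real.pow_div_factorial_le_exp (b * x ^ 2) (by positivity) n
    rw [div_le_iff₀ (by positivity), mul_pow] at h
    rw [neg_mul, Real.exp_neg, ← div_eq_mul_inv, div_le_div_iff₀ (Real.exp_pos _) (by positivity)]
    linarith
  have h3 : Real.exp (-b * x ^ 2) ≤ 1 := Real.exp_le_one_iff.mpr (by nlinarith [sq_nonneg x])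
  calc |x| ^ n * Real.exp (-b * x ^ 2) ≤ (1 + (x ^ 2) ^ n) * Real.exp (-b * x ^ 2) := by gcongr
    _ ≤ _ := by linarith

theorem IsPolyGauss.bounded {t : ℝ} {f : ℝ → ℂ} (hf : IsPolyGauss t f) :
    ∃ C : ℝ, ∀ x, ‖f x‖ ≤ C := by
  obtain ⟨p, rfl⟩ := hf
  induction p using Polynomial.induction_on' with
  | add p q hp hq =>
    obtain ⟨C, hC⟩ := hp
    obtain ⟨D, hD⟩ := hq
    refine ⟨C + D, fun x => ?_⟩
    simp only [eval_add, add_mul]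
    exact (norm_add_le _ _).trans (add_le_add (hC x) (hD x))
  | monomial n c =>
    have hb : 0 < 1 / (4 * (1 + t ^ 2)) := by positivity
    refine ⟨‖c‖ * (1 + (n.factorial : ℝ) / (1 / (4 * (1 + t ^ 2))) ^ n), fun x => ?_⟩
    simp only [eval_monomial, norm_mul, norm_pow, Complex.norm_real, Real.norm_eq_abs, norm_gauss]
    rw [mul_assoc]
    gcongr
    exact pow_abs_mul_gauss_le hb n x

theorem IsPolyGauss.iteratedDeriv {t : ℝ} {f : ℝ → ℂ} (hf : IsPolyGauss t f) (n : ℕ) :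
    IsPolyGauss t (iteratedDeriv n f) := by
  induction n with
  | zero => simpa using hf
  | succ n ih =>
    rw [iteratedDeriv_succ]
    exact ih.deriv

theorem IsPolyGauss.pow_mul {t : ℝ} {f : ℝ → ℂ} (hf : IsPolyGauss t f) (k : ℕ) :
    IsPolyGauss t fun x => (x : ℂ) ^ k * f x := by
  obtain ⟨p, rfl⟩ := hf
  exact ⟨X ^ k * p, by funext x; simp [mul_assoc]⟩

theorem IsPolyGauss.contDiff {t : ℝ} {f : ℝ → ℂ} (hf : IsPolyGauss t f) {n : WithTop ℕ∞} :
    ContDiff ℝ n f := by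
  obtain ⟨p, rfl⟩ := hf
  have h1 : ContDiff ℝ n (fun x : ℝ => (x : ℂ)) := Complex.ofRealCLM.contDiff
  have h2 : ContDiff ℝ n (fun x : ℝ => p.eval (x : ℂ)) := by
    have : ContDiff ℝ n (fun z : ℂ => p.eval z) := (p.differentiable.contDiff).restrict_scalars ℝ
    exact this.comp h1
  exact h2.mul (Complex.contDiff_exp.comp ((h1.pow 2).neg.div_const _))

/-- A polynomial multiple of the Gaussian, as a Schwartz function. -/
def IsPolyGauss.toSchwartz {t : ℝ} {f : ℝ → ℂ} (hf : IsPolyGauss t f) : 𝓢(ℝ, ℂ) where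
  toFun := f
  smooth' := hf.contDiff
  decay' k n := by
    obtain ⟨C, hC⟩ := ((hf.iteratedDeriv n).pow_mul k).bounded
    refine ⟨C, fun x => ?_⟩
    rw [norm_iteratedFDeriv_eq_norm_iteratedDeriv]
    simpa using hC x

/-- `ψₙ(·,t)` as a Schwartz function. -/
def psiS (n : ℕ) (t : ℝ) : 𝓢(ℝ, ℂ) := (isPolyGauss_psiFun n t).toSchwartz

theorem coe_psiS (n : ℕ) (t : ℝ) : ⇑(psiS n t) = psiFun n t := rfl

theorem toL2_psiS (n : ℕ) (t : ℝ) : toL2 (psiS n t) = psi n t :=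
  toL2_eq_toLp (memLp_psiFun n t) (coe_psiS n t)

theorem toL2_darbouxS_psiS (a : ℝ) (n : ℕ) (t : ℝ) :
    toL2 (darbouxS a (psiS n t)) = phi a n t :=
  toL2_eq_toLp (memLp_darboux a n t) (by rw [coe_darbouxS, coe_psiS])

theorem toL2_gZeroS_psiS (a : ℝ) (n : ℕ) (t : ℝ) :
    toL2 (gZeroS a (psiS n t)) = gPsi a n t :=
  toL2_eq_toLp (memLp_gZeroFun a n t) (by rw [coe_gZeroS, coe_psiS])

theorem hasTemperateGrowth_id' : (fun x : ℝ => x).HasTemperateGrowth := by fun_prop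

/-- Multiplication by the coordinate. -/
def coordS : 𝓢(ℝ, ℂ) →L[ℂ] 𝓢(ℝ, ℂ) := mulS fun x => x

theorem coordS_apply (f : 𝓢(ℝ, ℂ)) (x : ℝ) : coordS f x = x * f x :=
  mulS_apply hasTemperateGrowth_id' f x

/-- The raising operator. -/
def raiseS (t : ℝ) : 𝓢(ℝ, ℂ) →L[ℂ] 𝓢(ℝ, ℂ) :=
  (Complex.I + t) • dS - (Complex.I / 2) • coordS

/-- The lowering operator. -/
def lowerS (t : ℝ) : 𝓢(ℝ, ℂ) →L[ℂ] 𝓢(ℝ, ℂ) :=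
  (Complex.I - t) • dS + (Complex.I / 2) • coordS

theorem raiseS_apply (t : ℝ) (f : 𝓢(ℝ, ℂ)) :
    raiseS t f = (Complex.I + t) • dS f - (Complex.I / 2) • coordS f := rfl

theorem lowerS_apply (t : ℝ) (f : 𝓢(ℝ, ℂ)) :
    lowerS t f = (Complex.I - t) • dS f + (Complex.I / 2) • coordS f := rfl

theorem dS_coordS (f : 𝓢(ℝ, ℂ)) : dS (coordS f) = f + coordS (dS f) := by
  have h := dS_mulS hasTemperateGrowth_id' (Function.HasTemperateGrowth.const (1 : ℝ))
    (fun x => hasDerivAt_id' x) f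
  refine h.trans ?_
  congr 1
  ext x
  simp [mulS_apply (Function.HasTemperateGrowth.const (1 : ℝ))]

theorem lowerS_raiseS (t : ℝ) (f : 𝓢(ℝ, ℂ)) :
    lowerS t (raiseS t f) = raiseS t (lowerS t f) + f := by
  simp only [raiseS_apply, lowerS_apply, map_add, map_sub, map_smul, dS_coordS]
  ext x
  simp
  linear_combination (-f x) * Complex.I_sq

/-- The coordinate and the time cancel in the sum of the ladder operators, so the matrix of -∂² in
the basis does not depend on t. -/
theorem dS_eq_lowerS_add_raiseS (t : ℝ) (f : 𝓢(ℝ, ℂ)) :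
    dS f = (-(Complex.I / 2)) • (lowerS t f + raiseS t f) := by
  ext x
  simp [raiseS_apply, lowerS_apply]
  linear_combination (dS f x) * Complex.I_sq

theorem coordS_eq_lowerS_raiseS (t : ℝ) (f : 𝓢(ℝ, ℂ)) :
    coordS f = (Complex.I - t) • raiseS t f - (Complex.I + t) • lowerS t f := by
  ext x
  simp [raiseS_apply, lowerS_apply]
  linear_combination (coordS f x) * Complex.I_sq

theorem inner_raiseS (t : ℝ) (f g : 𝓢(ℝ, ℂ)) :
    inner ℂ (toL2 (raiseS t f)) (toL2 g) = inner ℂ (toL2 f) (toL2 (lowerS t g)) := by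
  have h := inner_mulS hasTemperateGrowth_id' f g
  simp only [raiseS_apply, lowerS_apply, map_add, map_sub, map_smul, inner_add_right,
    inner_sub_left, inner_smul_left, inner_smul_right, inner_dS]
  rw [show inner ℂ (toL2 f) (toL2 (coordS g)) = inner ℂ (toL2 (coordS f)) (toL2 g) from h]
  simp [Complex.conj_ofNat]
  ring

theorem sqrt_succ_smul_psiS (n : ℕ) (t : ℝ) :
    raiseS t (psiS n t) = (Real.sqrt ((n + 1 : ℕ) : ℝ) : ℂ) • psiS (n + 1) t := by
  ext x
  have h : (Real.sqrt ((n + 1 : ℕ) : ℝ) : ℂ) ≠ 0 := by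
    have : (0 : ℝ) < Real.sqrt ((n + 1 : ℕ) : ℝ) := by positivity
    exact_mod_cast this.ne'
  simp only [smul_apply, coe_psiS, psiFun, raising, raiseS_apply, sub_apply,
    coordS_apply, dS_apply, smul_eq_mul]
  push_cast at h ⊢
  field_simp

theorem lowerS_psiS_zero (t : ℝ) : lowerS t (psiS 0 t) = 0 := by
  ext x
  have h1 := one_add_I_mul_ne_zero t
  have h2 : HasDerivAt (fun y : ℂ => -y ^ 2 / (4 * (1 + Complex.I * t)))
      (-(2 * (x : ℂ)) / (4 * (1 + Complex.I * t))) (x : ℂ) := by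
    simpa using ((hasDerivAt_pow 2 (x : ℂ)).neg.div_const (4 * (1 + Complex.I * t)))
  have h3 := (h2.cexp.const_mul ((((2 * Real.pi) ^ (-(1 / 4) : ℝ) : ℝ) : ℂ) *
      (1 + Complex.I * t) ^ (-(1 / 2) : ℂ))).comp_ofReal
  have h4 : deriv (psiS 0 t) x = _ := h3.deriv
  simp only [lowerS_apply, add_apply, smul_apply, dS_apply, coordS_apply, h4, smul_eq_mul]
  simp only [coe_psiS, psiFun]
  have h5 : (Complex.I - t) * (-(2 * (x : ℂ)) / (4 * (1 + Complex.I * t))) +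
      Complex.I / 2 * x = 0 := by
    field_simp
    linear_combination 4 * x * t * Complex.I_sq
  simp only [zero_apply]
  linear_combination ((((2 * Real.pi) ^ (-(1 / 4) : ℝ) : ℝ) : ℂ) *
      (1 + Complex.I * t) ^ (-(1 / 2) : ℂ) *
      Complex.exp (-(x : ℂ) ^ 2 / (4 * (1 + Complex.I * t)))) * h5

theorem ofReal_sqrt_mul_self (n : ℕ) :
    (Real.sqrt (n : ℝ) : ℂ) * (Real.sqrt (n : ℝ) : ℂ) = n := by
  exact_mod_cast Real.mul_self_sqrt (Nat.cast_nonneg n)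

/-- For n = 0 the truncated index n - 1 is harmless, because the factor √0 vanishes. For larger n
the commutator [A, A⁺] = 1 gives AA⁺ψₙ = (n + 1)ψₙ by induction. -/
theorem lowerS_psiS (n : ℕ) (t : ℝ) :
    lowerS t (psiS n t) = (Real.sqrt (n : ℝ) : ℂ) • psiS (n - 1) t := by
  cases n with
  | zero => simp [lowerS_psiS_zero]
  | succ n =>
    have key : lowerS t (raiseS t (psiS n t)) = ((n + 1 : ℕ) : ℂ) • psiS n t := by
      induction n with
      | zero => simp [lowerS_raiseS, lowerS_psiS_zero]
      | succ n ih =>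
        rw [lowerS_raiseS]
        rw [sqrt_succ_smul_psiS, map_smul] at ih
        have h : (Real.sqrt ((n + 1 : ℕ) : ℝ) : ℂ) ≠ 0 := by
          have : (0 : ℝ) < Real.sqrt ((n + 1 : ℕ) : ℝ) := by positivity
          exact_mod_cast this.ne'
        have h2 : lowerS t (psiS (n + 1) t) = (Real.sqrt ((n + 1 : ℕ) : ℝ) : ℂ) • psiS n t := by
          refine smul_right_injective _ h ?_
          simp only
          rw [ih, smul_smul, ofReal_sqrt_mul_self]
        rw [h2, map_smul, sqrt_succ_smul_psiS, smul_smul, ofReal_sqrt_mul_self]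
        ext x
        simp
        ring
    rw [sqrt_succ_smul_psiS, map_smul] at key
    have h : (Real.sqrt ((n + 1 : ℕ) : ℝ) : ℂ) ≠ 0 := by
      have : (0 : ℝ) < Real.sqrt ((n + 1 : ℕ) : ℝ) := by positivity
      exact_mod_cast this.ne'
    refine smul_right_injective _ h ?_
    simp only
    rw [key, smul_smul, ofReal_sqrt_mul_self]
    rfl

/-! ### Orthonormality -/

theorem norm_psi_zero (t : ℝ) : ‖psi 0 t‖ = 1 := by
  have h : inner ℂ (psi 0 t) (psi 0 t) = (1 : ℂ) := by
    rw [← toL2_psiS, inner_toL2]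
    have hpos : (0 : ℝ) < 1 + t ^ 2 := by positivity
    have hb : 0 < 1 / (2 * (1 + t ^ 2)) := by positivity
    have hn : ‖(1 + Complex.I * t : ℂ)‖ = Real.sqrt (1 + t ^ 2) := by
      rw [Complex.norm_def, Complex.normSq_apply]
      simp [sq]
    have h1 : ∀ x : ℝ, psiS 0 t x * starRingEnd ℂ (psiS 0 t x) =
        (((2 * Real.pi) ^ (-(1 / 2) : ℝ) * (1 + t ^ 2) ^ (-(1 / 2) : ℝ) *
          Real.exp (-(1 / (2 * (1 + t ^ 2))) * x ^ 2) : ℝ) : ℂ) := by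
      intro x
      rw [Complex.mul_conj, Complex.normSq_eq_norm_sq]
      congr 1
      simp only [coe_psiS, psiFun, norm_mul, norm_gauss, Complex.norm_real, Real.norm_eq_abs]
      have h2 : ‖(1 + Complex.I * t : ℂ) ^ (-(1 / 2) : ℂ)‖ = (1 + t ^ 2) ^ (-(1 / 4) : ℝ) := by
        have : (-(1 / 2) : ℂ) = ((-(1 / 2) : ℝ) : ℂ) := by push_cast; ring
        rw [this, Complex.norm_cpow_real, hn, Real.sqrt_eq_rpow, ← Real.rpow_mul hpos.le]
        norm_num
      rw [h2, abs_of_pos (by positivity), mul_pow, mul_pow, ← Real.exp_nat_mul,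
        ← Real.rpow_mul_natCast (by positivity), ← Real.rpow_mul_natCast hpos.le]
      congr 1
      · congr 1 <;> norm_num
      · congr 1
        push_cast
        field_simp
        norm_num
    simp only [h1]
    rw [integral_complex_ofReal, integral_const_mul, integral_gaussian]
    have : Real.pi / (1 / (2 * (1 + t ^ 2))) = (2 * Real.pi) * (1 + t ^ 2) := by field_simp
    rw [this, Real.sqrt_eq_rpow, Real.mul_rpow (by positivity) hpos.le]
    have e1 : (2 * Real.pi) ^ (-(1 / 2) : ℝ) * (2 * Real.pi) ^ (1 / 2 : ℝ) = 1 := by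
      rw [← Real.rpow_add (by positivity)]; norm_num
    have e2 : (1 + t ^ 2) ^ (-(1 / 2) : ℝ) * (1 + t ^ 2) ^ (1 / 2 : ℝ) = 1 := by
      rw [← Real.rpow_add (by positivity)]; norm_num
    have e3 : (2 * Real.pi) ^ (-(1 / 2) : ℝ) * (1 + t ^ 2) ^ (-(1 / 2) : ℝ) *
        ((2 * Real.pi) ^ (1 / 2 : ℝ) * (1 + t ^ 2) ^ (1 / 2 : ℝ)) = 1 := by
      calc _ = ((2 * Real.pi) ^ (-(1 / 2) : ℝ) * (2 * Real.pi) ^ (1 / 2 : ℝ)) *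
            ((1 + t ^ 2) ^ (-(1 / 2) : ℝ) * (1 + t ^ 2) ^ (1 / 2 : ℝ)) := by ring
        _ = 1 := by rw [e1, e2, one_mul]
    rw [e3]
    simp
  rw [inner_self_eq_norm_sq_to_K] at h
  simp only [Complex.coe_algebraMap] at h
  have h2 : ‖psi 0 t‖ ^ 2 = 1 := by exact_mod_cast h
  exact by rwa [pow_eq_one_iff_of_nonneg (norm_nonneg _) two_ne_zero] at h2

theorem inner_psi (n m : ℕ) (t : ℝ) :
    inner ℂ (psi n t) (psi m t) = if n = m then (1 : ℂ) else 0 := by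
  have hne : ∀ n : ℕ, (Real.sqrt ((n + 1 : ℕ) : ℝ) : ℂ) ≠ 0 := fun n => by
    have : (0 : ℝ) < Real.sqrt ((n + 1 : ℕ) : ℝ) := by positivity
    exact_mod_cast this.ne'
  have h0 : ∀ m, inner ℂ (psi (m + 1) t) (psi 0 t) = (0 : ℂ) := fun m => by
    have h := inner_raiseS t (psiS m t) (psiS 0 t)
    rw [lowerS_psiS_zero, sqrt_succ_smul_psiS, map_smul, inner_smul_left, toL2_psiS, toL2_psiS,
      Complex.conj_ofReal] at h
    exact (mul_eq_zero.mp (h.trans (by simp))).resolve_left (hne m)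
  have h1 : ∀ n m, inner ℂ (psi (n + 1) t) (psi (m + 1) t) =
      (Real.sqrt ((n + 1 : ℕ) : ℝ) : ℂ)⁻¹ * Real.sqrt ((m + 1 : ℕ) : ℝ) *
        inner ℂ (psi n t) (psi m t) := fun n m => by
    have h := inner_raiseS t (psiS n t) (psiS (m + 1) t)
    rw [lowerS_psiS, sqrt_succ_smul_psiS, map_smul, map_smul, inner_smul_left, inner_smul_right,
      toL2_psiS, toL2_psiS, toL2_psiS, toL2_psiS, Complex.conj_ofReal, Nat.add_sub_cancel] at h
    rw [mul_assoc, ← h, inv_mul_cancel_left₀ (hne n)]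
  induction n generalizing m with
  | zero =>
    cases m with
    | zero => simp [inner_self_eq_norm_sq_to_K, norm_psi_zero]
    | succ m => rw [← inner_conj_symm, h0]; simp
  | succ n ih =>
    cases m with
    | zero => rw [h0]; simp
    | succ m =>
      rw [h1, ih]
      by_cases h : n = m
      · subst h; simpa using inv_mul_cancel₀ (hne n)
      · simp [h]

theorem orthonormal_psi (t : ℝ) : Orthonormal ℂ fun n => psi n t :=
  orthonormal_iff_ite.mpr fun n m => inner_psi n m t

theorem norm_psi (n : ℕ) (t : ℝ) : ‖psi n t‖ = 1 := (orthonormal_psi t).1 n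

/-! ### Completeness of the free-particle basis -/

theorem inner_toL2_left (f : 𝓢(ℝ, ℂ)) (u : L2) :
    inner ℂ (toL2 f) u = ∫ x, u x * starRingEnd ℂ (f x) := by
  rw [L2.inner_def]
  refine integral_congr_ae ?_
  filter_upwards [toL2_coeFn f] with x hx
  rw [hx, RCLike.inner_apply]

theorem memLp_exp_abs_mul_gauss {b : ℝ} (hb : 0 < b) (c : ℝ) :
    MemLp (fun x : ℝ => Real.exp (c * |x|) * Real.exp (-b * x ^ 2)) 2 volume := by
  have hcont : Continuous fun x : ℝ => Real.exp (c * |x|) * Real.exp (-b * x ^ 2) := by fun_prop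
  rw [memLp_two_iff_integrable_sq hcont.aestronglyMeasurable]
  refine ((integrable_exp_neg_mul_sq hb).const_mul (Real.exp (c ^ 2 / b))).mono'
    (by fun_prop) (Eventually.of_forall fun x => ?_)
  rw [Real.norm_eq_abs, abs_of_nonneg (by positivity), ← Real.exp_add, ← Real.exp_add,
    ← Real.exp_nat_mul, Real.exp_le_exp]
  -- Completing the square leaves a Gaussian of half the exponent as integrable bound for the
  -- square.
  have h : c ^ 2 / b + -b * x ^ 2 - ((2 : ℕ) : ℝ) * (c * |x| + -b * x ^ 2) =
      (c - b * |x|) ^ 2 / b := by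
    field_simp
    push_cast
    rw [← sq_abs x]
    ring
  have h2 : 0 ≤ (c - b * |x|) ^ 2 / b := by positivity
  linarith

theorem integrable_exp_abs_mul_psi (t c : ℝ) (u : L2) :
    Integrable fun x : ℝ => Real.exp (c * |x|) * ‖u x * starRingEnd ℂ (psiS 0 t x)‖ := by
  have hb : 0 < 1 / (4 * (1 + t ^ 2)) := by positivity
  have h1 := (memLp_exp_abs_mul_gauss hb c).integrable_mul (Lp.memLp u).norm
  refine (h1.const_mul ‖(((2 * Real.pi) ^ (-(1 / 4) : ℝ) : ℝ) : ℂ) *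
      (1 + Complex.I * t) ^ (-(1 / 2) : ℂ)‖).congr (Eventually.of_forall fun x => ?_)
  simp only [Pi.mul_apply, coe_psiS, psiFun, map_mul, norm_mul, norm_gauss, RCLike.norm_conj]
  ring

/-- x is a combination of the ladder operators, so the span contains all xᵏψ₀; orthogonality to the
basis thus becomes vanishing of all moments. -/
theorem coordS_iterate_mem_span (t : ℝ) (k : ℕ) :
    coordS^[k] (psiS 0 t) ∈ Submodule.span ℂ (Set.range fun n => psiS n t) := by
  induction k with
  | zero => exact Submodule.subset_span ⟨0, rfl⟩
  | succ k ih =>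
    rw [Function.iterate_succ_apply']
    refine Submodule.span_induction (p := fun f _ => coordS f ∈ _) ?_ (by simp) ?_ ?_ ih
    · rintro _ ⟨n, rfl⟩
      rw [coordS_eq_lowerS_raiseS t, lowerS_psiS, sqrt_succ_smul_psiS]
      exact Submodule.sub_mem _ (Submodule.smul_mem _ _ (Submodule.smul_mem _ _
        (Submodule.subset_span ⟨n + 1, rfl⟩))) (Submodule.smul_mem _ _ (Submodule.smul_mem _ _
        (Submodule.subset_span ⟨n - 1, rfl⟩)))
    · intro f g _ _ hf hg
      rw [map_add]
      exact Submodule.add_mem _ hf hg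
    · intro c f _ hf
      rw [map_smul]
      exact Submodule.smul_mem _ c hf

theorem coordS_iterate_apply (f : 𝓢(ℝ, ℂ)) (k : ℕ) (x : ℝ) :
    coordS^[k] f x = (x : ℂ) ^ k * f x := by
  induction k with
  | zero => simp
  | succ k ih => rw [Function.iterate_succ_apply', coordS_apply, ih]; ring

/-- Injectivity of the Fourier transform on L¹: a test function is the transform of a Schwartz
function, and Fubini moves that transform onto `h`. -/
theorem ae_eq_zero_of_fourier_eq_zero {h : ℝ → ℂ} (hi : Integrable h) (hF : ∀ ξ, 𝓕 h ξ = 0) :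
    h =ᵐ[volume] 0 := by
  refine ae_eq_zero_of_integral_contDiff_smul_eq_zero hi.locallyIntegrable fun g hg hgc => ?_
  have hcd : ContDiff ℝ (⊤ : ℕ∞) fun x => (g x : ℂ) := Complex.ofRealCLM.contDiff.comp hg
  have hcs : HasCompactSupport fun x => (g x : ℂ) := hgc.comp_left (g := Complex.ofReal) rfl
  set G : 𝓢(ℝ, ℂ) := hcs.toSchwartzMap hcd
  have h1 := VectorFourier.integral_fourierIntegral_smul_eq_flip (L := innerₗ ℝ)
    (μ := volume) (ν := volume) Real.continuous_fourierChar continuous_inner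
    (f := (𝓕⁻ G : 𝓢(ℝ, ℂ))) (g := h) (𝓕⁻ G : 𝓢(ℝ, ℂ)).integrable hi
  have h2 : ∀ ξ, VectorFourier.fourierIntegral Real.fourierChar volume (innerₗ ℝ)
      (𝓕⁻ G : 𝓢(ℝ, ℂ)) ξ =
      g ξ := by
    intro ξ
    have : 𝓕 (𝓕⁻ G) = G := FourierTransform.fourier_fourierInv_eq G
    have h3 := congrArg (fun F : 𝓢(ℝ, ℂ) => F ξ) this
    exact h3
  have h3 : ∀ x, VectorFourier.fourierIntegral Real.fourierChar volume (innerₗ ℝ).flip h x = 0 := by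
    intro x
    rw [flip_innerₗ]
    exact hF x
  simp only [h2, h3, smul_zero, integral_zero] at h1
  simpa using h1

/-- The function u times the conjugate of ψ₀ has zero moments and stays integrable against exp(c|x|)
for every c. Its Fourier transform can thus be expanded in powers of ξ under the integral, and every
term vanishes. -/
theorem eq_zero_of_inner_psi_eq_zero (t : ℝ) {u : L2} (hu : ∀ n, inner ℂ (psi n t) u = (0 : ℂ)) :
    u = 0 := by
  set h : ℝ → ℂ := fun x => u x * starRingEnd ℂ (psiS 0 t x) with hdef
  have hmeas : AEStronglyMeasurable h volume :=
    (Lp.aestronglyMeasurable u).mul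
      (Complex.continuous_conj.comp (psiS 0 t).continuous).aestronglyMeasurable
  have hint : ∀ c : ℝ, Integrable fun x : ℝ => Real.exp (c * |x|) * ‖h x‖ :=
    fun c => integrable_exp_abs_mul_psi t c u
  have hi : Integrable h := by
    rw [← integrable_norm_iff hmeas]
    simpa using hint 0
  have hmom : ∀ k : ℕ, ∫ x : ℝ, (x : ℂ) ^ k * h x = 0 := by
    intro k
    have h1 : inner ℂ (toL2 (coordS^[k] (psiS 0 t))) u = (0 : ℂ) := by
      refine Submodule.span_induction (p := fun f _ => inner ℂ (toL2 f) u = (0 : ℂ)) ?_ (by simp)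
        ?_ ?_ (coordS_iterate_mem_span t k)
      · rintro _ ⟨n, rfl⟩
        rw [toL2_psiS, hu]
      · intro f g _ _ hf hg
        rw [map_add, inner_add_left, hf, hg, add_zero]
      · intro c f _ hf
        rw [map_smul, inner_smul_left, hf, mul_zero]
    rw [inner_toL2_left] at h1
    rw [← h1]
    congr 1 with x
    rw [coordS_iterate_apply]
    simp [hdef]
    ring
  have hF : ∀ ξ, 𝓕 h ξ = 0 := by
    intro ξ
    rw [Real.fourier_real_eq_integral_exp_smul]
    have hsum := hasSum_integral_of_dominated_convergence (μ := (volume : Measure ℝ))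
      (F := fun (k : ℕ) (x : ℝ) => ((((-2 * Real.pi * x * ξ : ℝ) : ℂ) * Complex.I) ^ k /
        (k.factorial : ℂ)) • h x)
      (f := fun x : ℝ => Complex.exp (((-2 * Real.pi * x * ξ : ℝ) : ℂ) * Complex.I) • h x)
      (fun k x => (2 * Real.pi * |ξ| * |x|) ^ k / (k.factorial : ℝ) * ‖h x‖)
      (fun k => by
        have hc : Continuous fun x : ℝ => (((-2 * Real.pi * x * ξ : ℝ) : ℂ) * Complex.I) ^ k /
          (k.factorial : ℂ) := by fun_prop
        exact hc.aestronglyMeasurable.smul hmeas)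
      (fun k => Eventually.of_forall fun x => by
        rw [norm_smul, norm_div, norm_pow, norm_mul, Complex.norm_I, mul_one, Complex.norm_real,
          Complex.norm_natCast, Real.norm_eq_abs, abs_mul, abs_mul, abs_mul, abs_neg,
          abs_of_pos Real.pi_pos, abs_two]
        apply le_of_eq
        ring)
      (Eventually.of_forall fun x => (Real.summable_pow_div_factorial _).mul_right _)
      (by
        refine (hint (2 * Real.pi * |ξ|)).congr (Eventually.of_forall fun x => ?_)
        simp only
        rw [tsum_mul_right, Real.exp_eq_exp_ℝ, NormedSpace.exp_eq_tsum_div])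
      (Eventually.of_forall fun x => by
        have := NormedSpace.expSeries_div_hasSum_exp
          (((-2 * Real.pi * x * ξ : ℝ) : ℂ) * Complex.I)
        rw [← Complex.exp_eq_exp_ℂ] at this
        exact this.smul_const _)
    refine hsum.unique ?_
    convert! hasSum_zero with k
    have : ∀ x : ℝ, ((((-2 * Real.pi * x * ξ : ℝ) : ℂ) * Complex.I) ^ k /
        (k.factorial : ℂ)) • h x =
        ((-2 * Real.pi * ξ * Complex.I) ^ k / (k.factorial : ℂ)) * ((x : ℂ) ^ k * h x) := by
      intro x
      push_cast
      rw [smul_eq_mul]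
      ring
    simp only [this]
    rw [integral_const_mul, hmom, mul_zero]
  have h0 := ae_eq_zero_of_fourier_eq_zero hi hF
  refine (Lp.eq_zero_iff_ae_eq_zero).mpr ?_
  filter_upwards [h0] with x hx
  have hne : starRingEnd ℂ (psiS 0 t x) ≠ 0 := by
    rw [Ne, map_eq_zero, coe_psiS]
    simp only [psiFun]
    refine mul_ne_zero (mul_ne_zero ?_ ?_) (Complex.exp_ne_zero _)
    · have : (0 : ℝ) < (2 * Real.pi) ^ (-(1 / 4) : ℝ) := by positivity
      exact_mod_cast this.ne'
    · rw [Complex.cpow_ne_zero_iff]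
      exact Or.inl (one_add_I_mul_ne_zero t)
  exact (mul_eq_zero.mp hx).resolve_right hne

/-- The Hilbert basis `ψₙ(·,t)` of `L²(ℝ)`. -/
def psiBasis (t : ℝ) : HilbertBasis ℕ ℂ L2 :=
  HilbertBasis.mkOfOrthogonalEqBot (orthonormal_psi t) <| by
    rw [Submodule.eq_bot_iff]
    intro u hu
    refine eq_zero_of_inner_psi_eq_zero t fun n => ?_
    exact (Submodule.mem_orthogonal _ _).mp hu _ (Submodule.subset_span ⟨n, rfl⟩)

theorem psiBasis_apply (t : ℝ) (n : ℕ) : psiBasis t n = psi n t := by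
  rw [psiBasis, HilbertBasis.coe_mkOfOrthogonalEqBot]

theorem hasSum_psi (t : ℝ) (u : L2) :
    HasSum (fun n => (inner ℂ (psi n t) u : ℂ) • psi n t) u := by
  have := (psiBasis t).hasSum_repr u
  simpa only [HilbertBasis.repr_apply_apply, psiBasis_apply] using this

/-! ### Closures of submodules -/

section Closures

variable {X Y : Type*} [NormedAddCommGroup X] [NormedSpace ℂ X] [NormedAddCommGroup Y]
  [NormedSpace ℂ Y]

theorem map_topologicalClosure_le (A : Submodule ℂ X) (f : X →L[ℂ] Y) {x : X}
    (hx : x ∈ A.topologicalClosure) :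
    f x ∈ (A.map (f : X →ₗ[ℂ] Y)).topologicalClosure :=
  map_mem_closure f.continuous hx fun y hy => ⟨y, hy, rfl⟩

theorem topologicalClosure_map_congr {A B : Submodule ℂ X}
    (h : A.topologicalClosure = B.topologicalClosure) (f : X →L[ℂ] Y) :
    (A.map (f : X →ₗ[ℂ] Y)).topologicalClosure = (B.map (f : X →ₗ[ℂ] Y)).topologicalClosure := by
  have key : ∀ A B : Submodule ℂ X, A.topologicalClosure = B.topologicalClosure →
      (A.map (f : X →ₗ[ℂ] Y)).topologicalClosure ≤
        (B.map (f : X →ₗ[ℂ] Y)).topologicalClosure := by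
    intro A B h
    refine Submodule.topologicalClosure_minimal _ ?_ (Submodule.isClosed_topologicalClosure _)
    rintro _ ⟨x, hx, rfl⟩
    exact map_topologicalClosure_le B f (h ▸ A.le_topologicalClosure hx)
  exact le_antisymm (key A B h) (key B A h.symm)

/-- A continuous linear map that is bounded below on a submodule maps its closure onto the closure
of the image. -/
theorem exists_mem_topologicalClosure_of_bounded_below [CompleteSpace X] (A : Submodule ℂ X)
    (f : X →L[ℂ] Y) {C : ℝ} (hC : ∀ x ∈ A, ‖x‖ ≤ C * ‖f x‖) {y : Y}
    (hy : y ∈ (A.map (f : X →ₗ[ℂ] Y)).topologicalClosure) :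
    ∃ x ∈ A.topologicalClosure, f x = y := by
  have hC' : ∀ x ∈ A.topologicalClosure, ‖x‖ ≤ max C 0 * ‖f x‖ := by
    intro x hx
    have hcl : IsClosed {x : X | ‖x‖ ≤ max C 0 * ‖f x‖} :=
      isClosed_le continuous_norm (continuous_const.mul f.continuous.norm)
    exact closure_minimal (fun x hx => (hC x hx).trans
      (mul_le_mul_of_nonneg_right (le_max_left _ _) (norm_nonneg _))) hcl hx
  set g : A.topologicalClosure →L[ℂ] Y := f.comp A.topologicalClosure.subtypeL
  have hg : AntilipschitzWith ⟨max C 0, le_max_right _ _⟩ g :=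
    AddMonoidHomClass.antilipschitz_of_bound g fun x => hC' x x.2
  have hcomplete : CompleteSpace A.topologicalClosure :=
    (Submodule.isClosed_topologicalClosure A).completeSpace_coe
  have hr : IsClosed (Set.range g) := hg.isClosed_range g.uniformContinuous
  have : y ∈ Set.range g := by
    refine closure_minimal ?_ hr hy
    rintro _ ⟨x, hx, rfl⟩
    exact ⟨⟨x, A.le_topologicalClosure hx⟩, rfl⟩
  obtain ⟨x, hx⟩ := this
  exact ⟨x, x.2, hx⟩

end Closures

/-! ### The graph of `(L, g₀)` -/

/-- The map `θ ↦ (θ, L θ, g₀ θ)` on the Schwartz space. -/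
def tripleS (a : ℝ) : 𝓢(ℝ, ℂ) →ₗ[ℂ] L2 × L2 × L2 :=
  (toL2 : 𝓢(ℝ, ℂ) →ₗ[ℂ] L2).prod
    (((toL2 ∘L darbouxS a : 𝓢(ℝ, ℂ) →L[ℂ] L2) : 𝓢(ℝ, ℂ) →ₗ[ℂ] L2).prod
      ((toL2 ∘L gZeroS a : 𝓢(ℝ, ℂ) →L[ℂ] L2) : 𝓢(ℝ, ℂ) →ₗ[ℂ] L2))

theorem tripleS_apply (a : ℝ) (f : 𝓢(ℝ, ℂ)) :
    tripleS a f = (toL2 f, toL2 (darbouxS a f), toL2 (gZeroS a f)) := rfl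

/-- Expansion of (A + A⁺)²/4. The index n - 1 - 1 is truncated for n = 0, 1, where the coefficient
√n √(n-1) is zero. -/
theorem freeS_psiS (n : ℕ) (t : ℝ) : freeS (psiS n t) = (1 / 4 : ℂ) •
    (((Real.sqrt (n : ℝ) : ℂ) * Real.sqrt ((n - 1 : ℕ) : ℝ)) • psiS (n - 1 - 1) t +
      (2 * n + 1 : ℂ) • psiS n t +
      ((Real.sqrt ((n + 1 : ℕ) : ℝ) : ℂ) * Real.sqrt ((n + 1 + 1 : ℕ) : ℝ)) •
        psiS (n + 1 + 1) t) := by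
  rw [freeS_apply, dS_eq_lowerS_add_raiseS t (psiS n t), map_smul,
    dS_eq_lowerS_add_raiseS t (lowerS t _ + raiseS t _), map_add, map_add, lowerS_raiseS]
  have h1 : raiseS t (lowerS t (psiS n t)) = (n : ℂ) • psiS n t := by
    cases n with
    | zero => simp [lowerS_psiS_zero]
    | succ n =>
      rw [lowerS_psiS, map_smul, Nat.add_sub_cancel, sqrt_succ_smul_psiS, smul_smul,
        ofReal_sqrt_mul_self]
  rw [h1, lowerS_psiS, map_smul, lowerS_psiS, sqrt_succ_smul_psiS, map_smul, sqrt_succ_smul_psiS]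
  simp only [smul_smul]
  ext x
  simp only [neg_apply, smul_apply, add_apply, smul_eq_mul]
  linear_combination (-(1 / 4 : ℂ)) * (Real.sqrt (n : ℝ) * Real.sqrt ((n - 1 : ℕ) : ℝ) *
    psiS (n - 1 - 1) t x + (2 * n + 1) * psiS n t x + Real.sqrt ((n + 1 : ℕ) : ℝ) *
    Real.sqrt ((n + 1 + 1 : ℕ) : ℝ) * psiS (n + 1 + 1) t x) * Complex.I_sq

theorem norm_toL2_psiS (n : ℕ) (t : ℝ) : ‖toL2 (psiS n t)‖ = 1 := by
  rw [toL2_psiS, norm_psi]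

theorem norm_freeS_psiS_le (n : ℕ) (t : ℝ) : ‖toL2 (freeS (psiS n t))‖ ≤ n + 1 := by
  rw [freeS_psiS, map_smul, map_add, map_add, map_smul, map_smul, map_smul, norm_smul]
  have h1 : Real.sqrt (n : ℝ) * Real.sqrt ((n - 1 : ℕ) : ℝ) ≤ n := by
    have h : Real.sqrt ((n - 1 : ℕ) : ℝ) ≤ Real.sqrt (n : ℝ) :=
      Real.sqrt_le_sqrt (by exact_mod_cast Nat.sub_le n 1)
    calc _ ≤ Real.sqrt (n : ℝ) * Real.sqrt (n : ℝ) := by gcongr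
      _ = n := Real.mul_self_sqrt (Nat.cast_nonneg n)
  have h2 : Real.sqrt ((n + 1 : ℕ) : ℝ) * Real.sqrt ((n + 1 + 1 : ℕ) : ℝ) ≤ n + 2 := by
    have h : Real.sqrt ((n + 1 : ℕ) : ℝ) ≤ Real.sqrt ((n + 1 + 1 : ℕ) : ℝ) :=
      Real.sqrt_le_sqrt (by exact_mod_cast Nat.le_succ _)
    calc _ ≤ Real.sqrt ((n + 1 + 1 : ℕ) : ℝ) * Real.sqrt ((n + 1 + 1 : ℕ) : ℝ) := by gcongr
      _ = n + 2 := by rw [Real.mul_self_sqrt (Nat.cast_nonneg _)]; push_cast; ring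
  have h3 : ‖(2 * n + 1 : ℂ)‖ = 2 * n + 1 := by
    have : (2 * n + 1 : ℂ) = ((2 * n + 1 : ℕ) : ℂ) := by push_cast; ring
    rw [this, Complex.norm_natCast]
    push_cast
    ring
  have h4 := norm_add₃_le
    (a := ((Real.sqrt (n : ℝ) : ℂ) * Real.sqrt ((n - 1 : ℕ) : ℝ)) • toL2 (psiS (n - 1 - 1) t))
    (b := (2 * n + 1 : ℂ) • toL2 (psiS n t))
    (c := ((Real.sqrt ((n + 1 : ℕ) : ℝ) : ℂ) * Real.sqrt ((n + 1 + 1 : ℕ) : ℝ)) •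
        toL2 (psiS (n + 1 + 1) t))
  simp only [norm_smul, norm_toL2_psiS, norm_mul, Complex.norm_real, h3, Real.norm_eq_abs,
    abs_of_nonneg (Real.sqrt_nonneg _), mul_one] at h4 ⊢
  -- The three coefficients are at most n, 2n + 1 and n + 2; a quarter of their sum is below n + 1.
  norm_num at h4 h1 h2 ⊢
  linarith

theorem norm_gZeroS_psiS_le (a : ℝ) (n : ℕ) (t : ℝ) :
    ‖toL2 (gZeroS a (psiS n t))‖ ≤ (1 + a ^ 2) * (n + 1) := by
  rw [gZeroS_apply, map_add, map_smul]
  refine (norm_add_le _ _).trans ?_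
  rw [norm_smul, norm_toL2_psiS, norm_pow, Complex.norm_real, Real.norm_eq_abs, sq_abs]
  have := norm_freeS_psiS_le n t
  nlinarith [sq_nonneg a, (Nat.cast_nonneg n : (0 : ℝ) ≤ n)]

/-- The components are bounded by a⁻², a⁻¹ and 1 times ‖g₀f‖, and (1 + a⁻¹)² dominates all three. -/
theorem norm_tripleS_le {a : ℝ} (ha : 0 < a) (f : 𝓢(ℝ, ℂ)) :
    ‖tripleS a f‖ ≤ (1 + a⁻¹) ^ 2 * ‖toL2 (gZeroS a f)‖ := by
  have h1 := norm_toL2_le_darbouxS ha f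
  have h2 := norm_darbouxS_le_gZeroS ha f
  have ha' : 0 < a⁻¹ := inv_pos.mpr ha
  have h0 := norm_nonneg (toL2 (gZeroS a f))
  have h3 : ‖toL2 f‖ ≤ a⁻¹ * (a⁻¹ * ‖toL2 (gZeroS a f)‖) := h1.trans (by gcongr)
  have h4 : 0 ≤ a⁻¹ * ‖toL2 (gZeroS a f)‖ := by positivity
  have h5 : 0 ≤ a⁻¹ * (a⁻¹ * ‖toL2 (gZeroS a f)‖) := by positivity
  rw [tripleS_apply, Prod.norm_mk, Prod.norm_mk]
  refine max_le ?_ (max_le ?_ ?_) <;> nlinarith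

theorem norm_tripleS_psiS_le {a : ℝ} (ha : 0 < a) (n : ℕ) (t : ℝ) :
    ‖tripleS a (psiS n t)‖ ≤ (1 + a⁻¹) ^ 2 * (1 + a ^ 2) * (n + 1) := by
  refine (norm_tripleS_le ha _).trans ?_
  rw [mul_assoc]
  gcongr
  exact norm_gZeroS_psiS_le a n t

theorem ext_inner_toL2 {u v : L2}
    (h : ∀ χ : 𝓢(ℝ, ℂ), (inner ℂ (toL2 χ) u : ℂ) = inner ℂ (toL2 χ) v) : u = v := by
  refine ext_inner_left ℂ fun w => ?_
  have h1 : Continuous fun w : L2 => (inner ℂ w u : ℂ) := by fun_prop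
  have h2 : Continuous fun w : L2 => (inner ℂ w v : ℂ) := by fun_prop
  exact congrFun (denseRange_toL2.equalizer h1 h2 (funext h)) w

/-- If `v = ∑ cₙ ψₙ` with `∑ |cₙ| (n + 1)` finite, then the series of `(ψₙ, L ψₙ, g₀ ψₙ)` converges. -/
theorem summable_smul_tripleS {a : ℝ} (ha : 0 < a) (t : ℝ) {c : ℕ → ℂ}
    (hc : Summable fun n => ‖c n‖ * (n + 1)) :
    Summable fun n => c n • tripleS a (psiS n t) := by
  refine Summable.of_norm_bounded
    (g := fun n => (1 + a⁻¹) ^ 2 * (1 + a ^ 2) * (‖c n‖ * (n + 1))) (hc.mul_left _) fun n => ?_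
  rw [norm_smul]
  have := norm_tripleS_psiS_le ha n t
  calc _ ≤ ‖c n‖ * ((1 + a⁻¹) ^ 2 * (1 + a ^ 2) * (n + 1)) := by gcongr
    _ = _ := by ring

/-! ### Rapid decay of the coefficients of a Schwartz function. -/

/-- The number operator, shifted by one. -/
def numS (t : ℝ) (f : 𝓢(ℝ, ℂ)) : 𝓢(ℝ, ℂ) := lowerS t (raiseS t f)

theorem inner_lowerS (t : ℝ) (f g : 𝓢(ℝ, ℂ)) :
    inner ℂ (toL2 (lowerS t f)) (toL2 g) = inner ℂ (toL2 f) (toL2 (raiseS t g)) := by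
  rw [← inner_conj_symm, ← inner_raiseS, inner_conj_symm]

theorem inner_psi_numS (t : ℝ) (n : ℕ) (f : 𝓢(ℝ, ℂ)) :
    inner ℂ (psi n t) (toL2 (numS t f)) = (n + 1 : ℂ) * inner ℂ (psi n t) (toL2 f) := by
  rw [← toL2_psiS, numS, ← inner_raiseS, sqrt_succ_smul_psiS, map_smul, inner_smul_left]
  have h := inner_lowerS t (psiS (n + 1) t) f
  rw [← h, lowerS_psiS, map_smul, inner_smul_left, ← mul_assoc, Complex.conj_ofReal,
    ofReal_sqrt_mul_self]
  simp

/-- Each application of AA⁺ to f multiplies the n-th coefficient by n + 1. The third power leaves (n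
+ 1)⁻² after the weight n + 1 is used up. -/
theorem exists_norm_inner_psi_le (t : ℝ) (f : 𝓢(ℝ, ℂ)) :
    ∃ D : ℝ, ∀ n : ℕ, ‖(inner ℂ (psi n t) (toL2 f) : ℂ)‖ * (n + 1) ^ 3 ≤ D := by
  refine ⟨‖toL2 (numS t (numS t (numS t f)))‖, fun n => ?_⟩
  have h1 := norm_inner_le_norm (𝕜 := ℂ) (psi n t) (toL2 (numS t (numS t (numS t f))))
  rw [inner_psi_numS, inner_psi_numS, inner_psi_numS, norm_psi, one_mul, norm_mul, norm_mul,
    norm_mul] at h1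
  have h2 : ‖(n + 1 : ℂ)‖ = n + 1 := by
    have := Complex.norm_natCast (n + 1)
    push_cast at this
    exact this
  rw [h2] at h1
  refine le_trans (le_of_eq ?_) h1
  ring

theorem summable_inner_psi (t : ℝ) (f : 𝓢(ℝ, ℂ)) :
    Summable fun n : ℕ => ‖(inner ℂ (psi n t) (toL2 f) : ℂ)‖ * (n + 1) := by
  obtain ⟨D, hD⟩ := exists_norm_inner_psi_le t f
  have hs : Summable fun n : ℕ => D * (1 / ((n + 1 : ℕ) : ℝ) ^ 2) :=
    ((summable_nat_add_iff 1).mpr (Real.summable_one_div_nat_pow.mpr one_lt_two)).mul_left D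
  refine Summable.of_nonneg_of_le (fun n => by positivity) (fun n => ?_) hs
  have h := hD n
  push_cast
  rw [mul_one_div, le_div_iff₀ (by positivity)]
  refine le_trans (le_of_eq ?_) h
  ring

/-- Decay gives convergence to some triple. Its last two components are identified weakly: on a
Schwartz test function the operators move to the other side, where the plain L² expansion of f
suffices. -/
theorem hasSum_tripleS {a : ℝ} (ha : 0 < a) (t : ℝ) (f : 𝓢(ℝ, ℂ)) :
    HasSum (fun n => (inner ℂ (psi n t) (toL2 f) : ℂ) • tripleS a (psiS n t)) (tripleS a f) := by
  obtain ⟨Y, hY⟩ := summable_smul_tripleS ha t (summable_inner_psi t f)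
  have h1 := hY.mapL (ContinuousLinearMap.fst ℂ L2 (L2 × L2))
  have h2 := hY.mapL ((ContinuousLinearMap.fst ℂ L2 L2).comp
    (ContinuousLinearMap.snd ℂ L2 (L2 × L2)))
  have h3 := hY.mapL ((ContinuousLinearMap.snd ℂ L2 L2).comp
    (ContinuousLinearMap.snd ℂ L2 (L2 × L2)))
  simp only [map_smul, ContinuousLinearMap.comp_apply, ContinuousLinearMap.coe_fst',
    ContinuousLinearMap.coe_snd', tripleS_apply] at h1 h2 h3
  have e0 := hasSum_psi t (toL2 f)
  have e1 : Y.1 = toL2 f := by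
    refine h1.unique ?_
    simpa only [toL2_psiS] using e0
  have key : ∀ χ : 𝓢(ℝ, ℂ), HasSum (fun n => (inner ℂ (psi n t) (toL2 f) : ℂ) *
      inner ℂ (toL2 χ) (toL2 (psiS n t))) (inner ℂ (toL2 χ) (toL2 f)) := by
    intro χ
    have := e0.mapL (innerSL ℂ (toL2 χ))
    simpa only [map_smul, smul_eq_mul, innerSL_apply_apply, toL2_psiS] using this
  have e2 : Y.2.1 = toL2 (darbouxS a f) := by
    refine ext_inner_toL2 fun χ => ?_
    have := h2.mapL (innerSL ℂ (toL2 χ))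
    simp only [map_smul, smul_eq_mul, innerSL_apply_apply, inner_darbouxS] at this
    rw [inner_darbouxS]
    exact this.unique (key (darbouxAdjS a χ))
  have e3 : Y.2.2 = toL2 (gZeroS a f) := by
    refine ext_inner_toL2 fun χ => ?_
    have := h3.mapL (innerSL ℂ (toL2 χ))
    simp only [map_smul, smul_eq_mul, innerSL_apply_apply, inner_gZeroS] at this
    rw [inner_gZeroS]
    exact this.unique (key (gZeroS a χ))
  have : Y = tripleS a f := by
    rw [tripleS_apply, ← e1, ← e2, ← e3]
  exact this ▸ hY

/-- The span of the `(ψₙ(·,s), φₙ(·,s), g₀ψₙ(·,s))`. -/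
def tripleSpan (a s : ℝ) : Submodule ℂ (L2 × L2 × L2) :=
  Submodule.span ℂ (Set.range fun n => tripleS a (psiS n s))

/-- The closure of the graph of `θ ↦ (L θ, g₀ θ)`. -/
def tripleGraph (a : ℝ) : Submodule ℂ (L2 × L2 × L2) :=
  (LinearMap.range (tripleS a)).topologicalClosure

theorem tripleS_mem_closure_span {a : ℝ} (ha : 0 < a) (s : ℝ) (f : 𝓢(ℝ, ℂ)) :
    tripleS a f ∈ (tripleSpan a s).topologicalClosure := by
  refine (Submodule.isClosed_topologicalClosure _).mem_of_tendsto (hasSum_tripleS ha s f)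
    (Eventually.of_forall fun S => ?_)
  refine (tripleSpan a s).le_topologicalClosure (Submodule.sum_mem _ fun n _ => ?_)
  exact Submodule.smul_mem _ _ (Submodule.subset_span ⟨n, rfl⟩)

/-- The right-hand side carries no instant: this is the source of the independence of H₁ and M from
s. -/
theorem topologicalClosure_tripleSpan {a : ℝ} (ha : 0 < a) (s : ℝ) :
    (tripleSpan a s).topologicalClosure = tripleGraph a := by
  apply le_antisymm
  · refine Submodule.topologicalClosure_mono (Submodule.span_le.mpr ?_)
    rintro _ ⟨n, rfl⟩
    exact ⟨psiS n s, rfl⟩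
  · refine Submodule.topologicalClosure_minimal _ ?_ (Submodule.isClosed_topologicalClosure _)
    rintro _ ⟨f, rfl⟩
    exact tripleS_mem_closure_span ha s f

/-! ### The closures of `L` and `g₀` -/

/-- `(v, u, g) ↦ (v, u)`. -/
def projDarboux : L2 × L2 × L2 →L[ℂ] L2 × L2 :=
  (ContinuousLinearMap.fst ℂ L2 (L2 × L2)).prod
    ((ContinuousLinearMap.fst ℂ L2 L2).comp (ContinuousLinearMap.snd ℂ L2 (L2 × L2)))

/-- `(v, u, g) ↦ (v, g)`. -/
def projGZero : L2 × L2 × L2 →L[ℂ] L2 × L2 :=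
  (ContinuousLinearMap.fst ℂ L2 (L2 × L2)).prod
    ((ContinuousLinearMap.snd ℂ L2 L2).comp (ContinuousLinearMap.snd ℂ L2 (L2 × L2)))

theorem projDarboux_apply (p : L2 × L2 × L2) : projDarboux p = (p.1, p.2.1) := rfl

/-- The graph of the closure of `L`. -/
def darbouxGraph (a : ℝ) : Submodule ℂ (L2 × L2) :=
  ((LinearMap.range (tripleS a)).map (projDarboux : _ →ₗ[ℂ] L2 × L2)).topologicalClosure

/-- The graph of the closure of `g₀`. -/
def gZeroGraph (a : ℝ) : Submodule ℂ (L2 × L2) :=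
  ((LinearMap.range (tripleS a)).map (projGZero : _ →ₗ[ℂ] L2 × L2)).topologicalClosure

theorem mem_tripleGraph_of_isClosed {a : ℝ} {P : L2 × L2 × L2 → Prop} (hP : IsClosed {p | P p})
    (h : ∀ f, P (tripleS a f)) {p : L2 × L2 × L2} (hp : p ∈ tripleGraph a) : P p := by
  refine closure_minimal ?_ hP hp
  rintro _ ⟨f, rfl⟩
  exact h f

theorem mem_darbouxGraph_of_isClosed {a : ℝ} {P : L2 × L2 → Prop} (hP : IsClosed {p | P p})
    (h : ∀ f, P (toL2 f, toL2 (darbouxS a f))) {p : L2 × L2} (hp : p ∈ darbouxGraph a) : P p := by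
  refine closure_minimal ?_ hP hp
  rintro _ ⟨_, ⟨f, rfl⟩, rfl⟩
  exact h f

theorem mem_gZeroGraph_of_isClosed {a : ℝ} {P : L2 × L2 → Prop} (hP : IsClosed {p | P p})
    (h : ∀ f, P (toL2 f, toL2 (gZeroS a f))) {p : L2 × L2} (hp : p ∈ gZeroGraph a) : P p := by
  refine closure_minimal ?_ hP hp
  rintro _ ⟨_, ⟨f, rfl⟩, rfl⟩
  exact h f

theorem darbouxGraph_of_tripleGraph {a : ℝ} {p : L2 × L2 × L2} (hp : p ∈ tripleGraph a) :
    (p.1, p.2.1) ∈ darbouxGraph a := map_topologicalClosure_le _ projDarboux hp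

theorem gZeroGraph_of_tripleGraph {a : ℝ} {p : L2 × L2 × L2} (hp : p ∈ tripleGraph a) :
    (p.1, p.2.2) ∈ gZeroGraph a := map_topologicalClosure_le _ projGZero hp

theorem inner_darbouxGraph {a : ℝ} {p : L2 × L2} (hp : p ∈ darbouxGraph a) (χ : 𝓢(ℝ, ℂ)) :
    (inner ℂ (toL2 χ) p.2 : ℂ) = inner ℂ (toL2 (darbouxAdjS a χ)) p.1 :=
  mem_darbouxGraph_of_isClosed
    (P := fun p => (inner ℂ (toL2 χ) p.2 : ℂ) = inner ℂ (toL2 (darbouxAdjS a χ)) p.1)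
    (isClosed_eq (by fun_prop) (by fun_prop)) (fun f => inner_darbouxS a χ f) hp

theorem inner_gZeroGraph {a : ℝ} {p : L2 × L2} (hp : p ∈ gZeroGraph a) (χ : 𝓢(ℝ, ℂ)) :
    (inner ℂ (toL2 χ) p.2 : ℂ) = inner ℂ (toL2 (gZeroS a χ)) p.1 :=
  mem_gZeroGraph_of_isClosed
    (P := fun p => (inner ℂ (toL2 χ) p.2 : ℂ) = inner ℂ (toL2 (gZeroS a χ)) p.1)
    (isClosed_eq (by fun_prop) (by fun_prop)) (fun f => inner_gZeroS a χ f) hp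

/-- Closability, from a formal adjoint defined on the dense Schwartz space. -/
theorem darbouxGraph_unique {a : ℝ} {v u u' : L2} (h : (v, u) ∈ darbouxGraph a)
    (h' : (v, u') ∈ darbouxGraph a) : u = u' :=
  ext_inner_toL2 fun χ => (inner_darbouxGraph h χ).trans (inner_darbouxGraph h' χ).symm

theorem gZeroGraph_unique {a : ℝ} {v u u' : L2} (h : (v, u) ∈ gZeroGraph a)
    (h' : (v, u') ∈ gZeroGraph a) : u = u' :=
  ext_inner_toL2 fun χ => (inner_gZeroGraph h χ).trans (inner_gZeroGraph h' χ).symm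

theorem norm_le_of_darbouxGraph {a : ℝ} (ha : 0 < a) {p : L2 × L2} (hp : p ∈ darbouxGraph a) :
    ‖p.1‖ ≤ a⁻¹ * ‖p.2‖ :=
  mem_darbouxGraph_of_isClosed (P := fun p => ‖p.1‖ ≤ a⁻¹ * ‖p.2‖)
    (isClosed_le (by fun_prop) (by fun_prop)) (norm_toL2_le_darbouxS ha) hp

theorem norm_le_of_tripleGraph {a : ℝ} (ha : 0 < a) {p : L2 × L2 × L2} (hp : p ∈ tripleGraph a) :
    ‖p.2.1‖ ≤ a⁻¹ * ‖p.2.2‖ :=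
  mem_tripleGraph_of_isClosed (P := fun p => ‖p.2.1‖ ≤ a⁻¹ * ‖p.2.2‖)
    (isClosed_le (by fun_prop) (by fun_prop)) (norm_darbouxS_le_gZeroS ha) hp

/-- `⟨L v, L w⟩ = ⟨v, g₀ w⟩`. -/
theorem inner_darbouxGraph_tripleGraph {a : ℝ} {p : L2 × L2} (hp : p ∈ darbouxGraph a)
    {q : L2 × L2 × L2} (hq : q ∈ tripleGraph a) :
    (inner ℂ p.2 q.2.1 : ℂ) = inner ℂ p.1 q.2.2 := by
  refine mem_tripleGraph_of_isClosed
    (P := fun q => (inner ℂ p.2 q.2.1 : ℂ) = inner ℂ p.1 q.2.2)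
    (isClosed_eq (by fun_prop) (by fun_prop)) (fun g => ?_) hq
  exact mem_darbouxGraph_of_isClosed
    (P := fun p => (inner ℂ p.2 (tripleS a g).2.1 : ℂ) = inner ℂ p.1 (tripleS a g).2.2)
    (isClosed_eq (by fun_prop) (by fun_prop)) (fun f => inner_darbouxS_darbouxS a f g) hp

/-- The domain of ḡ₀ lies in that of L̄: along a sequence on which g₀θ converges, θ and Lθ converge
too. -/
theorem exists_tripleGraph_of_gZeroGraph {a : ℝ} (ha : 0 < a) {p : L2 × L2}
    (hp : p ∈ gZeroGraph a) : ∃ u, (p.1, u, p.2) ∈ tripleGraph a := by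
  obtain ⟨q, hq, hqp⟩ := exists_mem_topologicalClosure_of_bounded_below
    (LinearMap.range (tripleS a)) projGZero (C := (1 + a⁻¹) ^ 2) (by
      rintro _ ⟨f, rfl⟩
      refine (norm_tripleS_le ha f).trans ?_
      gcongr
      exact le_max_right _ _) hp
  refine ⟨q.2.1, ?_⟩
  subst hqp
  exact hq

/-- Surjectivity of ḡ₀: its range is dense by `gZeroS_surjective` and closed by the lower bound. -/
theorem exists_tripleGraph {a : ℝ} (ha : 0 < a) (f : L2) :
    ∃ v u, (v, u, f) ∈ tripleGraph a := by
  obtain ⟨q, hq, hqp⟩ := exists_mem_topologicalClosure_of_bounded_below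
    (LinearMap.range (tripleS a)) ((ContinuousLinearMap.snd ℂ L2 L2).comp
      (ContinuousLinearMap.snd ℂ L2 (L2 × L2))) (C := (1 + a⁻¹) ^ 2) (by
      rintro _ ⟨f, rfl⟩
      exact norm_tripleS_le ha f) (y := f) (by
      refine closure_mono ?_ (denseRange_toL2 f)
      rintro _ ⟨h, rfl⟩
      obtain ⟨w, rfl⟩ := gZeroS_surjective ha h
      exact ⟨tripleS a w, ⟨w, rfl⟩, rfl⟩)
  refine ⟨q.1, q.2.1, ?_⟩
  subst hqp
  exact hq

theorem tripleGraph_unique {a : ℝ} (ha : 0 < a) {v u v' u' f : L2}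
    (h : (v, u, f) ∈ tripleGraph a) (h' : (v', u', f) ∈ tripleGraph a) : v = v' ∧ u = u' := by
  have hs := Submodule.sub_mem _ h h'
  have h1 := norm_le_of_tripleGraph ha hs
  have h2 := norm_le_of_darbouxGraph ha (darbouxGraph_of_tripleGraph hs)
  simp only [Prod.mk_sub_mk, sub_self, norm_zero, mul_zero] at h1 h2
  have h3 : u - u' = 0 := norm_le_zero_iff.mp h1
  rw [h3, norm_zero, mul_zero] at h2
  exact ⟨sub_eq_zero.mp (norm_le_zero_iff.mp h2), sub_eq_zero.mp h3⟩

/-! ### The Hilbert space `H₁` -/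

theorem H1_eq_closure {a : ℝ} (ha : 0 < a) (s : ℝ) :
    H1 a s = ((LinearMap.range (tripleS a)).map
      (((ContinuousLinearMap.fst ℂ L2 L2).comp (ContinuousLinearMap.snd ℂ L2 (L2 × L2)) :
        L2 × L2 × L2 →L[ℂ] L2) : _ →ₗ[ℂ] L2)).topologicalClosure := by
  rw [← topologicalClosure_map_congr (topologicalClosure_tripleSpan ha s)]
  rw [tripleSpan, Submodule.map_span, ← Set.range_comp]
  unfold H1 lineal1
  congr 3
  funext n
  exact (toL2_darbouxS_psiS a n s).symm

theorem H1_eq {a : ℝ} (ha : 0 < a) (s s' : ℝ) : H1 a s' = H1 a s := by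
  rw [H1_eq_closure ha, H1_eq_closure ha]

theorem mem_H1_of_tripleGraph {a : ℝ} (ha : 0 < a) (s : ℝ) {p : L2 × L2 × L2}
    (hp : p ∈ tripleGraph a) : p.2.1 ∈ H1 a s := by
  rw [H1_eq_closure ha]
  exact map_topologicalClosure_le _ ((ContinuousLinearMap.fst ℂ L2 L2).comp
    (ContinuousLinearMap.snd ℂ L2 (L2 × L2))) hp

/-- L̄ maps onto H₁, not merely onto a dense part, since it is bounded below and closed. -/
theorem exists_darbouxGraph {a : ℝ} (ha : 0 < a) {s : ℝ} {u : L2} (hu : u ∈ H1 a s) :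
    ∃ v, (v, u) ∈ darbouxGraph a := by
  rw [H1_eq_closure ha] at hu
  have hu' : u ∈ ((((LinearMap.range (tripleS a)).map (projDarboux : _ →ₗ[ℂ] L2 × L2))).map
      ((ContinuousLinearMap.snd ℂ L2 L2 : L2 × L2 →L[ℂ] L2) : _ →ₗ[ℂ] L2)).topologicalClosure := by
    rw [← Submodule.map_comp]
    exact hu
  obtain ⟨q, hq, hqu⟩ := exists_mem_topologicalClosure_of_bounded_below _ _
    (C := 1 + a⁻¹) (by
      rintro _ ⟨_, ⟨f, rfl⟩, rfl⟩
      have h1 := norm_toL2_le_darbouxS ha f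
      have h2 := norm_nonneg (toL2 (darbouxS a f))
      have h3 : 0 < a⁻¹ := inv_pos.mpr ha
      refine max_le ?_ ?_
      · exact h1.trans (by simp only [projDarboux_apply, tripleS_apply, ContinuousLinearMap.coe_coe,
          ContinuousLinearMap.coe_snd']; nlinarith)
      · simp only [projDarboux_apply, tripleS_apply, ContinuousLinearMap.coe_coe,
          ContinuousLinearMap.coe_snd']; nlinarith) hu'
  subst hqu
  exact ⟨q.1, hq⟩

/-! ### The operators `L̄`, `ḡ₀`, `L̄⁺` and `M` -/

/-- `toLinearPMap` has the given submodule as its graph only if that submodule is single-valued.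
Assuming this for the closure yields both this condition and closability. -/
theorem toLinearPMap_closure_graph {E F : Type*} [NormedAddCommGroup E] [NormedSpace ℂ E]
    [NormedAddCommGroup F] [NormedSpace ℂ F] (A : Submodule ℂ (E × F))
    (h : ∀ p ∈ A.topologicalClosure, p.1 = 0 → p.2 = 0) :
    A.toLinearPMap.closure.graph = A.topologicalClosure := by
  have hg : A.toLinearPMap.graph = A :=
    A.toLinearPMap_graph_eq fun p hp => h p (A.le_topologicalClosure hp)
  have hc : A.toLinearPMap.IsClosable :=
    ⟨A.topologicalClosure.toLinearPMap, by
      rw [hg, Submodule.toLinearPMap_graph_eq _ h]⟩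
  rw [← hc.graph_closure_eq_closure_graph, hg]

theorem gZeroBar_graph {a : ℝ} (ha : 0 < a) (s : ℝ) : (gZeroBar a s).graph = gZeroGraph a := by
  have h : (Submodule.span ℂ (Set.range fun n => (psi n s, gPsi a n s))).topologicalClosure =
      gZeroGraph a := by
    rw [gZeroGraph, ← topologicalClosure_map_congr (topologicalClosure_tripleSpan ha s)]
    rw [tripleSpan, Submodule.map_span, ← Set.range_comp]
    congr 3
  unfold gZeroBar gZeroMin
  rw [toLinearPMap_closure_graph, h]
  rw [h]
  rintro ⟨v, u⟩ hp h0
  simp only at h0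
  subst h0
  exact gZeroGraph_unique hp (Submodule.zero_mem _)

/-- The closure is taken in L² × H₁; the inclusion into L² × L² is inducing, so it can be computed
there. -/
theorem mem_closure_Lmin {a : ℝ} (ha : 0 < a) (s : ℝ) (v : L2) (u : H1 a s) :
    (v, u) ∈ (Submodule.span ℂ (Set.range fun n => (psi n s, phiH1 a n s))).topologicalClosure ↔
      (v, (u : L2)) ∈ darbouxGraph a := by
  set ι : L2 × H1 a s →L[ℂ] L2 × L2 :=
    (ContinuousLinearMap.id ℂ L2).prodMap (H1 a s).subtypeL with hι
  have hind : IsInducing ι := IsInducing.prodMap IsInducing.id IsInducing.subtypeVal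
  have h : ((Submodule.span ℂ (Set.range fun n => (psi n s, phiH1 a n s))).map
      (ι : _ →ₗ[ℂ] L2 × L2)).topologicalClosure = darbouxGraph a := by
    rw [darbouxGraph, ← topologicalClosure_map_congr (topologicalClosure_tripleSpan ha s)]
    rw [tripleSpan, Submodule.map_span, Submodule.map_span, ← Set.range_comp, ← Set.range_comp]
    congr 3
    funext n
    simp [projDarboux_apply, tripleS_apply, toL2_psiS, toL2_darbouxS_psiS, hι, phiH1]
  rw [← h, ← SetLike.mem_coe, ← SetLike.mem_coe, Submodule.topologicalClosure_coe,
    Submodule.topologicalClosure_coe, hind.closure_eq_preimage_closure_image, Submodule.map_coe]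
  rfl

theorem mem_Lbar_graph {a : ℝ} (ha : 0 < a) (s : ℝ) (v : L2) (u : H1 a s) :
    (v, u) ∈ (Lbar a s).graph ↔ (v, (u : L2)) ∈ darbouxGraph a := by
  unfold Lbar Lmin
  rw [toLinearPMap_closure_graph, mem_closure_Lmin ha]
  rintro ⟨v, u⟩ hp h0
  simp only at h0
  subst h0
  rw [mem_closure_Lmin ha] at hp
  exact Subtype.ext (darbouxGraph_unique hp (Submodule.zero_mem _))

/-- L̄⁺ is built from two separate closures; they come from one joint closure because ḡ₀ controls L̄
and L̄ is single-valued. -/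
theorem mem_LbarPlusGraph {a : ℝ} (ha : 0 < a) (s : ℝ) (u : H1 a s) (f : L2) :
    (u, f) ∈ LbarPlusGraph a s ↔ ∃ v, (v, (u : L2), f) ∈ tripleGraph a := by
  constructor
  · rintro ⟨v, h1, h2⟩
    rw [mem_Lbar_graph ha] at h1
    rw [gZeroBar_graph ha] at h2
    obtain ⟨u', hu'⟩ := exists_tripleGraph_of_gZeroGraph ha h2
    have := darbouxGraph_unique h1 (darbouxGraph_of_tripleGraph hu')
    exact ⟨v, this ▸ hu'⟩
  · rintro ⟨v, hv⟩
    refine ⟨v, ?_, ?_⟩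
    · rw [mem_Lbar_graph ha]
      exact darbouxGraph_of_tripleGraph hv
    · rw [gZeroBar_graph ha]
      exact gZeroGraph_of_tripleGraph hv

theorem mem_LbarPlus_graph {a : ℝ} (ha : 0 < a) (s : ℝ) (u : H1 a s) (f : L2) :
    (u, f) ∈ (LbarPlus a s).graph ↔ ∃ v, (v, (u : L2), f) ∈ tripleGraph a := by
  unfold LbarPlus
  rw [Submodule.toLinearPMap_graph_eq, mem_LbarPlusGraph ha]
  rintro ⟨u, f⟩ hp h0
  simp only at h0
  subst h0
  obtain ⟨v, hv⟩ := (mem_LbarPlusGraph ha s _ _).mp hp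
  have h1 := norm_le_of_darbouxGraph ha (darbouxGraph_of_tripleGraph hv)
  simp only [ZeroMemClass.coe_zero, norm_zero, mul_zero, norm_le_zero_iff] at h1
  subst h1
  exact gZeroGraph_unique (gZeroGraph_of_tripleGraph hv) (Submodule.zero_mem _)

theorem mem_M_graph {a : ℝ} (ha : 0 < a) (s : ℝ) (f : L2) (u : H1 a s) :
    (f, u) ∈ (M a s).graph ↔ ∃ v, (v, (u : L2), f) ∈ tripleGraph a := by
  unfold M
  rw [LinearPMap.inverse_graph, ← mem_LbarPlus_graph ha]
  · constructor
    · rintro ⟨p, hp, hpe⟩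
      have : p = (u, f) := by
        rw [← Prod.swap_inj]
        exact hpe
      exact this ▸ hp
    · intro h
      exact ⟨(u, f), h, rfl⟩
  -- The graph of `inverse` is the swapped graph only when the kernel is trivial.
  · rw [LinearMap.ker_eq_bot']
    rintro x hx
    have h1 := (LbarPlus a s).mem_graph x
    have hx' : (LbarPlus a s) x = 0 := hx
    rw [hx'] at h1
    obtain ⟨v, hv⟩ := (mem_LbarPlus_graph ha s _ _).mp h1
    have := (tripleGraph_unique ha hv (Submodule.zero_mem _)).2
    exact Subtype.ext (Subtype.ext this)

theorem M_domain {a : ℝ} (ha : 0 < a) (s : ℝ) : (M a s).domain = ⊤ := by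
  rw [eq_top_iff]
  intro f _
  obtain ⟨v, u, h⟩ := exists_tripleGraph ha f
  have := (mem_M_graph ha s f ⟨u, mem_H1_of_tripleGraph ha s h⟩).mpr ⟨v, h⟩
  exact LinearPMap.mem_domain_of_mem_graph this

/-- As the domain of M is everything, the default value 0 in `applyM` never occurs. -/
theorem exists_applyM {a : ℝ} (ha : 0 < a) (s : ℝ) (f : L2) :
    ∃ v, (v, (applyM a s f : L2), f) ∈ tripleGraph a := by
  have hf : f ∈ (M a s).domain := by rw [M_domain ha]; trivial
  rw [← mem_M_graph ha, applyM, dif_pos hf]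
  exact (M a s).mem_graph ⟨f, hf⟩

theorem applyM_eq_of_tripleGraph {a : ℝ} (ha : 0 < a) (s : ℝ) {v u f : L2}
    (h : (v, u, f) ∈ tripleGraph a) : (applyM a s f : L2) = u := by
  obtain ⟨v', hv'⟩ := exists_applyM ha s f
  exact (tripleGraph_unique ha hv' h).2

theorem applyM_add {a : ℝ} (ha : 0 < a) (s : ℝ) (f g : L2) :
    applyM a s (f + g) = applyM a s f + applyM a s g := by
  obtain ⟨v, hv⟩ := exists_applyM ha s f
  obtain ⟨w, hw⟩ := exists_applyM ha s g
  have h : (v + w, ((applyM a s f + applyM a s g : H1 a s) : L2), f + g) ∈ tripleGraph a :=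
    Submodule.add_mem _ hv hw
  exact Subtype.ext (applyM_eq_of_tripleGraph ha s h)

theorem applyM_smul {a : ℝ} (ha : 0 < a) (s : ℝ) (c : ℂ) (f : L2) :
    applyM a s (c • f) = c • applyM a s f := by
  obtain ⟨v, hv⟩ := exists_applyM ha s f
  have h : (c • v, ((c • applyM a s f : H1 a s) : L2), c • f) ∈ tripleGraph a :=
    Submodule.smul_mem _ c hv
  exact Subtype.ext (applyM_eq_of_tripleGraph ha s h)

theorem norm_applyM_le {a : ℝ} (ha : 0 < a) (s : ℝ) (f : L2) :
    ‖applyM a s f‖ ≤ a⁻¹ * ‖f‖ := by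
  obtain ⟨v, hv⟩ := exists_applyM ha s f
  have h := norm_le_of_tripleGraph ha hv
  rw [Submodule.norm_coe] at h
  exact h

/-- `M` as a bounded operator. -/
def boundedM {a : ℝ} (ha : 0 < a) (s : ℝ) : L2 →L[ℂ] H1 a s :=
  LinearMap.mkContinuous
    { toFun := applyM a s
      map_add' := applyM_add ha s
      map_smul' := applyM_smul ha s }
    a⁻¹ (norm_applyM_le ha s)

theorem applyM_gZeroS {a : ℝ} (ha : 0 < a) (s : ℝ) (f : 𝓢(ℝ, ℂ)) :
    (applyM a s (toL2 (gZeroS a f)) : L2) = toL2 (darbouxS a f) :=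
  applyM_eq_of_tripleGraph ha s (Submodule.le_topologicalClosure _ ⟨f, rfl⟩)

/-- Because Mf = L̄ḡ₀⁻¹f, pairing it with L̄v reproduces ⟨v, f⟩. Every matrix element of η_z in H₁
thereby becomes one of ψ_z in L². -/
theorem inner_applyM {a : ℝ} (ha : 0 < a) (s : ℝ) {p : L2 × L2} (hp : p ∈ darbouxGraph a)
    (f : L2) : (inner ℂ p.2 (applyM a s f : L2) : ℂ) = inner ℂ p.1 f := by
  obtain ⟨v, hv⟩ := exists_applyM ha s f
  exact inner_darbouxGraph_tripleGraph hp hv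

/-! ### The time evolution of the basis -/

theorem dS_psiS_zero (t : ℝ) :
    dS (psiS 0 t) = (-(1 / (2 * (1 + Complex.I * t)))) • coordS (psiS 0 t) := by
  have h := lowerS_psiS_zero t
  have h1 := one_add_I_mul_ne_zero t
  ext x
  have h2 := congrArg (fun f : 𝓢(ℝ, ℂ) => f x) h
  simp only [lowerS_apply, add_apply, smul_apply, smul_eq_mul, zero_apply] at h2 ⊢
  rw [eq_comm, neg_mul, neg_eq_iff_eq_neg, one_div, inv_mul_eq_iff_eq_mul₀ (by simpa using h1)]
  linear_combination (-2) * Complex.I * h2 +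
    ((coordS (psiS 0 t) x) + 2 * (dS (psiS 0 t) x)) * Complex.I_sq

theorem freeS_psiS_zero_apply (t x : ℝ) :
    freeS (psiS 0 t) x = (1 / (2 * (1 + Complex.I * t)) -
      (1 / (2 * (1 + Complex.I * t))) ^ 2 * x ^ 2) * psiS 0 t x := by
  rw [freeS_apply, dS_psiS_zero, map_smul, dS_coordS, dS_psiS_zero, map_smul]
  simp only [neg_apply, smul_apply, add_apply, smul_eq_mul, coordS_apply]
  ring

theorem norm_one_add_I_mul_ge (t : ℝ) : 1 ≤ ‖(1 + Complex.I * t : ℂ)‖ := by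
  have h := Complex.abs_re_le_norm (1 + Complex.I * t)
  simpa using h

/-- Uniform in t because |1 + it| ≥ 1. This and the next bound dominate the differentiation under
the integral sign. -/
theorem norm_psiS_zero_le (t x : ℝ) :
    ‖psiS 0 t x‖ ≤ (2 * Real.pi) ^ (-(1 / 4) : ℝ) := by
  simp only [coe_psiS, psiFun, norm_mul, norm_gauss, Complex.norm_real, Real.norm_eq_abs]
  have h1 : ‖(1 + Complex.I * t : ℂ) ^ (-(1 / 2) : ℂ)‖ ≤ 1 := by
    have : (-(1 / 2) : ℂ) = ((-(1 / 2) : ℝ) : ℂ) := by push_cast; ring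
    rw [this, Complex.norm_cpow_real]
    exact Real.rpow_le_one_of_one_le_of_nonpos (norm_one_add_I_mul_ge t) (by norm_num)
  have h2 : Real.exp (-(1 / (4 * (1 + t ^ 2))) * x ^ 2) ≤ 1 := by
    rw [Real.exp_le_one_iff, neg_mul, neg_nonpos]
    positivity
  rw [abs_of_pos (by positivity)]
  calc _ ≤ (2 * Real.pi) ^ (-(1 / 4) : ℝ) * 1 * 1 := by gcongr
    _ = _ := by ring

theorem norm_freeS_psiS_zero_le (t x : ℝ) :
    ‖freeS (psiS 0 t) x‖ ≤ (1 + x ^ 2) * (2 * Real.pi) ^ (-(1 / 4) : ℝ) := by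
  rw [freeS_psiS_zero_apply, norm_mul]
  have h1 : ‖(1 / (2 * (1 + Complex.I * t)) : ℂ)‖ ≤ 1 := by
    rw [norm_div, norm_mul, norm_one, Complex.norm_ofNat, div_le_one₀]
    · linarith [norm_one_add_I_mul_ge t]
    · linarith [norm_one_add_I_mul_ge t]
  have h2 : ‖(1 / (2 * (1 + Complex.I * t)) -
      (1 / (2 * (1 + Complex.I * t))) ^ 2 * x ^ 2 : ℂ)‖ ≤ 1 + x ^ 2 := by
    refine (norm_sub_le _ _).trans ?_
    rw [norm_mul, norm_pow, norm_pow, Complex.norm_real, Real.norm_eq_abs, sq_abs]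
    have h3 : ‖(1 / (2 * (1 + Complex.I * t)) : ℂ)‖ ^ 2 ≤ 1 := pow_le_one₀ (norm_nonneg _) h1
    nlinarith [sq_nonneg x]
  have h3 := norm_psiS_zero_le t x
  gcongr

theorem hasDerivAt_psiS_zero_apply (t x : ℝ) :
    HasDerivAt (fun r : ℝ => psiS 0 r x) (-Complex.I * freeS (psiS 0 t) x) t := by
  have h0 := one_add_I_mul_ne_zero t
  have h1 : HasDerivAt (fun r : ℂ => 1 + Complex.I * r) Complex.I (t : ℂ) := by
    simpa using ((hasDerivAt_id (t : ℂ)).const_mul Complex.I).const_add 1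
  have hs : (1 + Complex.I * t : ℂ) ∈ Complex.slitPlane := by
    rw [Complex.mem_slitPlane_iff]
    left
    simp
  have h2 := h1.cpow_const (c := (-(1 / 2) : ℂ)) hs
  have h3 : HasDerivAt (fun r : ℂ => -(x : ℂ) ^ 2 / (4 * (1 + Complex.I * r))) _ (t : ℂ) :=
    (hasDerivAt_const (t : ℂ) (-(x : ℂ) ^ 2)).div (h1.const_mul 4) (by simpa using h0)
  have h4 := ((h2.const_mul (((2 * Real.pi) ^ (-(1 / 4) : ℝ) : ℝ) : ℂ)).mul h3.cexp).comp_ofReal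
  convert! h4 using 1
  rw [freeS_psiS_zero_apply, Complex.cpow_sub _ _ h0, Complex.cpow_one]
  simp only [coe_psiS, psiFun]
  field_simp
  ring

theorem hasDerivAt_inner_psiS_zero (χ : 𝓢(ℝ, ℂ)) (t : ℝ) :
    HasDerivAt (fun r : ℝ => (inner ℂ (toL2 χ) (toL2 (psiS 0 r)) : ℂ))
      (inner ℂ (toL2 χ) (-Complex.I • toL2 (freeS (psiS 0 t)))) t := by
  rw [← map_smul]
  simp only [inner_toL2]
  have hbound : Integrable fun x : ℝ =>
      (2 * Real.pi) ^ (-(1 / 4) : ℝ) * (‖χ x‖ + ‖x‖ ^ 2 * ‖χ x‖) :=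
    (χ.integrable.norm.add (χ.integrable_pow_mul volume 2)).const_mul _
  have := hasDerivAt_integral_of_dominated_loc_of_deriv_le (μ := (volume : Measure ℝ))
    (F := fun r x => psiS 0 r x * starRingEnd ℂ (χ x))
    (F' := fun r x => (-Complex.I • freeS (psiS 0 r)) x * starRingEnd ℂ (χ x))
    (x₀ := t) (s := Set.univ)
    (bound := fun x => (2 * Real.pi) ^ (-(1 / 4) : ℝ) * (‖χ x‖ + ‖x‖ ^ 2 * ‖χ x‖))
    Filter.univ_mem
    (Eventually.of_forall fun r => ((psiS 0 r).continuous.mul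
      (Complex.continuous_conj.comp χ.continuous)).aestronglyMeasurable)
    ?_
    (((-Complex.I • freeS (psiS 0 t)).continuous.mul
      (Complex.continuous_conj.comp χ.continuous)).aestronglyMeasurable)
    (Eventually.of_forall fun x r _ => ?_) hbound
    (Eventually.of_forall fun x r _ => ?_)
  · exact this.2
  · refine (χ.integrable.norm.const_mul ((2 * Real.pi) ^ (-(1 / 4) : ℝ))).mono'
      (((psiS 0 t).continuous.mul
      (Complex.continuous_conj.comp χ.continuous)).aestronglyMeasurable)
      (Eventually.of_forall fun x => ?_)
    rw [norm_mul, RCLike.norm_conj]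
    have := norm_psiS_zero_le t x
    gcongr
  · rw [norm_mul, RCLike.norm_conj, smul_apply, norm_smul, norm_neg, Complex.norm_I, one_mul]
    have := norm_freeS_psiS_zero_le r x
    rw [Real.norm_eq_abs, sq_abs]
    calc _ ≤ ((1 + x ^ 2) * (2 * Real.pi) ^ (-(1 / 4) : ℝ)) * ‖χ x‖ := by gcongr
      _ = _ := by ring
  · have := (hasDerivAt_psiS_zero_apply r x).mul_const (starRingEnd ℂ (χ x))
    simpa using this

/-- The commutator i∂ is i times the time derivative of A⁺, so A⁺ maps solutions of the free
equation to solutions. -/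
theorem freeS_raiseS (t : ℝ) (f : 𝓢(ℝ, ℂ)) :
    freeS (raiseS t f) = raiseS t (freeS f) + Complex.I • dS f := by
  simp only [freeS_apply, raiseS_apply, map_sub, map_smul, dS_coordS, map_add, map_neg]
  ext x
  simp
  ring

/-- The induction must range over all test functions: moving A⁺ onto χ replaces it by χ' and xχ. -/
theorem hasDerivAt_inner_psiS (n : ℕ) (χ : 𝓢(ℝ, ℂ)) (t : ℝ) :
    HasDerivAt (fun r : ℝ => (inner ℂ (toL2 χ) (toL2 (psiS n r)) : ℂ))
      (inner ℂ (toL2 χ) (-Complex.I • toL2 (freeS (psiS n t)))) t := by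
  induction n generalizing χ t with
  | zero => exact hasDerivAt_inner_psiS_zero χ t
  | succ n ih =>
    have hne : (Real.sqrt ((n + 1 : ℕ) : ℝ) : ℂ) ≠ 0 := by
      have : (0 : ℝ) < Real.sqrt ((n + 1 : ℕ) : ℝ) := by positivity
      exact_mod_cast this.ne'
    have hpsi : ∀ r, psiS (n + 1) r =
        (Real.sqrt ((n + 1 : ℕ) : ℝ) : ℂ)⁻¹ • raiseS r (psiS n r) := fun r => by
      rw [sqrt_succ_smul_psiS, inv_smul_smul₀ hne]
    have hexp : ∀ (r : ℝ) (g : 𝓢(ℝ, ℂ)), (inner ℂ (toL2 χ) (toL2 (raiseS r g)) : ℂ) =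
        -(Complex.I + r) * inner ℂ (toL2 (dS χ)) (toL2 g) -
          Complex.I / 2 * inner ℂ (toL2 (coordS χ)) (toL2 g) := fun r g => by
      have h := inner_mulS hasTemperateGrowth_id' χ g
      rw [raiseS_apply, map_sub, map_smul, map_smul, inner_sub_right, inner_smul_right,
        inner_smul_right, inner_dS]
      rw [show inner ℂ (toL2 χ) (toL2 (coordS g)) = inner ℂ (toL2 (coordS χ)) (toL2 g) from h]
      ring
    have h1 : HasDerivAt (fun r : ℝ => -(Complex.I + (r : ℂ))) (-1) t := by
      simpa using ((hasDerivAt_id (t : ℂ)).const_add Complex.I).neg.comp_ofReal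
    have h2 := ((h1.mul (ih (dS χ) t)).sub ((ih (coordS χ) t).const_mul (Complex.I / 2))).const_mul
      ((Real.sqrt ((n + 1 : ℕ) : ℝ) : ℂ)⁻¹)
    convert! h2 using 1
    · funext r
      rw [hpsi, map_smul, inner_smul_right, hexp]
      rfl
    · rw [hpsi, map_smul, map_smul, freeS_raiseS, map_add, map_smul, inner_smul_right,
        inner_smul_right, inner_add_right, inner_smul_right, hexp, inner_dS, inner_smul_right,
        inner_smul_right]
      linear_combination (Real.sqrt ((n + 1 : ℕ) : ℝ) : ℂ)⁻¹ *
        inner ℂ (toL2 (dS χ)) (toL2 (psiS n t)) * Complex.I_sq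

/-! ### From weak to norm differentiability. -/

theorem norm_le_of_forall_inner_toL2 {u : L2} {K : ℝ}
    (h : ∀ χ : 𝓢(ℝ, ℂ), ‖(inner ℂ (toL2 χ) u : ℂ)‖ ≤ K * ‖toL2 χ‖) : ‖u‖ ≤ K := by
  have h1 : ∀ v : L2, ‖(inner ℂ v u : ℂ)‖ ≤ K * ‖v‖ := fun v => by
    refine denseRange_toL2.induction_on (p := fun v => ‖(inner ℂ v u : ℂ)‖ ≤ K * ‖v‖) v
      (isClosed_le (by fun_prop) (by fun_prop)) h
  have h2 := h1 u
  rw [inner_self_eq_norm_sq_to_K] at h2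
  simp only [Complex.coe_algebraMap, norm_pow, Complex.norm_real, norm_norm] at h2
  rcases (norm_nonneg u).eq_or_lt with h0 | h0
  · rw [← h0]
    obtain ⟨χ, hχ⟩ : ∃ χ : 𝓢(ℝ, ℂ), 0 < ‖toL2 χ‖ := ⟨psiS 0 0, by simp [norm_toL2_psiS]⟩
    have h3 := (norm_nonneg _).trans (h χ)
    exact nonneg_of_mul_nonneg_left h3 hχ
  · rw [sq] at h2
    exact le_of_mul_le_mul_right h2 h0

/-- A curve in `L²` with a continuous weak derivative is differentiable. -/
theorem hasDerivAt_of_inner_toL2 {F G : ℝ → L2} (hG : Continuous G)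
    (h : ∀ (χ : 𝓢(ℝ, ℂ)) (t : ℝ), HasDerivAt (fun r => (inner ℂ (toL2 χ) (F r) : ℂ))
      (inner ℂ (toL2 χ) (G t)) t) (t : ℝ) : HasDerivAt F (G t) t := by
  have key : ∀ r, F r = F t + ∫ y in t..r, G y := by
    intro r
    refine ext_inner_toL2 fun χ => ?_
    have h1 := intervalIntegral.integral_eq_sub_of_hasDerivAt (a := t) (b := r)
      (fun y _ => h χ y) (Continuous.intervalIntegrable (by fun_prop) _ _)
    have h2 := (innerSL ℂ (toL2 χ)).intervalIntegral_comp_comm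
      (hG.intervalIntegrable (μ := volume) t r)
    simp only [innerSL_apply_apply] at h2
    rw [inner_add_right, ← h2, h1]
    ring
  have h3 := (intervalIntegral.integral_hasDerivAt_right (hG.intervalIntegrable t t)
    (hG.stronglyMeasurableAtFilter _ _) hG.continuousAt).const_add (F t)
  exact h3.congr_of_eventuallyEq (Eventually.of_forall key)

/-- The weak derivative is bounded by n + 1 uniformly in time, which gives a Lipschitz bound in
norm. As -∂²ψₙ is a finite combination of basis vectors, it is then continuous in time, as
`hasDerivAt_of_inner_toL2` requires. -/
theorem continuous_psi (n : ℕ) : Continuous (psi n) := by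
  have hlip : LipschitzWith ⟨n + 1, by positivity⟩ (psi n) := by
    refine LipschitzWith.of_dist_le_mul fun t r => ?_
    rw [dist_eq_norm]
    refine norm_le_of_forall_inner_toL2 fun χ => ?_
    have h := Convex.norm_image_sub_le_of_norm_hasDerivWithin_le (𝕜 := ℝ) (s := Set.univ)
      (C := ‖toL2 χ‖ * (n + 1)) (x := r) (y := t)
      (fun y _ => (hasDerivAt_inner_psiS n χ y).hasDerivWithinAt) (fun y _ => by
        refine (norm_inner_le_norm _ _).trans ?_
        rw [norm_smul, norm_neg, Complex.norm_I, one_mul]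
        have := norm_freeS_psiS_le n y
        gcongr) convex_univ (Set.mem_univ _) (Set.mem_univ _)
    rw [← toL2_psiS, ← toL2_psiS, inner_sub_right, dist_eq_norm]
    refine h.trans (le_of_eq ?_)
    change ‖toL2 χ‖ * (n + 1) * ‖t - r‖ = (n + 1) * ‖t - r‖ * ‖toL2 χ‖
    ring
  exact hlip.continuous

theorem continuous_freeS_psiS (n : ℕ) : Continuous fun t => toL2 (freeS (psiS n t)) := by
  simp only [freeS_psiS, map_smul, map_add, toL2_psiS]
  have h1 := continuous_psi (n - 1 - 1)
  have h2 := continuous_psi n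
  have h3 := continuous_psi (n + 1 + 1)
  fun_prop

theorem hasDerivAt_psi (n : ℕ) (t : ℝ) :
    HasDerivAt (psi n) (-Complex.I • toL2 (freeS (psiS n t))) t := by
  refine hasDerivAt_of_inner_toL2 (G := fun t => -Complex.I • toL2 (freeS (psiS n t)))
    (by have := continuous_freeS_psiS n; fun_prop) (fun χ r => ?_) t
  simpa only [toL2_psiS] using hasDerivAt_inner_psiS n χ r

/-! ### The vectors `ψ_z` and `η_z` -/

/-- The coefficient of `ψₙ` in `ψ_z`. -/
def csCoef (z : ℂ) (n : ℕ) : ℂ := (Phi z : ℂ) * ((coef n : ℂ) * z ^ n)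

theorem coef_nonneg (n : ℕ) : 0 ≤ coef n := by unfold coef; positivity

theorem coef_sq (n : ℕ) : coef n ^ 2 = ((n.factorial : ℝ))⁻¹ := by
  rw [coef, inv_pow, Real.sq_sqrt (Nat.cast_nonneg _)]

/-- The square of the n-th term is 2⁻ⁿ · (2r²)ⁿ/n!, a product of terms of two convergent series, so
the term is at most their sum. -/
theorem summable_coef_mul_pow (r : ℝ) : Summable fun n : ℕ => coef n * |r| ^ n := by
  have h1 : Summable fun n : ℕ => (1 / 2 : ℝ) ^ n := summable_geometric_two
  have h2 : Summable fun n : ℕ => (2 * |r| ^ 2) ^ n / (n.factorial : ℝ) :=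
    Real.summable_pow_div_factorial _
  refine Summable.of_nonneg_of_le
    (fun n => mul_nonneg (coef_nonneg n) (by positivity)) (fun n => ?_) (h1.add h2)
  have h3 : (coef n * |r| ^ n) ^ 2 = (1 / 2 : ℝ) ^ n * ((2 * |r| ^ 2) ^ n / (n.factorial : ℝ)) := by
    rw [mul_pow, coef_sq, div_pow, one_pow, mul_pow]
    field_simp
    ring
  have hx : (0 : ℝ) ≤ (1 / 2) ^ n := by positivity
  have hy : (0 : ℝ) ≤ (2 * |r| ^ 2) ^ n / (n.factorial : ℝ) := by positivity
  refine le_of_sq_le_sq ?_ (add_nonneg hx hy)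
  rw [h3]
  nlinarith

theorem summable_csCoef (z : ℂ) : Summable fun n : ℕ => ‖csCoef z n‖ * (n + 1) := by
  -- The factor n + 1 ≤ 2ⁿ is absorbed by doubling |z|.
  have h := (summable_coef_mul_pow (2 * ‖z‖)).mul_left |Phi z|
  refine Summable.of_nonneg_of_le (fun n => by positivity) (fun n => ?_) h
  have h1 : (n + 1 : ℝ) ≤ 2 ^ n := by
    have := Nat.lt_two_pow_self (n := n)
    exact_mod_cast this
  rw [csCoef, norm_mul, norm_mul, Complex.norm_real, Complex.norm_real, norm_pow, Real.norm_eq_abs,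
    Real.norm_eq_abs, abs_of_nonneg (coef_nonneg n), abs_mul, abs_two, abs_norm, mul_pow]
  have := coef_nonneg n
  calc |Phi z| * (coef n * ‖z‖ ^ n) * (n + 1) ≤ |Phi z| * (coef n * ‖z‖ ^ n) * 2 ^ n := by gcongr
    _ = _ := by ring

theorem summable_norm_csCoef (z : ℂ) : Summable fun n : ℕ => ‖csCoef z n‖ := by
  refine Summable.of_nonneg_of_le (fun n => norm_nonneg _) (fun n => ?_) (summable_csCoef z)
  have : (0 : ℝ) ≤ n := Nat.cast_nonneg n
  nlinarith [norm_nonneg (csCoef z n)]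

theorem hasSum_psiZ (z : ℂ) (t : ℝ) : HasSum (fun n => csCoef z n • psi n t) (psiZ z t) := by
  have hs : Summable fun n => csCoef z n • psi n t := by
    refine Summable.of_norm_bounded (summable_norm_csCoef z) fun n => ?_
    rw [norm_smul, norm_psi, mul_one]
  have h : psiZ z t = ∑' n, csCoef z n • psi n t := by
    unfold psiZ csCoef
    rw [← tsum_const_smul'']
    simp only [smul_smul]
  rw [h]
  exact hs.hasSum

theorem hasSum_etaZ {a : ℝ} (ha : 0 < a) (s : ℝ) (z : ℂ) (t : ℝ) :
    HasSum (fun n => csCoef z n • etaN a s n t) (etaZ a s z t) := by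
  have := (hasSum_psiZ z t).mapL (boundedM ha s)
  simp only [map_smul] at this
  exact this

/-- The vector `h₀ ψ_z`. -/
def freePsiZ (z : ℂ) (t : ℝ) : L2 := ∑' n, csCoef z n • toL2 (freeS (psiS n t))

theorem norm_csCoef_smul_freeS_le (z : ℂ) (n : ℕ) (t : ℝ) :
    ‖csCoef z n • toL2 (freeS (psiS n t))‖ ≤ ‖csCoef z n‖ * (n + 1) := by
  rw [norm_smul]
  have := norm_freeS_psiS_le n t
  gcongr

theorem hasSum_freePsiZ (z : ℂ) (t : ℝ) :
    HasSum (fun n => csCoef z n • toL2 (freeS (psiS n t))) (freePsiZ z t) :=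
  (Summable.of_norm_bounded (summable_csCoef z)
    fun n => norm_csCoef_smul_freeS_le z n t).hasSum

theorem hasDerivAt_psiZ (z : ℂ) (t : ℝ) :
    HasDerivAt (psiZ z) (-Complex.I • freePsiZ z t) t := by
  have h := hasDerivAt_tsum (summable_csCoef z)
    (g := fun n t => csCoef z n • psi n t)
    (g' := fun n t => csCoef z n • (-Complex.I • toL2 (freeS (psiS n t))))
    (fun n y => (hasDerivAt_psi n y).const_smul (csCoef z n))
    (fun n y => by
      rw [smul_comm, norm_smul, norm_neg, Complex.norm_I, one_mul]
      exact norm_csCoef_smul_freeS_le z n y)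
    (y₀ := t) (hasSum_psiZ z t).summable t
  have h1 : psiZ z = fun t => ∑' n, csCoef z n • psi n t :=
    funext fun t => (hasSum_psiZ z t).tsum_eq.symm
  have h2 : -Complex.I • freePsiZ z t =
      ∑' n, csCoef z n • (-Complex.I • toL2 (freeS (psiS n t))) := by
    rw [freePsiZ, ← tsum_const_smul'']
    simp only [smul_comm (csCoef z _)]
  rw [h1, h2]
  exact h

theorem hasDerivAt_etaZ {a : ℝ} (ha : 0 < a) (s : ℝ) (z : ℂ) (t : ℝ) :
    HasDerivAt (etaZ a s z) (boundedM ha s (-Complex.I • freePsiZ z t)) t :=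
  ((boundedM ha s).restrictScalars ℝ).hasFDerivAt.comp_hasDerivAt t (hasDerivAt_psiZ z t)

/-! ### The soliton Hamiltonian -/

theorem exists_of_mem_testPairs {a : ℝ} {p : L2 × L2}
    (hp : p ∈ testPairs (solitonPotential a)) :
    ∃ χ : 𝓢(ℝ, ℂ), p.1 = toL2 χ ∧ p.2 = toL2 (solitonS a χ) := by
  obtain ⟨θ, h1, h2, h3, h4⟩ := hp
  refine ⟨h2.toSchwartzMap h1, ?_, ?_⟩
  · refine Lp.ext (h3.trans ?_)
    exact (toL2_coeFn (h2.toSchwartzMap h1)).symm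
  · refine Lp.ext (h4.trans ?_)
    refine EventuallyEq.trans ?_ (toL2_coeFn _).symm
    rw [coe_solitonS]
    rfl

theorem mem_schrodingerGraph_schwartz (a : ℝ) (f : 𝓢(ℝ, ℂ)) :
    (toL2 f, toL2 (solitonS a f)) ∈ schrodingerGraph (solitonPotential a) := by
  intro θ hθ
  obtain ⟨χ, h1, h2⟩ := exists_of_mem_testPairs hθ
  rw [h1, h2]
  exact (inner_solitonS a χ f).symm

theorem isClosed_schrodingerGraph (V : ℝ → ℝ) :
    IsClosed (schrodingerGraph V : Set (L2 × L2)) := by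
  have : (schrodingerGraph V : Set (L2 × L2)) =
      ⋂ θ ∈ testPairs V, {p | (inner ℂ θ.2 p.1 : ℂ) = inner ℂ θ.1 p.2} := by
    ext p
    simp only [Set.mem_iInter]
    rfl
  rw [this]
  exact isClosed_biInter fun θ _ => isClosed_eq (by fun_prop) (by fun_prop)

theorem eq_zero_of_zero_mem_schrodingerGraph {a : ℝ} {g : L2}
    (h : (0, g) ∈ schrodingerGraph (solitonPotential a)) : g = 0 := by
  have hloc : LocallyIntegrable (g : ℝ → ℂ) volume :=
    (Lp.memLp g).locallyIntegrable one_le_two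
  refine Lp.eq_zero_iff_ae_eq_zero.mpr
    (ae_eq_zero_of_integral_contDiff_smul_eq_zero hloc fun w hw hwc => ?_)
  have hcd : ContDiff ℝ (⊤ : ℕ∞) fun x => (w x : ℂ) := Complex.ofRealCLM.contDiff.comp hw
  have hcs : HasCompactSupport fun x => (w x : ℂ) := hwc.comp_left (g := Complex.ofReal) rfl
  set χ : 𝓢(ℝ, ℂ) := hcs.toSchwartzMap hcd
  have h1 := h (toL2 χ, toL2 (solitonS a χ)) ⟨_, hcd, hcs, toL2_coeFn χ, by
    refine (toL2_coeFn _).trans ?_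
    rw [coe_solitonS]
    rfl⟩
  simp only [inner_zero_right] at h1
  rw [inner_toL2_left] at h1
  rw [h1]
  congr 1 with x
  have : χ x = (w x : ℂ) := rfl
  rw [this, Complex.conj_ofReal, Complex.real_smul, mul_comm]

theorem hOne_graph {a : ℝ} (s : ℝ) (f g : H1 a s) :
    (f, g) ∈ (hOne a s).graph ↔ ((f : L2), (g : L2)) ∈ schrodingerGraph (solitonPotential a) := by
  unfold hOne
  rw [Submodule.toLinearPMap_graph_eq]
  · rfl
  · rintro ⟨f, g⟩ hp h0
    simp only at h0
    subst h0
    have : ((0 : L2), (g : L2)) ∈ schrodingerGraph (solitonPotential a) := hp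
    exact Subtype.ext (eq_zero_of_zero_mem_schrodingerGraph this)

theorem gZeroS_freeS (a : ℝ) (f : 𝓢(ℝ, ℂ)) : gZeroS a (freeS f) = freeS (gZeroS a f) := by
  rw [gZeroS_apply, gZeroS_apply, map_add, map_smul]

/-- The intertwining relation `h₁ M = M h₀` on the Schwartz space. -/
theorem applyM_mem_schrodingerGraph {a : ℝ} (ha : 0 < a) (s : ℝ) (f : 𝓢(ℝ, ℂ)) :
    ((applyM a s (toL2 f) : L2), (applyM a s (toL2 (freeS f)) : L2)) ∈
      schrodingerGraph (solitonPotential a) := by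
  -- With f = g₀w one has Mf = Lw and Mh₀f = Mg₀h₀w = Lh₀w = h₁Lw.
  obtain ⟨w, rfl⟩ := gZeroS_surjective ha f
  rw [← gZeroS_freeS, applyM_gZeroS ha, applyM_gZeroS ha, ← solitonS_darbouxS]
  exact mem_schrodingerGraph_schwartz a _

/-- The partial sums lie in the graph of the maximal operator, which is closed; membership of η_z in
the domain is part of the conclusion. -/
theorem etaZ_mem_hOne_graph {a : ℝ} (ha : 0 < a) (s : ℝ) (z : ℂ) (t : ℝ) :
    (etaZ a s z t, boundedM ha s (freePsiZ z t)) ∈ (hOne a s).graph := by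
  rw [hOne_graph]
  have h1 := (hasSum_psiZ z t).mapL ((H1 a s).subtypeL.comp (boundedM ha s))
  have h2 := (hasSum_freePsiZ z t).mapL ((H1 a s).subtypeL.comp (boundedM ha s))
  refine (isClosed_schrodingerGraph _).mem_of_tendsto (h1.prodMk h2)
    (Eventually.of_forall fun S => ?_)
  refine Submodule.sum_mem _ fun n _ => ?_
  rw [map_smul, map_smul, ← Prod.smul_mk, ← toL2_psiS]
  exact Submodule.smul_mem _ _ (applyM_mem_schrodingerGraph ha s (psiS n t))

theorem etaZ_schrodinger {a : ℝ} (ha : 0 < a) (s : ℝ) (z : ℂ) (t : ℝ) :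
    ∃ hz : etaZ a s z t ∈ (hOne a s).domain, ∃ η' : H1 a s,
      HasDerivAt (etaZ a s z) η' t ∧ Complex.I • η' = hOne a s ⟨etaZ a s z t, hz⟩ := by
  have h := etaZ_mem_hOne_graph ha s z t
  have hz := LinearPMap.mem_domain_of_mem_graph h
  refine ⟨hz, _, hasDerivAt_etaZ ha s z t, ?_⟩
  rw [LinearPMap.image_iff hz, map_smul, smul_smul]
  simpa using h

/-! ### Gaussian moments in the complex plane -/

theorem Phi_sq (z : ℂ) : (Phi z) ^ 2 = Real.exp (-‖z‖ ^ 2) := by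
  rw [Phi, ← Real.exp_nat_mul]
  congr 1
  push_cast
  ring

theorem integral_norm_pow_mul_exp (m : ℕ) :
    ∫ z : ℂ, ‖z‖ ^ m * Real.exp (-‖z‖ ^ 2) = Real.pi * Real.Gamma ((m + 2) / 2) := by
  have h := Complex.integral_rpow_mul_exp_neg_rpow (p := 2) (q := m) one_le_two
    (by have : (0 : ℝ) ≤ m := Nat.cast_nonneg m; linarith)
  simp only [Real.rpow_natCast, Real.rpow_two] at h
  rw [h]
  ring

theorem integrable_norm_pow_mul_exp (m : ℕ) :
    Integrable fun z : ℂ => ‖z‖ ^ m * Real.exp (-‖z‖ ^ 2) := by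
  -- A non-integrable function has integral 0 by convention, whereas the computed value is positive.
  by_contra h
  have h1 := integral_norm_pow_mul_exp m
  rw [integral_undef h] at h1
  have : 0 < Real.Gamma (((m : ℝ) + 2) / 2) := Real.Gamma_pos_of_pos (by positivity)
  have := mul_pos Real.pi_pos this
  linarith

theorem integrable_moment (n k : ℕ) :
    Integrable fun z : ℂ => (Phi z : ℂ) ^ 2 * z ^ n * (starRingEnd ℂ z) ^ k := by
  have hc : Continuous fun z : ℂ => (Phi z : ℂ) ^ 2 * z ^ n * (starRingEnd ℂ z) ^ k := by
    unfold Phi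
    fun_prop
  rw [← integrable_norm_iff hc.aestronglyMeasurable]
  refine (integrable_norm_pow_mul_exp (n + k)).congr (Eventually.of_forall fun z => ?_)
  simp only [norm_mul, norm_pow, Complex.norm_real, RCLike.norm_conj, Real.norm_eq_abs, sq_abs,
    Phi_sq]
  ring

/-- The moments of the Gaussian measure `exp (-|z|²) dx dy`. -/
theorem integral_moment (n k : ℕ) :
    ∫ z : ℂ, (Phi z : ℂ) ^ 2 * z ^ n * (starRingEnd ℂ z) ^ k =
      if n = k then (Real.pi * n.factorial : ℂ) else 0 := by
  split_ifs with hnk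
  · subst hnk
    have h : ∀ z : ℂ, (Phi z : ℂ) ^ 2 * z ^ n * (starRingEnd ℂ z) ^ n =
        ((‖z‖ ^ (2 * n) * Real.exp (-‖z‖ ^ 2) : ℝ) : ℂ) := fun z => by
      rw [mul_assoc, ← mul_pow, Complex.mul_conj, Complex.normSq_eq_norm_sq, ← Phi_sq, pow_mul]
      push_cast
      ring
    simp only [h]
    rw [integral_complex_ofReal, integral_norm_pow_mul_exp]
    have : (((2 * n : ℕ) : ℝ) + 2) / 2 = n + 1 := by push_cast; ring
    rw [this, Real.Gamma_nat_eq_factorial]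
    push_cast
    ring
  -- The rotation by π/(n - k) preserves the measure and multiplies zⁿz̄ᵏ by exp(iπ) = -1.
  · set c : Circle := Circle.exp (Real.pi / ((n : ℝ) - k)) with hc
    have hne : ((n : ℝ) - k) ≠ 0 := sub_ne_zero.mpr (by exact_mod_cast hnk)
    have hcc : (c : ℂ) ^ n * (starRingEnd ℂ (c : ℂ)) ^ k = -1 := by
      rw [hc, Circle.coe_exp, ← Complex.exp_conj, ← Complex.exp_nat_mul, ← Complex.exp_nat_mul,
        ← Complex.exp_add, ← Complex.exp_pi_mul_I]
      congr 1
      have hne' : ((n : ℂ) - k) ≠ 0 := by exact_mod_cast hne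
      simp only [map_mul, Complex.conj_ofReal, Complex.conj_I]
      push_cast
      field_simp
      ring
    have h1 := (LinearIsometryEquiv.measurePreserving (rotation c)).integral_comp
      (rotation c).toHomeomorph.measurableEmbedding
      (fun z : ℂ => (Phi z : ℂ) ^ 2 * z ^ n * (starRingEnd ℂ z) ^ k)
    have h2 : ∀ z : ℂ, (Phi (rotation c z) : ℂ) ^ 2 * (rotation c z) ^ n *
        (starRingEnd ℂ (rotation c z)) ^ k =
        -((Phi z : ℂ) ^ 2 * z ^ n * (starRingEnd ℂ z) ^ k) := fun z => by
      have : Phi (rotation c z) = Phi z := by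
        rw [Phi, Phi, LinearIsometryEquiv.norm_map]
      rw [this, rotation_apply, map_mul, mul_pow, mul_pow]
      linear_combination ((Phi z : ℂ) ^ 2 * z ^ n * (starRingEnd ℂ z) ^ k) * hcc
    simp only [h2] at h1
    rw [integral_neg] at h1
    exact CharZero.neg_eq_self_iff.mp h1

/-- x² = (z² + 2zz̄ + z̄²)/4 reduces to three Gaussian moments; the middle one raises both
exponents, whence (n + 1)!. -/
theorem integrable_re_sq_moment (n k : ℕ) :
    (Integrable fun z : ℂ => (z.re : ℂ) ^ 2 *
      ((Phi z : ℂ) ^ 2 * z ^ n * (starRingEnd ℂ z) ^ k)) ∧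
    ∫ z : ℂ, (z.re : ℂ) ^ 2 * ((Phi z : ℂ) ^ 2 * z ^ n * (starRingEnd ℂ z) ^ k) =
      (1 / 4 : ℂ) * ((if n + 2 = k then (Real.pi * (n + 2).factorial : ℂ) else 0) +
        2 * (if n = k then (Real.pi * (n + 1).factorial : ℂ) else 0) +
        (if n = k + 2 then (Real.pi * n.factorial : ℂ) else 0)) := by
  have h : ∀ z : ℂ, (z.re : ℂ) ^ 2 * ((Phi z : ℂ) ^ 2 * z ^ n * (starRingEnd ℂ z) ^ k) =
      (1 / 4 : ℂ) * (((Phi z : ℂ) ^ 2 * z ^ (n + 2) * (starRingEnd ℂ z) ^ k) +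
        2 * ((Phi z : ℂ) ^ 2 * z ^ (n + 1) * (starRingEnd ℂ z) ^ (k + 1)) +
        ((Phi z : ℂ) ^ 2 * z ^ n * (starRingEnd ℂ z) ^ (k + 2))) := fun z => by
    rw [Complex.re_eq_add_conj]
    ring
  simp only [h]
  have i1 := integrable_moment (n + 2) k
  have i2 := (integrable_moment (n + 1) (k + 1)).const_mul 2
  have i3 := integrable_moment n (k + 2)
  have j1 := integral_moment (n + 2) k
  have j2 := integral_moment (n + 1) (k + 1)
  have j3 := integral_moment n (k + 2)
  have i12 : Integrable fun z : ℂ => (Phi z : ℂ) ^ 2 * z ^ (n + 2) * (starRingEnd ℂ z) ^ k +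
      2 * ((Phi z : ℂ) ^ 2 * z ^ (n + 1) * (starRingEnd ℂ z) ^ (k + 1)) := i1.add i2
  refine ⟨(i12.add i3).const_mul _, ?_⟩
  rw [integral_const_mul, integral_add i12 i3, integral_add i1 i2, integral_const_mul,
    j1, j2, j3]
  simp only [Nat.add_right_cancel_iff]

/-! ### Weighted Gaussian moments and the matrix of g₀. -/

theorem coef_pos (n : ℕ) : 0 < coef n := by
  unfold coef
  positivity

theorem coef_sq_mul_factorial (n : ℕ) : (coef n : ℂ) ^ 2 * (n.factorial : ℂ) = 1 := by
  have h : coef n ^ 2 * (n.factorial : ℝ) = 1 := by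
    rw [coef_sq]
    exact inv_mul_cancel₀ (by positivity)
  exact_mod_cast h

theorem coef_succ_mul_sqrt (n : ℕ) :
    (coef (n + 1) : ℂ) * Real.sqrt ((n + 1 : ℕ) : ℝ) = coef n := by
  have h : coef (n + 1) * Real.sqrt ((n + 1 : ℕ) : ℝ) = coef n := by
    rw [coef, coef, Nat.factorial_succ, Nat.cast_mul, Real.sqrt_mul (Nat.cast_nonneg _), mul_inv]
    have : Real.sqrt ((n + 1 : ℕ) : ℝ) ≠ 0 := by positivity
    field_simp
  exact_mod_cast h

theorem inner_psi_gPsi (a : ℝ) (t : ℝ) (n k : ℕ) :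
    (inner ℂ (psi n t) (gPsi a k t) : ℂ) = (1 / 4 : ℂ) *
      ((if n + 2 = k then ((Real.sqrt ((n + 1 : ℕ) : ℝ) : ℂ) * Real.sqrt ((n + 2 : ℕ) : ℝ))
          else 0) +
        (if n = k then (2 * n + 1 + 4 * a ^ 2 : ℂ) else 0) +
        (if n = k + 2 then ((Real.sqrt ((k + 1 : ℕ) : ℝ) : ℂ) * Real.sqrt ((k + 2 : ℕ) : ℝ))
          else 0)) := by
  rw [← toL2_gZeroS_psiS, gZeroS_apply, freeS_psiS, map_add, map_smul, map_smul, map_add, map_add,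
    map_smul, map_smul, map_smul, inner_add_right, inner_smul_right, inner_smul_right,
    inner_add_right, inner_add_right, inner_smul_right, inner_smul_right, inner_smul_right]
  simp only [toL2_psiS, inner_psi]
  rcases k with _ | _ | k
  · simp only [Nat.cast_zero, Real.sqrt_zero]
    split_ifs <;> simp_all
    ring
  · simp only [zero_add, Nat.sub_self, Nat.cast_zero, Real.sqrt_zero]
    split_ifs <;> first | omega | (subst_vars; push_cast; ring_nf)
  · simp only [Nat.add_sub_cancel]
    split_ifs <;> first | omega | (subst_vars; push_cast; ring_nf)

/-- This is where the density is determined. On the diagonal x² contributes (n + 1)/2, while -∂² has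
(2n + 1)/4: the difference is the 1/4 subtracted in ω_η. The entries with |n - k| = 2 agree without
correction. -/
theorem coef_mul_integral_eq (a : ℝ) (t : ℝ) (n k : ℕ) :
    (coef n : ℂ) * coef k *
      ((∫ z : ℂ, (z.re : ℂ) ^ 2 * ((Phi z : ℂ) ^ 2 * z ^ n * (starRingEnd ℂ z) ^ k)) +
        (a ^ 2 - 1 / 4 : ℂ) * ∫ z : ℂ, (Phi z : ℂ) ^ 2 * z ^ n * (starRingEnd ℂ z) ^ k) =
      Real.pi * inner ℂ (psi n t) (gPsi a k t) := by
  rw [(integrable_re_sq_moment n k).2, integral_moment, inner_psi_gPsi]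
  by_cases h1 : n = k
  · subst h1
    have := coef_sq_mul_factorial n
    simp [Nat.factorial_succ]
    linear_combination (Real.pi * (2 * (n + 1) / 4 + a ^ 2 - 1 / 4) : ℂ) * this
  by_cases h2 : n + 2 = k
  · subst h2
    have h3 : ¬ n = n + 2 + 2 := by omega
    have e1 := coef_sq_mul_factorial (n + 2)
    have e2 := coef_succ_mul_sqrt n
    have e3 := coef_succ_mul_sqrt (n + 1)
    simp only [if_neg h1, if_neg h3, if_true]
    rw [← e2, ← e3]
    linear_combination (1 / 4 * Real.pi * Real.sqrt ((n + 1 : ℕ) : ℝ) *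
      Real.sqrt ((n + 2 : ℕ) : ℝ) : ℂ) * e1
  by_cases h3 : n = k + 2
  · subst h3
    have e1 := coef_sq_mul_factorial (k + 2)
    have e2 := coef_succ_mul_sqrt k
    have e3 := coef_succ_mul_sqrt (k + 1)
    simp only [if_neg h1, if_neg h2, if_true]
    rw [← e2, ← e3]
    linear_combination (1 / 4 * Real.pi * Real.sqrt ((k + 1 : ℕ) : ℝ) *
      Real.sqrt ((k + 2 : ℕ) : ℝ) : ℂ) * e1
  · simp [h1, h2, h3]

/-! ### The holomorphic representation -/

/-- The Hilbert space `L²(ℂ)`. -/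
abbrev L2C : Type := Lp ℂ 2 (volume : Measure ℂ)

theorem csCoef_mul_conj (n k : ℕ) (z : ℂ) :
    csCoef z n * starRingEnd ℂ (csCoef z k) =
      (coef n : ℂ) * coef k * ((Phi z : ℂ) ^ 2 * z ^ n * (starRingEnd ℂ z) ^ k) := by
  simp only [csCoef, map_mul, map_pow, Complex.conj_ofReal]
  ring

theorem continuous_csCoef (n : ℕ) : Continuous fun z => csCoef z n := by
  unfold csCoef Phi
  fun_prop

theorem integrable_csCoef_mul_conj (n k : ℕ) :
    Integrable fun z : ℂ => csCoef z n * starRingEnd ℂ (csCoef z k) := by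
  simp only [csCoef_mul_conj]
  exact (integrable_moment n k).const_mul _

theorem memLp_conj_csCoef (n : ℕ) :
    MemLp (fun z => starRingEnd ℂ (csCoef z n)) 2 (volume : Measure ℂ) := by
  have hc : Continuous fun z => starRingEnd ℂ (csCoef z n) :=
    Complex.continuous_conj.comp (continuous_csCoef n)
  rw [memLp_two_iff_integrable_sq_norm hc.aestronglyMeasurable]
  refine (integrable_csCoef_mul_conj n n).norm.congr (Eventually.of_forall fun z => ?_)
  simp only [norm_mul, RCLike.norm_conj]
  ring

theorem memLp_re_mul_conj_csCoef (n : ℕ) :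
    MemLp (fun z : ℂ => (z.re : ℂ) * starRingEnd ℂ (csCoef z n)) 2 (volume : Measure ℂ) := by
  have hc : Continuous fun z : ℂ => (z.re : ℂ) * starRingEnd ℂ (csCoef z n) :=
    (Complex.continuous_ofReal.comp Complex.continuous_re).mul
      (Complex.continuous_conj.comp (continuous_csCoef n))
  rw [memLp_two_iff_integrable_sq_norm hc.aestronglyMeasurable]
  refine (((integrable_re_sq_moment n n).1.const_mul ((coef n : ℂ) * coef n)).norm).congr
    (Eventually.of_forall fun z => ?_)
  have h := congrArg norm (csCoef_mul_conj n n z)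
  simp only [norm_mul, RCLike.norm_conj, norm_pow] at h ⊢
  linear_combination (-‖(z.re : ℂ)‖ ^ 2) * h

/-- The function `z ↦ ⟨ψ_z, ψₙ⟩`. -/
def bargmann (n : ℕ) : L2C := (memLp_conj_csCoef n).toLp _

/-- The function `z ↦ x ⟨ψ_z, ψₙ⟩`, `x = Re z`. -/
def bargmannRe (n : ℕ) : L2C := (memLp_re_mul_conj_csCoef n).toLp _

theorem inner_bargmann (n k : ℕ) (t : ℝ) :
    (inner ℂ (bargmann n) (bargmann k) : ℂ) = Real.pi * inner ℂ (psi n t) (psi k t) := by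
  have h : (inner ℂ (bargmann n) (bargmann k) : ℂ) =
      ∫ z : ℂ, csCoef z n * starRingEnd ℂ (csCoef z k) := by
    rw [L2.inner_def]
    refine integral_congr_ae ?_
    filter_upwards [(memLp_conj_csCoef n).coeFn_toLp, (memLp_conj_csCoef k).coeFn_toLp]
      with z h1 h2
    rw [bargmann, bargmann, h1, h2, RCLike.inner_apply, Complex.conj_conj, mul_comm]
  rw [h, inner_psi]
  simp only [csCoef_mul_conj]
  rw [integral_const_mul, integral_moment]
  split_ifs with hnk
  · subst hnk
    linear_combination (Real.pi : ℂ) * coef_sq_mul_factorial n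
  · simp

theorem inner_bargmannRe (a : ℝ) (n k : ℕ) (t : ℝ) :
    (inner ℂ (bargmannRe n) (bargmannRe k) : ℂ) +
      (a ^ 2 - 1 / 4 : ℂ) * inner ℂ (bargmann n) (bargmann k) =
      Real.pi * inner ℂ (phi a n t) (phi a k t) := by
  have h0 : (inner ℂ (bargmann n) (bargmann k) : ℂ) =
      (coef n : ℂ) * coef k * ∫ z : ℂ, (Phi z : ℂ) ^ 2 * z ^ n * (starRingEnd ℂ z) ^ k := by
    rw [inner_bargmann n k 0, inner_psi, integral_moment]
    split_ifs with hnk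
    · subst hnk
      linear_combination (-Real.pi : ℂ) * coef_sq_mul_factorial n
    · simp
  have h : (inner ℂ (bargmannRe n) (bargmannRe k) : ℂ) = (coef n : ℂ) * coef k *
      ∫ z : ℂ, (z.re : ℂ) ^ 2 * ((Phi z : ℂ) ^ 2 * z ^ n * (starRingEnd ℂ z) ^ k) := by
    rw [L2.inner_def, ← integral_const_mul]
    refine integral_congr_ae ?_
    filter_upwards [(memLp_re_mul_conj_csCoef n).coeFn_toLp,
      (memLp_re_mul_conj_csCoef k).coeFn_toLp] with z h1 h2
    rw [bargmannRe, bargmannRe, h1, h2, RCLike.inner_apply, map_mul, Complex.conj_conj,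
      Complex.conj_ofReal]
    linear_combination (z.re : ℂ) ^ 2 * csCoef_mul_conj n k z
  have h2 : (inner ℂ (phi a n t) (phi a k t) : ℂ) = inner ℂ (psi n t) (gPsi a k t) := by
    rw [← toL2_darbouxS_psiS, ← toL2_darbouxS_psiS, inner_darbouxS_darbouxS, toL2_psiS,
      toL2_gZeroS_psiS]
  rw [h, h0, h2, ← coef_mul_integral_eq]
  ring

/-- For a weakly defined family `κ`, the relation `F = (z ↦ ⟨κ z, v⟩)` is closed in `v` and `F`. -/
theorem isClosed_ae_eq_inner (κ : ℂ → L2) :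
    IsClosed {p : L2 × L2C | (p.2 : ℂ → ℂ) =ᵐ[volume] fun z => inner ℂ (κ z) p.1} := by
  refine IsSeqClosed.isClosed fun u p hu hp => ?_
  have h1 : Tendsto (fun j => (u j).1) atTop (𝓝 p.1) := (continuous_fst.tendsto p).comp hp
  have h2 : Tendsto (fun j => (u j).2) atTop (𝓝 p.2) := (continuous_snd.tendsto p).comp hp
  -- A subsequence converges almost everywhere, while the inner products converge at every z; no
  -- measurability of κ is needed.
  obtain ⟨ns, hns, hae⟩ := (tendstoInMeasure_of_tendsto_Lp h2).exists_seq_tendsto_ae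
  have hall : ∀ᵐ z : ℂ, ∀ j, ((u j).2 : ℂ → ℂ) z = inner ℂ (κ z) (u j).1 :=
    ae_all_iff.mpr hu
  filter_upwards [hae, hall] with z hz1 hz2
  refine tendsto_nhds_unique hz1 ?_
  simp only [hz2]
  have hc : Continuous fun v : L2 => (inner ℂ (κ z) v : ℂ) := by fun_prop
  exact (hc.tendsto _).comp (h1.comp hns.tendsto_atTop)

theorem inner_psiZ_psi (z : ℂ) (t : ℝ) (n : ℕ) :
    (inner ℂ (psiZ z t) (psi n t) : ℂ) = starRingEnd ℂ (csCoef z n) := by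
  rw [← inner_conj_symm]
  congr 1
  have h := (hasSum_psiZ z t).mapL (innerSL ℂ (psi n t))
  simp only [map_smul, innerSL_apply_apply, inner_psi, smul_eq_mul, mul_ite, mul_one,
    mul_zero] at h
  refine h.unique ?_
  have h2 := hasSum_single (f := fun k => if n = k then csCoef z k else 0) n
    fun k hk => if_neg hk.symm
  simpa using h2

/-- The span of the `(ψₙ, L ψₙ, ⟨ψ_z, ψₙ⟩, x ⟨ψ_z, ψₙ⟩)`. -/
def bargmannSpan (a t : ℝ) : Submodule ℂ (L2 × L2 × L2C × L2C) :=
  Submodule.span ℂ (Set.range fun n => (psi n t, phi a n t, bargmann n, bargmannRe n))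

theorem inner_bargmannSpan (a t : ℝ) {p q : L2 × L2 × L2C × L2C} (hp : p ∈ bargmannSpan a t)
    (hq : q ∈ bargmannSpan a t) :
    (inner ℂ p.2.2.1 q.2.2.1 : ℂ) = Real.pi * inner ℂ p.1 q.1 ∧
    (inner ℂ p.2.2.2 q.2.2.2 : ℂ) + (a ^ 2 - 1 / 4 : ℂ) * inner ℂ p.2.2.1 q.2.2.1 =
      Real.pi * inner ℂ p.2.1 q.2.1 := by
  induction hp, hq using Submodule.span_induction₂ with
  | mem_mem x y hx hy =>
    obtain ⟨n, rfl⟩ := hx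
    obtain ⟨k, rfl⟩ := hy
    exact ⟨inner_bargmann n k t, inner_bargmannRe a n k t⟩
  | zero_left y hy => simp
  | zero_right x hx => simp
  | add_left x y z hx hy hz h1 h2 =>
    simp only [Prod.fst_add, Prod.snd_add, inner_add_left]
    exact ⟨by linear_combination h1.1 + h2.1, by linear_combination h1.2 + h2.2⟩
  | add_right x y z hx hy hz h1 h2 =>
    simp only [Prod.fst_add, Prod.snd_add, inner_add_right]
    exact ⟨by linear_combination h1.1 + h2.1, by linear_combination h1.2 + h2.2⟩
  | smul_left r x y hx hy h =>
    simp only [Prod.smul_fst, Prod.smul_snd, inner_smul_left]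
    exact ⟨by linear_combination (starRingEnd ℂ r) * h.1,
      by linear_combination (starRingEnd ℂ r) * h.2⟩
  | smul_right r x y hx hy h =>
    simp only [Prod.smul_fst, Prod.smul_snd, inner_smul_right]
    exact ⟨by linear_combination r * h.1, by linear_combination r * h.2⟩

/-- The identity known on the basis is sesquilinear and continuous in all components, so it passes
to the closure in one argument at a time. -/
theorem inner_bargmannClosure (a t : ℝ) {p q : L2 × L2 × L2C × L2C}
    (hp : p ∈ (bargmannSpan a t).topologicalClosure)
    (hq : q ∈ (bargmannSpan a t).topologicalClosure) :
    (inner ℂ p.2.2.2 q.2.2.2 : ℂ) + (a ^ 2 - 1 / 4 : ℂ) * inner ℂ p.2.2.1 q.2.2.1 =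
      Real.pi * inner ℂ p.2.1 q.2.1 := by
  have h1 : ∀ p ∈ bargmannSpan a t, ∀ q ∈ (bargmannSpan a t).topologicalClosure,
      (inner ℂ p.2.2.2 q.2.2.2 : ℂ) + (a ^ 2 - 1 / 4 : ℂ) * inner ℂ p.2.2.1 q.2.2.1 =
      Real.pi * inner ℂ p.2.1 q.2.1 := by
    intro p hp q hq
    have hcl : IsClosed {q : L2 × L2 × L2C × L2C |
        (inner ℂ p.2.2.2 q.2.2.2 : ℂ) + (a ^ 2 - 1 / 4 : ℂ) * inner ℂ p.2.2.1 q.2.2.1 =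
        Real.pi * inner ℂ p.2.1 q.2.1} := isClosed_eq (by fun_prop) (by fun_prop)
    exact closure_minimal (fun q hq => (inner_bargmannSpan a t hp hq).2) hcl hq
  have hcl : IsClosed {p : L2 × L2 × L2C × L2C |
      (inner ℂ p.2.2.2 q.2.2.2 : ℂ) + (a ^ 2 - 1 / 4 : ℂ) * inner ℂ p.2.2.1 q.2.2.1 =
      Real.pi * inner ℂ p.2.1 q.2.1} := isClosed_eq (by fun_prop) (by fun_prop)
  exact closure_minimal (fun p hp => h1 p hp q hq) hcl hp

theorem norm_sq_bargmannSpan (a t : ℝ) {p : L2 × L2 × L2C × L2C} (hp : p ∈ bargmannSpan a t) :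
    ‖p.2.2.1‖ ^ 2 = Real.pi * ‖p.1‖ ^ 2 ∧
    ‖p.2.2.2‖ ^ 2 + (a ^ 2 - 1 / 4) * ‖p.2.2.1‖ ^ 2 = Real.pi * ‖p.2.1‖ ^ 2 := by
  have h := inner_bargmannSpan a t hp hp
  simp only [inner_self_eq_norm_sq_to_K, Complex.coe_algebraMap] at h
  obtain ⟨h1, h2⟩ := h
  refine ⟨by exact_mod_cast h1, ?_⟩
  apply Complex.ofReal_injective
  push_cast
  exact h2

/-- Writing F, G for the two transforms of v and u for Lv, ‖F‖² = π‖v‖² ≤ 4m² and ‖G‖² = π‖u‖² +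
(1/4 - a²)‖F‖² ≤ 5m². Both lie below (3m)², whatever the sign of a² - 1/4. -/
theorem norm_bargmannSpan_le (a t : ℝ) {p : L2 × L2 × L2C × L2C} (hp : p ∈ bargmannSpan a t) :
    ‖p‖ ≤ 3 * ‖(p.1, p.2.1)‖ := by
  obtain ⟨h1, h2⟩ := norm_sq_bargmannSpan a t hp
  have hpi := Real.pi_le_four
  have hpi0 := Real.pi_pos
  set m := ‖(p.1, p.2.1)‖
  have hm1 : ‖p.1‖ ≤ m := le_max_left _ _
  have hm2 : ‖p.2.1‖ ≤ m := le_max_right _ _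
  have hm0 : 0 ≤ m := norm_nonneg _
  have hs1 : ‖p.1‖ ^ 2 ≤ m ^ 2 := by gcongr
  have hs2 : ‖p.2.1‖ ^ 2 ≤ m ^ 2 := by gcongr
  have hs3 : Real.pi * ‖p.1‖ ^ 2 ≤ 4 * m ^ 2 := by gcongr
  have hs4 : Real.pi * ‖p.2.1‖ ^ 2 ≤ 4 * m ^ 2 := by gcongr
  have h3 : ‖p.2.2.1‖ ≤ 3 * m := le_of_sq_le_sq (by nlinarith) (by positivity)
  have h4 : ‖p.2.2.2‖ ≤ 3 * m := le_of_sq_le_sq (by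
    nlinarith [sq_nonneg (a * ‖p.2.2.1‖), sq_nonneg m]) (by positivity)
  refine max_le (by linarith) (max_le (by linarith) (max_le h3 h4))

/-- `L̄ v = u` has square integrable coherent-state transforms of `v`, also with the weight `x`. -/
theorem exists_bargmannClosure {a : ℝ} (ha : 0 < a) (t : ℝ) {p : L2 × L2}
    (hp : p ∈ darbouxGraph a) :
    ∃ F G : L2C, (p.1, p.2, F, G) ∈ (bargmannSpan a t).topologicalClosure := by
  set π₂ : L2 × L2 × L2C × L2C →L[ℂ] L2 × L2 :=
    (ContinuousLinearMap.fst ℂ L2 (L2 × L2C × L2C)).prod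
      ((ContinuousLinearMap.fst ℂ L2 (L2C × L2C)).comp
        (ContinuousLinearMap.snd ℂ L2 (L2 × L2C × L2C))) with hπ
  have h : ((bargmannSpan a t).map (π₂ : _ →ₗ[ℂ] L2 × L2)).topologicalClosure =
      darbouxGraph a := by
    rw [darbouxGraph, ← topologicalClosure_map_congr (topologicalClosure_tripleSpan ha t)]
    rw [tripleSpan, bargmannSpan, Submodule.map_span, Submodule.map_span, ← Set.range_comp,
      ← Set.range_comp]
    congr 3
    funext n
    simp [hπ, projDarboux_apply, tripleS_apply, toL2_psiS, toL2_darbouxS_psiS]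
  rw [← h] at hp
  obtain ⟨q, hq, rfl⟩ := exists_mem_topologicalClosure_of_bounded_below (bargmannSpan a t) π₂
    (C := 3) (fun q hq => norm_bargmannSpan_le a t hq) hp
  exact ⟨q.2.2.1, q.2.2.2, hq⟩

theorem ae_eq_of_bargmannClosure (a t : ℝ) {p : L2 × L2 × L2C × L2C}
    (hp : p ∈ (bargmannSpan a t).topologicalClosure) :
    (p.2.2.1 : ℂ → ℂ) =ᵐ[volume] (fun z => inner ℂ (psiZ z t) p.1) ∧
    (p.2.2.2 : ℂ → ℂ) =ᵐ[volume] (fun z => (z.re : ℂ) * inner ℂ (psiZ z t) p.1) := by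
  -- Both claims are the same closedness argument, with κ equal to ψ_z and to xψ_z.
  have key : ∀ (κ : ℂ → L2) (π₂ : L2 × L2 × L2C × L2C →L[ℂ] L2C),
      (∀ n, (π₂ (psi n t, phi a n t, bargmann n, bargmannRe n) : ℂ → ℂ) =ᵐ[volume]
        fun z => inner ℂ (κ z) (psi n t)) →
      (π₂ p : ℂ → ℂ) =ᵐ[volume] fun z => inner ℂ (κ z) p.1 := by
    intro κ π₂ hgen
    have hcl : IsClosed {q : L2 × L2 × L2C × L2C |
        (π₂ q : ℂ → ℂ) =ᵐ[volume] fun z => inner ℂ (κ z) q.1} :=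
      (isClosed_ae_eq_inner κ).preimage (f := fun q : L2 × L2 × L2C × L2C => (q.1, π₂ q))
        (by fun_prop)
    refine closure_minimal (fun q hq => ?_) hcl hp
    refine Submodule.span_induction (p := fun q _ => (π₂ q : ℂ → ℂ) =ᵐ[volume]
      fun z => inner ℂ (κ z) q.1) ?_ ?_ ?_ ?_ hq
    · rintro _ ⟨n, rfl⟩
      exact hgen n
    · rw [map_zero]
      filter_upwards [Lp.coeFn_zero ℂ 2 (volume : Measure ℂ)] with z hz
      rw [hz, Prod.fst_zero, inner_zero_right, Pi.zero_apply]
    · intro x y _ _ hx hy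
      rw [map_add]
      filter_upwards [hx, hy, Lp.coeFn_add (π₂ x) (π₂ y)] with z h1 h2 h3
      rw [h3, Pi.add_apply, h1, h2, Prod.fst_add, inner_add_right]
    · intro c x _ hx
      rw [map_smul]
      filter_upwards [hx, Lp.coeFn_smul c (π₂ x)] with z h1 h3
      rw [h3, Pi.smul_apply, h1, Prod.smul_fst, inner_smul_right, smul_eq_mul]
  constructor
  · refine key (fun z => psiZ z t) ((ContinuousLinearMap.fst ℂ L2C L2C).comp
      ((ContinuousLinearMap.snd ℂ L2 (L2C × L2C)).comp
        (ContinuousLinearMap.snd ℂ L2 (L2 × L2C × L2C)))) fun n => ?_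
    refine (memLp_conj_csCoef n).coeFn_toLp.trans (Eventually.of_forall fun z => ?_)
    simp only [inner_psiZ_psi]
  · have h := key (fun z => (z.re : ℂ) • psiZ z t) ((ContinuousLinearMap.snd ℂ L2C L2C).comp
      ((ContinuousLinearMap.snd ℂ L2 (L2C × L2C)).comp
        (ContinuousLinearMap.snd ℂ L2 (L2 × L2C × L2C)))) fun n => by
          refine (memLp_re_mul_conj_csCoef n).coeFn_toLp.trans (Eventually.of_forall fun z => ?_)
          simp only [inner_smul_left, inner_psiZ_psi, Complex.conj_ofReal]
    refine h.trans (Eventually.of_forall fun z => ?_)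
    simp only [inner_smul_left, Complex.conj_ofReal]

/-! ### The resolution of the identity -/

theorem inner_etaZ {a : ℝ} (ha : 0 < a) (s : ℝ) {v : L2} {u : H1 a s}
    (hv : (v, (u : L2)) ∈ darbouxGraph a) (z : ℂ) (t : ℝ) :
    (inner ℂ u (etaZ a s z t) : ℂ) = inner ℂ v (psiZ z t) := by
  rw [Submodule.coe_inner]
  exact inner_applyM ha s hv (psiZ z t)

/-- The integrand is split into products of the L² functions ⟨ψ_z, v⟩ and x⟨ψ_z, v⟩, so absolute
convergence needs no positivity of the density. -/
theorem integral_resolution {a : ℝ} (ha : 0 < a) (s t : ℝ) (f g : H1 a s) :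
    Integrable (fun z : ℂ => (omegaEta a z.re : ℂ) *
      (inner ℂ f (etaZ a s z t) * inner ℂ (etaZ a s z t) g)) ∧
    ∫ z : ℂ, (omegaEta a z.re : ℂ) *
      (inner ℂ f (etaZ a s z t) * inner ℂ (etaZ a s z t) g) = inner ℂ f g := by
  obtain ⟨v, hv⟩ := exists_darbouxGraph ha f.2
  obtain ⟨w, hw⟩ := exists_darbouxGraph ha g.2
  obtain ⟨F, G, hFG⟩ := exists_bargmannClosure ha t hv
  obtain ⟨F', G', hFG'⟩ := exists_bargmannClosure ha t hw
  have e1 := ae_eq_of_bargmannClosure a t hFG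
  have e2 := ae_eq_of_bargmannClosure a t hFG'
  have hinner := inner_bargmannClosure a t hFG hFG'
  simp only at e1 e2 hinner
  have i1 : Integrable fun z : ℂ => inner ℂ (G z) (G' z) := L2.integrable_inner G G'
  have i0 : Integrable fun z : ℂ => inner ℂ (F z) (F' z) := L2.integrable_inner F F'
  have hpi : (Real.pi : ℂ) ≠ 0 := by exact_mod_cast Real.pi_ne_zero
  have hae : (fun z : ℂ => (Real.pi : ℂ)⁻¹ * (inner ℂ (G z) (G' z) +
      (a ^ 2 - 1 / 4 : ℂ) * inner ℂ (F z) (F' z))) =ᵐ[volume]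
      fun z => (omegaEta a z.re : ℂ) *
        (inner ℂ f (etaZ a s z t) * inner ℂ (etaZ a s z t) g) := by
    filter_upwards [e1.1, e1.2, e2.1, e2.2] with z h1 h2 h3 h4
    rw [h1, h2, h3, h4, inner_etaZ ha s hv, ← inner_conj_symm (etaZ a s z t) g,
      inner_etaZ ha s hw, inner_conj_symm, RCLike.inner_apply, RCLike.inner_apply, map_mul,
      inner_conj_symm, Complex.conj_ofReal, omegaEta]
    push_cast
    ring
  have i01 := i0.const_mul (a ^ 2 - 1 / 4 : ℂ)
  refine ⟨((i1.add i01).const_mul _).congr hae, ?_⟩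
  rw [← integral_congr_ae hae, integral_const_mul, integral_add i1 i01, integral_const_mul,
    ← L2.inner_def, ← L2.inner_def, hinner, inv_mul_cancel_left₀ hpi, Submodule.coe_inner]

theorem integrable_withDensity_ofReal {w : ℂ → ℝ} (hw : Continuous w) {f : ℂ → ℂ}
    (hf : Integrable fun z => (w z : ℂ) * f z) :
    Integrable f (volume.withDensity fun z => ENNReal.ofReal (w z)) ∧
    ∫ z, f z ∂(volume.withDensity fun z => ENNReal.ofReal (w z)) =
      ∫ z in {z | 0 < w z}, (w z : ℂ) * f z := by
  have hm : MeasurableSet {z | 0 < w z} := (isOpen_lt continuous_const hw).measurableSet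
  have h : (fun z => (w z).toNNReal • f z) =
      {z | 0 < w z}.indicator fun z => (w z : ℂ) * f z := by
    funext z
    by_cases hz : 0 < w z
    · rw [Set.indicator_of_mem (s := {z | 0 < w z}) hz, NNReal.smul_def,
        Real.coe_toNNReal _ hz.le, Complex.real_smul]
    · rw [Set.indicator_of_notMem (s := {z | 0 < w z}) hz, Real.toNNReal_of_nonpos (not_lt.mp hz),
        zero_smul]
  have hmeas : Measurable fun z => (w z).toNNReal := hw.measurable.real_toNNReal
  constructor
  · refine (integrable_withDensity_iff_integrable_smul (μ := volume) hmeas).mpr ?_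
    rw [h]
    exact hf.indicator hm
  · have := integral_withDensity_eq_integral_smul (μ := (volume : Measure ℂ)) hmeas f
    refine this.trans ?_
    rw [h, integral_indicator hm]

theorem ofDensity_integral {w : ℂ → ℝ} (hw : Continuous w) {f : ℂ → ℂ}
    (hf : Integrable fun z => (w z : ℂ) * f z) :
    (SignedRadonMeasure.ofDensity w hw).AbsIntegrable f ∧
    (SignedRadonMeasure.ofDensity w hw).integral f = ∫ z, (w z : ℂ) * f z := by
  have h1 := integrable_withDensity_ofReal hw hf
  have hf' : Integrable fun z => (((-w) z : ℝ) : ℂ) * f z := by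
    simpa using hf.neg
  have h2 := integrable_withDensity_ofReal hw.neg hf'
  refine ⟨⟨h1.1, h2.1⟩, ?_⟩
  unfold SignedRadonMeasure.integral
  refine (congrArg₂ _ h1.2 h2.2).trans ?_
  have hm1 : MeasurableSet {z | 0 < w z} := (isOpen_lt continuous_const hw).measurableSet
  have hm2 : MeasurableSet {z | 0 < (-w) z} := (isOpen_lt continuous_const hw.neg).measurableSet
  rw [← integral_indicator hm1, ← integral_indicator hm2,
    ← integral_sub (hf.indicator hm1) (hf'.indicator hm2)]
  congr 1 with z
  rcases lt_trichotomy (w z) 0 with hz | hz | hz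
  · rw [Set.indicator_of_notMem (by simpa using hz.le), Set.indicator_of_mem (by simpa using hz), Pi.neg_apply]
    push_cast
    ring
  · rw [Set.indicator_of_notMem (by simp [hz]), Set.indicator_of_notMem (by simp [hz]), hz]
    simp
  · rw [Set.indicator_of_mem (by simpa using hz), Set.indicator_of_notMem (by simpa using hz.le)]
    simp

theorem resolvesIdentity_muEta {a : ℝ} (ha : 0 < a) (s t : ℝ) :
    (muEta a).ResolvesIdentity fun z => etaZ a s z t := by
  intro f g
  have h := integral_resolution ha s t f g
  have h2 := ofDensity_integral (w := fun z => omegaEta a z.re)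
    (by unfold omegaEta; fun_prop) h.1
  exact ⟨h2.1, h2.2.trans h.2⟩

/-! ### Signed Radon measures with prescribed Gaussian characteristic function -/

/-- The character `z ↦ exp (2 i Im (w̄ z))`, with the Gaussian weight `Φ(z)²`. -/
def gaussChar (w z : ℂ) : ℂ :=
  (Phi z : ℂ) ^ 2 * Complex.exp ((2 * (starRingEnd ℂ w * z).im : ℝ) * Complex.I)

/-- The Gaussian weight `Φ²`. -/
def phiSq (z : ℂ) : NNReal := ⟨Phi z ^ 2, sq_nonneg _⟩

theorem phiSq_pos (z : ℂ) : 0 < phiSq z := by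
  have : 0 < Phi z ^ 2 := pow_pos (Real.exp_pos _) 2
  exact this

theorem measurable_phiSq : Measurable phiSq := by
  refine Measurable.subtype_mk ?_
  unfold Phi
  fun_prop

theorem phiSq_smul (z c : ℂ) : phiSq z • c = (Phi z : ℂ) ^ 2 * c := by
  rw [NNReal.smul_def, Complex.real_smul]
  congr 1; exact Complex.ofReal_pow _ _

/-- At w = 0 the character is 1, so integrability says exactly that Φ² has finite integral. -/
theorem isFiniteMeasure_withDensity_phiSq {m : Measure ℂ} (h : Integrable (gaussChar 0) m) :
    IsFiniteMeasure (m.withDensity fun z => (phiSq z : ENNReal)) := by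
  have h1 : Integrable (fun _ : ℂ => (1 : ℂ)) (m.withDensity fun z => (phiSq z : ENNReal)) := by
    rw [integrable_withDensity_iff_integrable_smul measurable_phiSq]
    refine h.congr (Eventually.of_forall fun z => ?_)
    simp only [phiSq_smul, gaussChar]
    simp
  rw [integrable_const_iff] at h1
  simpa using h1

/-- The label w = (Im y - i Re y)/2 is chosen so that 2 Im(w̄z) is the real inner product of z and
y. -/
theorem charFun_withDensity_phiSq (m : Measure ℂ) (y : ℂ) :
    charFun (m.withDensity fun z => (phiSq z : ENNReal)) y =
      ∫ z, gaussChar (⟨y.im / 2, -y.re / 2⟩) z ∂m := by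
  rw [charFun_apply, integral_withDensity_eq_integral_smul measurable_phiSq]
  congr 1 with z
  rw [phiSq_smul, gaussChar]
  congr 4
  simp [Complex.inner]
  ring

/-- Adding the negative parts crosswise turns an equality of signed measures into one of positive
measures. With the weight Φ² these are finite and determined by their characteristic functions; the
weight is positive and can be divided out. -/
theorem SignedRadonMeasure.add_eq_add_of_integral_eq {μ ν : SignedRadonMeasure Set.univ}
    (hμ : ∀ w, μ.AbsIntegrable (gaussChar w)) (hν : ∀ w, ν.AbsIntegrable (gaussChar w))
    (h : ∀ w, μ.integral (gaussChar w) = ν.integral (gaussChar w)) :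
    μ.pos + ν.neg = μ.neg + ν.pos := by
  have i1 := fun w => (hμ w).1.add_measure (hν w).2
  have i2 := fun w => (hμ w).2.add_measure (hν w).1
  have f1 := isFiniteMeasure_withDensity_phiSq (i1 0)
  have f2 := isFiniteMeasure_withDensity_phiSq (i2 0)
  have hc : (μ.pos + ν.neg).withDensity (fun z => (phiSq z : ENNReal)) =
      (μ.neg + ν.pos).withDensity (fun z => (phiSq z : ENNReal)) := by
    refine Measure.ext_of_charFun (funext fun y => ?_)
    rw [charFun_withDensity_phiSq, charFun_withDensity_phiSq,
      integral_add_measure (hμ _).1 (hν _).2, integral_add_measure (hμ _).2 (hν _).1]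
    have := h ⟨y.im / 2, -y.re / 2⟩
    unfold SignedRadonMeasure.integral at this
    linear_combination this
  have hm : Measurable fun z => (phiSq z : ENNReal) := measurable_phiSq.coe_nnreal_ennreal
  have hinv := fun m : Measure ℂ => withDensity_inv_same (μ := m) hm
    (Eventually.of_forall fun z => by simpa using (phiSq_pos z).ne')
    (Eventually.of_forall fun z => by simp)
  rw [← hinv (μ.pos + ν.neg), hc, hinv]

theorem SignedRadonMeasure.value_eq_of_add_eq_add {μ ν : SignedRadonMeasure Set.univ}
    (h : μ.pos + ν.neg = μ.neg + ν.pos) {B : Set ℂ} (hB : Bornology.IsBounded B) :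
    μ.value B = ν.value B := by
  have hK : IsCompact (closure B) := hB.isCompact_closure
  have hfin : ∀ m : Measure ℂ, m (closure B) < ⊤ → m B ≠ ⊤ := fun m hm =>
    ((measure_mono subset_closure).trans_lt hm).ne
  have e1 := hfin _ (μ.pos_lt_top _ (Set.subset_univ _) hK)
  have e2 := hfin _ (μ.neg_lt_top _ (Set.subset_univ _) hK)
  have e3 := hfin _ (ν.pos_lt_top _ (Set.subset_univ _) hK)
  have e4 := hfin _ (ν.neg_lt_top _ (Set.subset_univ _) hK)
  have h1 := congrArg (fun m : Measure ℂ => (m B).toReal) h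
  simp only [Measure.add_apply] at h1
  rw [ENNReal.toReal_add e1 e4, ENNReal.toReal_add e2 e3] at h1
  unfold SignedRadonMeasure.value
  linarith

theorem ofDensity_value {w : ℂ → ℝ} (hw : Continuous w) {B : Set ℂ} (hm : MeasurableSet B)
    (hB : Bornology.IsBounded B) :
    (SignedRadonMeasure.ofDensity w hw).value B = ∫ z in B, w z := by
  have hint : IntegrableOn w B :=
    (hw.continuousOn.integrableOn_compact hB.isCompact_closure).mono_set subset_closure
  rw [integral_eq_lintegral_pos_part_sub_lintegral_neg_part hint]
  unfold SignedRadonMeasure.value SignedRadonMeasure.ofDensity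
  simp only [withDensity_apply _ hm]

/-! ### Uniqueness of the measure -/

theorem inner_psiZ_psiZ (z w : ℂ) (t : ℝ) :
    (inner ℂ (psiZ w t) (psiZ z t) : ℂ) =
      (Phi w : ℂ) * Phi z * Complex.exp (starRingEnd ℂ w * z) := by
  have h := (hasSum_psiZ z t).mapL (innerSL ℂ (psiZ w t))
  simp only [map_smul, innerSL_apply_apply, inner_psiZ_psi, smul_eq_mul] at h
  have h2 := (NormedSpace.expSeries_div_hasSum_exp (starRingEnd ℂ w * z)).mul_left
    ((Phi w : ℂ) * Phi z)
  rw [← Complex.exp_eq_exp_ℂ] at h2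
  refine h.unique (h2.congr_fun fun n => ?_)
  have e := coef_sq_mul_factorial n
  have hn : (n.factorial : ℂ) ≠ 0 := by exact_mod_cast n.factorial_ne_zero
  simp only [csCoef, map_mul, map_pow, Complex.conj_ofReal]
  field_simp
  linear_combination ((Phi z : ℂ) * Phi w * z ^ n * (starRingEnd ℂ w) ^ n) * e

/-- ψ_z is in the domain of L̄ because its coefficients are summable against n + 1; so L̄ψ_w may
serve as a test vector in H₁. -/
theorem exists_darbouxGraph_psiZ {a : ℝ} (ha : 0 < a) (z : ℂ) (t : ℝ) :
    ∃ u, (psiZ z t, u) ∈ darbouxGraph a := by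
  obtain ⟨Y, hY⟩ := summable_smul_tripleS ha t (summable_csCoef z)
  have hmem : Y ∈ tripleGraph a := by
    refine (Submodule.isClosed_topologicalClosure _).mem_of_tendsto hY
      (Eventually.of_forall fun S => ?_)
    refine Submodule.le_topologicalClosure _ (Submodule.sum_mem _ fun n _ => ?_)
    exact Submodule.smul_mem _ _ ⟨psiS n t, rfl⟩
  have h1 := hY.mapL (ContinuousLinearMap.fst ℂ L2 (L2 × L2))
  simp only [map_smul, ContinuousLinearMap.coe_fst', tripleS_apply, toL2_psiS] at h1
  refine ⟨Y.2.1, ?_⟩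
  rw [(hasSum_psiZ z t).unique h1]
  exact darbouxGraph_of_tripleGraph hmem

theorem mem_H1_of_darbouxGraph {a : ℝ} (ha : 0 < a) (s : ℝ) {p : L2 × L2}
    (hp : p ∈ darbouxGraph a) : p.2 ∈ H1 a s := by
  rw [H1_eq_closure ha]
  refine closure_mono ?_ (map_topologicalClosure_le _ (ContinuousLinearMap.snd ℂ L2 L2) hp)
  rintro _ ⟨_, ⟨q, hq, rfl⟩, rfl⟩
  exact ⟨q, hq, rfl⟩

theorem psi_phi_mem_darbouxGraph (a : ℝ) (n : ℕ) (t : ℝ) :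
    (psi n t, phi a n t) ∈ darbouxGraph a := by
  have h : tripleS a (psiS n t) ∈ tripleGraph a :=
    Submodule.le_topologicalClosure _ ⟨psiS n t, rfl⟩
  have h2 := darbouxGraph_of_tripleGraph h
  rwa [tripleS_apply, toL2_psiS, toL2_darbouxS_psiS] at h2

theorem inner_etaZ_right {a : ℝ} (ha : 0 < a) (s : ℝ) {v : L2} {u : H1 a s}
    (hv : (v, (u : L2)) ∈ darbouxGraph a) (z : ℂ) (t : ℝ) :
    (inner ℂ (etaZ a s z t) u : ℂ) = inner ℂ (psiZ z t) v := by
  rw [← inner_conj_symm (etaZ a s z t) u, inner_etaZ ha s hv, inner_conj_symm]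

/-! ### Testing the resolution on coherent states and on basis vectors. -/

theorem SignedRadonMeasure.absIntegrable_const_mul_iff {μ : SignedRadonMeasure Set.univ} {c : ℂ}
    (hc : c ≠ 0) {f : ℂ → ℂ} :
    μ.AbsIntegrable (fun z => c * f z) ↔ μ.AbsIntegrable f :=
  and_congr (integrable_const_mul_iff hc.isUnit f) (integrable_const_mul_iff hc.isUnit f)

theorem SignedRadonMeasure.integral_const_mul (μ : SignedRadonMeasure Set.univ) (c : ℂ)
    (f : ℂ → ℂ) : μ.integral (fun z => c * f z) = c * μ.integral f := by
  unfold SignedRadonMeasure.integral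
  rw [MeasureTheory.integral_const_mul, MeasureTheory.integral_const_mul, mul_sub]

theorem Phi_ne_zero (z : ℂ) : (Phi z : ℂ) ≠ 0 := by
  have : 0 < Phi z := Real.exp_pos _
  exact_mod_cast this.ne'

/-- Opposite labels w and -w make the exponent w̄z - z̄w = 2i Im(w̄z) purely imaginary. The constant
c is chosen before μ, so it is common to all resolving measures. -/
theorem resolution_gaussChar {a : ℝ} (ha : 0 < a) (s t : ℝ) (w : ℂ) :
    ∃ c : ℂ, ∀ μ : SignedRadonMeasure Set.univ, (μ.ResolvesIdentity fun z => etaZ a s z t) →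
      μ.AbsIntegrable (gaussChar w) ∧ μ.integral (gaussChar w) = c := by
  obtain ⟨u, hu⟩ := exists_darbouxGraph_psiZ ha w t
  obtain ⟨u', hu'⟩ := exists_darbouxGraph_psiZ ha (-w) t
  set f : H1 a s := ⟨u, mem_H1_of_darbouxGraph ha s hu⟩
  set g : H1 a s := ⟨u', mem_H1_of_darbouxGraph ha s hu'⟩
  set k : ℂ := (Phi w : ℂ) * Phi (-w) with hk
  have hk0 : k ≠ 0 := mul_ne_zero (Phi_ne_zero _) (Phi_ne_zero _)
  have hfun : (fun z => (inner ℂ f (etaZ a s z t) * inner ℂ (etaZ a s z t) g : ℂ)) =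
      fun z => k * gaussChar w z := by
    funext z
    rw [inner_etaZ ha s (u := f) hu, inner_etaZ_right ha s (u := g) hu', inner_psiZ_psiZ,
      inner_psiZ_psiZ, gaussChar]
    have h1 : (((2 * (starRingEnd ℂ w * z).im : ℝ) : ℂ) * Complex.I) =
        starRingEnd ℂ w * z + starRingEnd ℂ z * (-w) := by
      apply Complex.ext <;> simp <;> ring
    rw [h1, Complex.exp_add, hk]
    ring
  refine ⟨k⁻¹ * inner ℂ f g, fun μ hμ => ?_⟩
  have h := hμ f g
  simp only at h
  rw [hfun, SignedRadonMeasure.absIntegrable_const_mul_iff hk0,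
    SignedRadonMeasure.integral_const_mul] at h
  exact ⟨h.1, by rw [← h.2, inv_mul_cancel_left₀ hk0]⟩

theorem value_eq_of_resolvesIdentity {a : ℝ} (ha : 0 < a) (s t : ℝ)
    {μ : SignedRadonMeasure Set.univ} (hμ : μ.ResolvesIdentity fun z => etaZ a s z t)
    {B : Set ℂ} (hm : MeasurableSet B) (hB : Bornology.IsBounded B) :
    μ.value B = ∫ z in B, omegaEta a z.re := by
  have hη := resolvesIdentity_muEta ha s t
  choose c hc using resolution_gaussChar ha s t
  have h := SignedRadonMeasure.add_eq_add_of_integral_eq (fun w => (hc w μ hμ).1)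
    (fun w => (hc w _ hη).1) (fun w => (hc w μ hμ).2.trans (hc w _ hη).2.symm)
  rw [SignedRadonMeasure.value_eq_of_add_eq_add h hB]
  exact ofDensity_value (w := fun z => omegaEta a z.re) (by unfold omegaEta; fun_prop) hm hB

theorem solvesMomentProblem_of_resolvesIdentity {a : ℝ} (ha : 0 < a) (s t : ℝ)
    {μ : SignedRadonMeasure Set.univ} (hμ : μ.ResolvesIdentity fun z => etaZ a s z t) :
    SolvesMomentProblem μ (S a t) := by
  intro n k
  have hn := psi_phi_mem_darbouxGraph a n t
  have hk := psi_phi_mem_darbouxGraph a k t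
  set f : H1 a s := ⟨phi a n t, mem_H1_of_darbouxGraph ha s hn⟩
  set g : H1 a s := ⟨phi a k t, mem_H1_of_darbouxGraph ha s hk⟩
  have hc0 : (coef n : ℂ) * coef k ≠ 0 := by
    have h := mul_pos (coef_pos n) (coef_pos k)
    exact_mod_cast h.ne'
  have hfun : (fun z => (inner ℂ f (etaZ a s z t) * inner ℂ (etaZ a s z t) g : ℂ)) =
      fun z => ((coef n : ℂ) * coef k) *
        ((Phi z : ℂ) ^ 2 * z ^ n * (starRingEnd ℂ z) ^ k) := by
    funext z
    rw [inner_etaZ ha s (u := f) hn, inner_etaZ_right ha s (u := g) hk, inner_psiZ_psi,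
      ← inner_conj_symm, inner_psiZ_psi, Complex.conj_conj, csCoef_mul_conj]
  have h := hμ f g
  simp only at h
  rw [hfun, SignedRadonMeasure.absIntegrable_const_mul_iff hc0,
    SignedRadonMeasure.integral_const_mul] at h
  refine ⟨h.1, h.2.trans ?_⟩
  rw [Submodule.coe_inner]
  change (inner ℂ (phi a n t) (phi a k t) : ℂ) = inner ℂ (psi n t) (gPsi a k t)
  rw [← toL2_darbouxS_psiS, ← toL2_darbouxS_psiS, inner_darbouxS_darbouxS, toL2_psiS,
    toL2_gZeroS_psiS]

end DarbouxCS

end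

theorem theorem2 (a : ℝ) (ha : 0 < a) (s : ℝ) :
    -- `M` is defined on the whole of `L²(ℝ)`, and neither `H₁` nor `M` depends on the instant `s`
    ((M a s).domain = ⊤ ∧
      ∀ s' : ℝ, H1 a s' = H1 a s ∧ ∀ f : L2, (applyM a s' f : L2) = (applyM a s f : L2)) ∧
    -- `ψ_z = Φ ∑ aₙ zⁿ ψₙ` and `η_z = M ψ_z = Φ ∑ aₙ zⁿ ηₙ`
    (∀ (z : ℂ) (t : ℝ),
      HasSum (fun n : ℕ => ((Phi z : ℂ) * ((coef n : ℂ) * z ^ n)) • psi n t) (psiZ z t) ∧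
      HasSum (fun n : ℕ => ((Phi z : ℂ) * ((coef n : ℂ) * z ^ n)) • etaN a s n t)
        (etaZ a s z t)) ∧
    -- the `η_z` are coherent states of the soliton Hamiltonian, with the measure `dμ_η`
    IsCoherentSystem (hOne a s) Set.univ (muEta a) (etaZ a s) ∧
    -- `⟨φₙ|φₖ⟩ = ⟨ψₙ|g₀|ψₖ⟩ = S_{nk}`
    (∀ (t : ℝ) (n k : ℕ), inner ℂ (phi a n t) (phi a k t) = S a t n k) ∧
    -- every measure that resolves the identity solves the moment problem and equals `dμ_η`
    ∀ (t : ℝ) (μ : SignedRadonMeasure Set.univ), μ.ResolvesIdentity (fun z => etaZ a s z t) →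
      SolvesMomentProblem μ (S a t) ∧
      ∀ B : Set ℂ, MeasurableSet B → Bornology.IsBounded B →
        μ.value B = ∫ z in B, omegaEta a z.re := by
  refine ⟨⟨M_domain ha s, fun s' => ⟨H1_eq ha s s', fun f => ?_⟩⟩,
    fun z t => ⟨hasSum_psiZ z t, hasSum_etaZ ha s z t⟩,
    ⟨isOpen_univ, isConnected_univ, fun t => resolvesIdentity_muEta ha s t,
      fun z _ t => etaZ_schrodinger ha s z t⟩, fun t n k => ?_,
    fun t μ hμ => ⟨solvesMomentProblem_of_resolvesIdentity ha s t hμ,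
      fun B hm hB => value_eq_of_resolvesIdentity ha s t hμ hm hB⟩⟩
  -- The triple (v, Mf, f) lies in a graph without reference to an instant, so it also computes M at
  -- s'.
  · obtain ⟨v, hv⟩ := exists_applyM ha s f
    exact applyM_eq_of_tripleGraph ha s' hv
  · rw [S, ← toL2_darbouxS_psiS, ← toL2_darbouxS_psiS, inner_darbouxS_darbouxS, toL2_psiS,
      toL2_gZeroS_psiS]
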